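/- Let $\Bbbk$ be a field in which $2\neq 0$ (for instance $\mathbb{C}$). For an oriented link diagram $D$ in the annulus with $n_+$ positive and $n_-$ negative crossings, let $\mathrm{AKh}(D)$ be its annular Khovanov homology over $\Bbbk$, graded by the homological grading $i$, the quantum grading $j$ and the annular grading $k$. It is the homology of the annular Khovanov complex, whose basis consists of the complete smoothings $v$ of $D$ together with a sign $\pm1$ on each circle of the smoothing; if $|v|$ is the number of $1$-smoothings, the gradings are $i=|v|-n_-$, $j=(\text{sum of all signs})+|v|+n_+-2n_-$ and $k=$ sum of the signs of the circles that are essential in the annulus, and the differential is the part of the Khovanov differential that preserves $k$. $\mathrm{AKh}^i$ denotes the $(j,k)$-bigraded part in homological grading $i$. For $n\ge 0$ let $L_n$ be the annular knot that is the closure around the annulus of the following two-strand tangle, drawn in the direction of the core of the annulus: a clasp, followed by $n$ left-handed half twists of the two strands (that is, $\sigma^{-n}$). Here the clasp consists of two crossings placed side by side, the two right ends of the left crossing being joined to the two left ends of the right crossing; and in all $n+2$ crossings, with the tangle drawn vertically, the strand from the lower right to the upper left is the over-strand. (These are the wrapping number $2$ clasp-braids; $L_0$ together with the annular axis is a Whitehead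 link.) Let $V_m$ be the $(m+1)$-dimensional $(j,k)$-bigraded vector space that has dimension one in the bigradings $(k,k)$ for $k=-m,-m+2,\dots,m$, and let $\{b\}$ denote the shift of the quantum grading up by $b$. Let $n\ge1$. If $n$ is even, then, as bigraded vector spaces, $$\mathrm{AKh}^i(L_n)\cong\begin{cases}V_2\{2n-1\}& i=n\\ V_2\{2n-3\}\oplus V_0\{2n-3\}& i=n-1\\ V_0\{2i+1\}\oplus V_0\{2i-1\}& 1\le i\le n-2\\ V_0\{1\}\oplus V_0\{-1\}\oplus V_0\{-1\}& i=0\\ V_0\{-1\}& i=-1\\ V_0\{-5\}& i=-2\\ 0&\text{otherwise.}\end{cases}$$ If $n$ is odd, then $$\mathrm{AKh}^i(L_n)\cong\begin{cases}V_2\{2n+5\}& i=n+2\\ V_2\{2n+3\}\oplus V_0\{2n+3\}& i=n+1\\ V_0\{2i+1\}\oplus V_0\{2i+3\}& 2\le i\le n\\ V_0\{3\}& i=1\\ V_0\{3\}\oplus V_0\{1\}& i=0\\ 0&\text{otherwise.}\end{cases}$$ Finally, $$\mathrm{AKh}^i(L_0)\cong\begin{cases}V_2\{-1\}\oplus V_0\{-1\}&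 i=0\\ V_2\{-3\}& i=-1\\ V_0\{-5\}& i=-2\\ 0&\text{otherwise.}\end{cases}$$ -/

import Mathlib

/-- An oriented link diagram in the annulus, given by a planar-diagram code with `N` crossings and
set of edges `E`.

* `corner c : Fin 4 → E` lists the four edge-ends at the crossing `c` in counterclockwise order,
  starting at an end of the under-strand (so corners `0, 2` are under and `1, 3` are over).
* `out c x` says whether the strand is oriented away from the crossing `c` at its corner `x`.
* `cut e` is the number of times that the edge `e` crosses a fixed ray of the annulus, running from
  the inner to the outer boundary circle and missing the crossings.

An edge that meets no crossing is a crossingless component. -/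
structure AnnularDiagram (N : ℕ) (E : Type) where
  corner : Fin N → Fin 4 → E
  out : Fin N → Fin 4 → Bool
  cut : E → ℕ
  /-- strands go straight through a crossing -/
  through : ∀ c x, out c (x + 2) = !out c x
  /-- an edge that meets a crossing has exactly two ends, one outgoing and one incoming -/
  ends : ∀ c x, ∃! p : Fin N × Fin 4,
    corner p.1 p.2 = corner c x ∧ out p.1 p.2 = !out c x

namespace AnnularDiagram

variable {N : ℕ} {E : Type} (D : AnnularDiagram N E)

/-- A crossing is positive iff its `0`-smoothing is compatible with the orientation. -/
def IsPositive (c : Fin N) : Prop := D.out c 0 ≠ D.out c 1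

instance (c : Fin N) : Decidable (D.IsPositive c) := by unfold IsPositive; infer_instance

/-- `n₊`, the number of positive crossings. -/
def nPlus : ℕ := (Finset.univ.filter fun c => D.IsPositive c).card

/-- `n₋`, the number of negative crossings. -/
def nMinus : ℕ := (Finset.univ.filter fun c => ¬ D.IsPositive c).card

/-- The edges joined at the crossing `c` by its smoothing: the `0`-smoothing (`b = false`) joins
corners `0, 1` and corners `2, 3`; the `1`-smoothing (`b = true`) joins `0, 3` and `1, 2`. -/
def JoinedAt (c : Fin N) (b : Bool) (e f : E) : Prop :=
  if b then (e = D.corner c 0 ∧ f = D.corner c 3) ∨ (e = D.corner c 1 ∧ f = D.corner c 2)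
  else (e = D.corner c 0 ∧ f = D.corner c 1) ∨ (e = D.corner c 2 ∧ f = D.corner c 3)

/-- Lying on the same circle of the complete smoothing `v`. -/
def smoothing (v : Fin N → Bool) : Setoid E :=
  Relation.EqvGen.setoid fun e f => ∃ c, D.JoinedAt c (v c) e f

/-- The circles of the complete smoothing `v`. -/
def Circle (v : Fin N → Bool) : Type := Quotient (D.smoothing v)

/-- The circle of the complete smoothing `v` that contains the edge `e`. -/
def circle (v : Fin N → Bool) (e : E) : D.Circle v := Quotient.mk (D.smoothing v) e

instance [Finite E] (v : Fin N → Bool) : Finite (D.Circle v) :=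
  inferInstanceAs (Finite (Quotient (D.smoothing v)))

noncomputable instance [Finite E] (v : Fin N → Bool) : Fintype (D.Circle v) := Fintype.ofFinite _

/-- A circle in the annulus is essential iff it crosses the ray an odd number of times. -/
def Essential [Fintype E] (v : Fin N → Bool) (z : D.Circle v) : Prop :=
  open scoped Classical in
  Odd (∑ e ∈ Finset.univ.filter (fun e : E => D.circle v e = z), D.cut e)

/-- Enhanced states: a complete smoothing with a sign (`+1` for `v₊`, `-1` for `v₋`) on each of its
circles. They form the standard basis of the annular Khovanov complex. -/
structure EnhancedState where
  v : Fin N → Bool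
  sign : D.Circle v → ℤˣ

namespace EnhancedState

variable {D} [Fintype E]

noncomputable instance : Fintype D.EnhancedState :=
  open scoped Classical in
  Fintype.ofEquiv (Σ v : Fin N → Bool, D.Circle v → ℤˣ)
    ⟨fun p => ⟨p.1, p.2⟩, fun S => ⟨S.v, S.sign⟩, fun _ => rfl, fun _ => rfl⟩

/-- The number of `1`-smoothings. -/
def ones (S : D.EnhancedState) : ℕ := (Finset.univ.filter fun c => S.v c = true).card

/-- Homological grading. -/
def hdeg (S : D.EnhancedState) : ℤ := S.ones - D.nMinus

/-- Quantum grading. -/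
noncomputable def qdeg (S : D.EnhancedState) : ℤ :=
  ∑ z, (S.sign z : ℤ) + S.ones + D.nPlus - 2 * D.nMinus

/-- Annular grading. -/
noncomputable def adeg (S : D.EnhancedState) : ℤ :=
  open scoped Classical in
  ∑ z ∈ Finset.univ.filter (D.Essential S.v), (S.sign z : ℤ)

/-- `T` occurs in the image of `S` under the edge map of the cube of resolutions at `c`: the
smoothing changes from `0` to `1` at `c` only, the circles not passing through `c` keep their signs,
and the quantum and annular gradings are preserved. (Preservation of the quantum grading amounts to
the usual merge and split maps `v₊v₊ ↦ v₊`, `v₊v₋, v₋v₊ ↦ v₋`, `v₋v₋ ↦ 0`, `v₊ ↦ v₊v₋ + v₋v₊`,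
`v₋ ↦ v₋v₋`; preservation of the annular grading selects the annular part of these maps.) -/
def Incident (c : Fin N) (S T : D.EnhancedState) : Prop :=
  S.v c = false ∧ T.v = Function.update S.v c true ∧
  (∀ e, (∀ x, D.circle S.v e ≠ D.circle S.v (D.corner c x)) →
    S.sign (D.circle S.v e) = T.sign (D.circle T.v e)) ∧
  S.qdeg = T.qdeg ∧ S.adeg = T.adeg

/-- The coefficient of `T` in the differential of `S`, with the usual sign
`(-1) ^ #{1-smoothings before c}`. -/
noncomputable def incidence (S T : D.EnhancedState) : ℤ :=
  open scoped Classical in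
  ∑ c, if Incident c S T then
    (-1) ^ (Finset.univ.filter fun c' => c' < c ∧ S.v c' = true).card else 0

end EnhancedState

variable (𝕜 : Type*) [Field 𝕜] [Fintype E]

/-- The enhanced states of trigrading `(i, j, k)`. -/
def StateOf (i j k : ℤ) : Type :=
  {S : D.EnhancedState // S.hdeg = i ∧ S.qdeg = j ∧ S.adeg = k}

noncomputable instance (i j k : ℤ) : Fintype (D.StateOf i j k) :=
  open scoped Classical in
  inferInstanceAs (Fintype {S : D.EnhancedState // S.hdeg = i ∧ S.qdeg = j ∧ S.adeg = k})

/-- The component from trigrading `(i, j, k)` to `(i', j, k)` of the annular Khovanov differential,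
where a chain is the function of its coefficients in the basis of enhanced states. The component is
zero unless `i' = i + 1`. -/
noncomputable def d (i i' j k : ℤ) : (D.StateOf i j k → 𝕜) →ₗ[𝕜] (D.StateOf i' j k → 𝕜) :=
  Matrix.mulVecLin (Matrix.of fun T S => ((EnhancedState.incidence S.1 T.1 : ℤ) : 𝕜))

end AnnularDiagram

/-- Bigraded vector spaces; the first index is the quantum grading `j`, the second one the annular
grading `k`. -/
abbrev Bigraded.{u} (𝕜 : Type u) [Field 𝕜] : Type (u + 1) := ℤ → ℤ → ModuleCat.{u} 𝕜

namespace Bigraded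

universe u

variable {𝕜 : Type u} [Field 𝕜]

/-- Isomorphism of bigraded vector spaces. -/
def Iso (A B : Bigraded 𝕜) : Prop := ∀ j k, Nonempty (A j k ≃ₗ[𝕜] B j k)

/-- Direct sum. -/
def sum (A B : Bigraded 𝕜) : Bigraded 𝕜 := fun j k => ModuleCat.of 𝕜 (A j k × B j k)

/-- `A.shift b` is `A{b}`, the shift of the quantum grading up by `b`. -/
def shift (A : Bigraded 𝕜) (b : ℤ) : Bigraded 𝕜 := fun j k => A (j - b) k

/-- The zero space. -/
def zero (𝕜 : Type u) [Field 𝕜] : Bigraded 𝕜 := fun _ _ => ModuleCat.of 𝕜 PUnit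

/-- `V_m`, of dimension one in the bigradings `(k, k)`, `k = -m, -m + 2, …, m`. -/
def V (𝕜 : Type u) [Field 𝕜] (m : ℕ) : Bigraded 𝕜 := fun j k =>
  if j = k ∧ |k| ≤ m ∧ Even (k - m) then ModuleCat.of 𝕜 𝕜 else ModuleCat.of 𝕜 PUnit

end Bigraded

/-- Annular Khovanov homology in homological grading `i`, as a bigraded vector space: cycles modulo
boundaries of the annular Khovanov complex. (For a code drawn in the annulus every boundary is a
cycle, so that `submoduleOf` merely regards the boundaries as a subspace of the cycles.) -/
noncomputable def AKh.{u} (𝕜 : Type u) [Field 𝕜] {N : ℕ} {E : Type} [Fintype E]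
    (D : AnnularDiagram N E) (i : ℤ) : Bigraded 𝕜 := fun j k =>
  ModuleCat.of 𝕜 (LinearMap.ker (D.d 𝕜 i (i + 1) j k) ⧸
    (LinearMap.range (D.d 𝕜 (i - 1) i j k)).submoduleOf (LinearMap.ker (D.d 𝕜 i (i + 1) j k)))

/-- The edges of the diagram of the clasp-braid `L n`. -/
inductive ClaspEdge (n : ℕ) : Type
  | l (k : Fin (n + 1))
  | r (k : Fin (n + 1))
  | bot
  | top
  deriving DecidableEq, Fintype

namespace ClaspBraid

open ClaspEdge

/-- Ends of the edges at the crossings, in the order SW, SE, NE, NW; see `claspBraid`. -/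
def corner (n : ℕ) : Fin (n + 2) → Fin 4 → ClaspEdge n
  | ⟨0, _⟩ => ![l (Fin.last n), bot, top, l 0]
  | ⟨1, _⟩ => ![bot, r (Fin.last n), r 0, top]
  | ⟨k + 2, h⟩ => ![l ⟨k, by omega⟩, r ⟨k, by omega⟩, r ⟨k + 1, by omega⟩, l ⟨k + 1, by omega⟩]

/-- The orientation for which the strand `l (Fin.last n)` runs upwards (the other one differs by
reversal of the knot, which does not change the signs of the crossings). -/
def out (n : ℕ) : Fin (n + 2) → Fin 4 → Bool
  | ⟨0, _⟩ => ![false, !decide (Even n), true, decide (Even n)]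
  | ⟨1, _⟩ => ![decide (Even n), true, !decide (Even n), false]
  | ⟨k + 2, _⟩ =>
    ![!decide (Even (n + k)), decide (Even (n + k)), decide (Even (n + k)), !decide (Even (n + k))]

end ClaspBraid

namespace ClaspBraid

open ClaspEdge

theorem through (n : ℕ) (c : Fin (n + 2)) (x : Fin 4) : out n c (x + 2) = !out n c x := by
  match c with
  | ⟨0, _⟩ => fin_cases x <;> simp [out]
  | ⟨1, _⟩ => fin_cases x <;> simp [out]
  | ⟨k + 2, _⟩ => fin_cases x <;> simp [out]

theorem ends_injective (n : ℕ) (p q : Fin (n + 2) × Fin 4)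
    (h1 : corner n p.1 p.2 = corner n q.1 q.2) (h2 : out n p.1 p.2 = out n q.1 q.2) : p = q := by
  obtain ⟨⟨c, hc⟩, x⟩ := p
  obtain ⟨⟨c', hc'⟩, y⟩ := q
  rcases c with _ | _ | k <;> rcases c' with _ | _ | m <;> fin_cases x <;> fin_cases y <;>
    simp [corner, out, Fin.ext_iff] at h1 h2 ⊢ <;> grind

theorem ends_exists (n : ℕ) (c : Fin (n + 2)) (x : Fin 4) : ∃ p : Fin (n + 2) × Fin 4,
    corner n p.1 p.2 = corner n c x ∧ out n p.1 p.2 = !out n c x := by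
  have hl : ∀ (k : ℕ) (hk : k < n + 1) (b : Bool), ∃ p : Fin (n + 2) × Fin 4,
      corner n p.1 p.2 = l ⟨k, hk⟩ ∧ out n p.1 p.2 = b := by
    intro k hk b
    by_cases hb : b = decide (Even (n + k))
    · rcases k with _ | k
      · exact ⟨(⟨0, by omega⟩, 3), by simp [corner], by simp [out] at hb ⊢; grind⟩
      · exact ⟨(⟨k + 2, by omega⟩, 3), by simp [corner], by simp [out] at hb ⊢; grind⟩
    · rcases Nat.lt_succ_iff_lt_or_eq.1 hk with h | rfl
      · exact ⟨(⟨k + 2, by omega⟩, 0), by simp [corner], by simp [out] at hb ⊢; grind⟩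
      · exact ⟨(⟨0, by omega⟩, 0), by simp [corner, Fin.last], by simp [out] at hb ⊢; grind⟩
  have hr : ∀ (k : ℕ) (hk : k < n + 1) (b : Bool), ∃ p : Fin (n + 2) × Fin 4,
      corner n p.1 p.2 = r ⟨k, hk⟩ ∧ out n p.1 p.2 = b := by
    intro k hk b
    by_cases hb : b = !decide (Even (n + k))
    · rcases k with _ | k
      · exact ⟨(⟨1, by omega⟩, 2), by simp [corner], by simp [out] at hb ⊢; grind⟩
      · exact ⟨(⟨k + 2, by omega⟩, 2), by simp [corner], by simp [out] at hb ⊢; grind⟩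
    · rcases Nat.lt_succ_iff_lt_or_eq.1 hk with h | rfl
      · exact ⟨(⟨k + 2, by omega⟩, 1), by simp [corner], by simp [out] at hb ⊢; grind⟩
      · exact ⟨(⟨1, by omega⟩, 1), by simp [corner, Fin.last], by simp [out] at hb ⊢; grind⟩
  have hb : ∀ b : Bool, ∃ p : Fin (n + 2) × Fin 4,
      corner n p.1 p.2 = bot ∧ out n p.1 p.2 = b := by
    intro b
    by_cases hb : b = out n ⟨0, by omega⟩ 1
    · exact ⟨(⟨0, by omega⟩, 1), by simp [corner], hb.symm⟩
    · exact ⟨(⟨1, by omega⟩, 0), by simp [corner], by simp [out] at hb ⊢; grind⟩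
  have ht : ∀ b : Bool, ∃ p : Fin (n + 2) × Fin 4,
      corner n p.1 p.2 = top ∧ out n p.1 p.2 = b := by
    intro b
    by_cases hb : b = out n ⟨0, by omega⟩ 2
    · exact ⟨(⟨0, by omega⟩, 2), by simp [corner], hb.symm⟩
    · exact ⟨(⟨1, by omega⟩, 3), by simp [corner], by simp [out] at hb ⊢; grind⟩
  generalize out n c x = b
  rcases corner n c x with ⟨k, hk⟩ | ⟨k, hk⟩ | _ | _
  exacts [hl k hk _, hr k hk _, hb _, ht _]

end ClaspBraid

open ClaspEdge in
/-- The closed clasp-braid `L n`, `n ≥ 0`, of wrapping number two: the closure around the annulus of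
the two-strand tangle below, drawn in the direction of the core of the annulus. Reading upwards, it
consists of a clasp, whose left and right crossings are `0` and `1`, and of `n` left-handed half
twists `2, …, n + 1` (negative crossings, were both strands oriented upwards). At every crossing
the strand from SW to NE is the under-strand. The ray that defines the annulus meets the diagram in
one point of each of the two edges `l (Fin.last n)`, `r (Fin.last n)` which close up the tangle.

```
   l n      r n
     \      /
     [twists]            the crossings 2, …, n+1; the crossing k+2 joins
     /      \            l k, r k (below) to l (k+1), r (k+1) (above)
   l 0      r 0
     \  top /
      \ __ /
       X  X              the crossings 0 and 1
      / ‾‾ \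
     /  bot \
   l n      r n
```
-/
def claspBraid (n : ℕ) : AnnularDiagram (n + 2) (ClaspEdge n) where
  corner := ClaspBraid.corner n
  out := ClaspBraid.out n
  cut e := if e = l (Fin.last n) ∨ e = r (Fin.last n) then 1 else 0
  through := ClaspBraid.through n
  ends c x := by
    obtain ⟨p, hp⟩ := ClaspBraid.ends_exists n c x
    exact ⟨p, hp, fun q hq =>
      ClaspBraid.ends_injective n q p (hq.1.trans hp.1.symm) (hq.2.trans hp.2.symm)⟩

/-!
The proof computes the annular Khovanov complex of `L n` by induction on `n`, peeling off the
uppermost half twist.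

The circles of the smoothings of `L n` are explicit, so that the complex has an explicit basis
`LState n` with an explicit differential (`LState.stateEquiv`, `LState.incidence_toState`). If the
uppermost half twist of `L (n + 1)` is `1`-smoothed, then `L n` remains. If it is `0`-smoothed, what
remains is the clasp with `n` half twists, capped off by an arc above and by an arc below, a diagram
whose states are `DState n`. Thus the complex of `L (n + 1)` is the mapping cone of a saddle map `σ`
from the complex of the capped diagram to that of `L n`. A half twist under a cap is removed by the
first Reidemeister move, which is realized by the chain map `DState.untwist`; without half twists the
capped diagram is one of the Hopf link. So its homology has four generators, `CapGen`, whatever `n`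
is. On these generators the circles through the upper and the lower arc act by operators
`X` and `Y`, and since `X` changes sign with each half twist (`DState.X_untwist`), the saddle map to
`L (n + 1)` becomes `Y - X` or `Y + X` according to the parity of `n` (`SState.fstPart_δ`). In either
case it maps one generator to twice another generator and kills the others. The saddle map to `L 0`
maps one generator to a generator and kills the others.

Altogether the complex of `L n` contains a quasi-isomorphic complex, spanned by `SState n`, whose
differential matches generators in pairs with coefficients `1` and `2`; the latter is invertible
in `𝕜`. The unmatched generators, which are homogeneous, form a basis of the homology
(`AKh.nonempty_linearEquiv`), and it remains to count them in each trigrading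
(`SState.criticalCount_eq`). The notion of quasi-isomorphism in use is `IsExhaustive`, which composes
well and passes from the parts of a mapping cone to the whole.
-/

/-! ### Sign sequences for the capped clasp-braid and for the closed clasp-braid -/

/-- The sign `±1` encoded by a Boolean, `true` being `+1`. -/
def sgnInt (a : Bool) : ℤ := if a then 1 else -1

/-- `a ⬝ b` contains `c`, for the multiplication `v₊v₊ = v₊`, `v₊v₋ = v₋v₊ = v₋`, `v₋v₋ = 0` of
the Frobenius algebra of Khovanov homology. -/
def mulB (a b c : Bool) : Bool := (a || b) && (c == (a && b))

/-- `b ⊗ c` occurs in the coproduct of `a`, for the comultiplication `v₊ ↦ v₊v₋ + v₋v₊`,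
`v₋ ↦ v₋v₋` of the Frobenius algebra of Khovanov homology. -/
def splitB (a b c : Bool) : Bool := if a then b != c else !b && !c

/-- Enhanced states of the clasp whose two upper ends are joined by an arc, and whose two lower ends
are joined by an arc (a diagram of the Hopf link). The two digits are the smoothings of the crossings
`0` and `1`; the arguments are the signs of the circles, first the circle through the upper arc; the
second circle is the one through the lower arc for `s00`, and the one inside the clasp for `s11`. -/
inductive HopfState
  | s00 (t b : Bool)
  | s10 (a : Bool)
  | s01 (a : Bool)
  | s11 (a c : Bool)
  deriving DecidableEq, Fintype

/-- Enhanced states of `L 0`. The arguments are the signs of the circles: for `s10`, `s01`, `s11`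
those of the left and of the right essential circle, and then that of the circle inside the
clasp. -/
inductive BaseState
  | s00 (a : Bool)
  | s10 (x y : Bool)
  | s01 (x y : Bool)
  | s11 (x y c : Bool)
  deriving DecidableEq, Fintype

/-- Places at which the circles of a smoothed clasp are inspected. In the capped clasp, `left` is the
upper arc and `right` is the lower one. -/
inductive Site
  | left | right | bot | top
  deriving DecidableEq

instance : Fintype Site := ⟨{.left, .right, .bot, .top}, by rintro (_ | _ | _ | _) <;> simp⟩

namespace HopfState

/-- The smoothings of the crossings, `true` being the `1`-smoothing. -/
def val : HopfState → Fin 2 → Bool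
  | s00 _ _ => ![false, false]
  | s10 _ => ![true, false]
  | s01 _ => ![false, true]
  | s11 _ _ => ![true, true]

/-- Labels of the circles: `0` for the circle through the upper arc, `-1` for the one through the
lower arc if it is different, `-2` for the circle inside the clasp. -/
def lab : HopfState → Site → ℤ
  | s00 _ _, .right => -1
  | s00 _ _, .bot => -1
  | s11 _ _, .bot => -2
  | s11 _ _, .top => -2
  | _, _ => 0

/-- The sign of the circle at a place. -/
def sgn : HopfState → Site → Bool
  | s00 _ b, .right => b
  | s00 _ b, .bot => b
  | s00 t _, _ => t
  | s10 a, _ => a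
  | s01 a, _ => a
  | s11 _ c, .bot => c
  | s11 _ c, .top => c
  | s11 a _, _ => a

/-- The number of `1`-smoothings. -/
def deg : HopfState → ℕ
  | s00 _ _ => 0
  | s10 _ => 1
  | s01 _ => 1
  | s11 _ _ => 2

/-- The labels that occur, one for each circle. -/
def labels : HopfState → Finset ℤ
  | s00 _ _ => {0, -1}
  | s10 _ => {0}
  | s01 _ => {0}
  | s11 _ _ => {0, -2}

/-- Sum of the signs of the circles. -/
def sum : HopfState → ℤ
  | s00 a b => sgnInt a + sgnInt b
  | s10 a => sgnInt a
  | s01 a => sgnInt a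
  | s11 a c => sgnInt a + sgnInt c

/-- Multiplication of the sign of the circle through the upper arc. -/
def act (s : Bool) : HopfState → HopfState → Bool
  | s00 t b, s00 t' b' => mulB s t t' && b == b'
  | s10 a, s10 a' => mulB s a a'
  | s01 a, s01 a' => mulB s a a'
  | s11 a c, s11 a' c' => mulB s a a' && c == c'
  | _, _ => false

/-- Multiplication of the sign of the circle through the lower arc. -/
def bact (s : Bool) : HopfState → HopfState → Bool
  | s00 t b, s00 t' b' => mulB s b b' && t == t'
  | s10 a, s10 a' => mulB s a a'
  | s01 a, s01 a' => mulB s a a'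
  | s11 a c, s11 a' c' => mulB s a a' && c == c'
  | _, _ => false

/-- Matrix coefficients of the differential. -/
def inc : HopfState → HopfState → ℤ
  | s00 t b, s10 a => if mulB t b a then 1 else 0
  | s00 t b, s01 a => if mulB t b a then 1 else 0
  | s10 a, s11 b c => if splitB a b c then -1 else 0
  | s01 a, s11 b c => if splitB a b c then 1 else 0
  | _, _ => 0

end HopfState

namespace BaseState

/-- The smoothings of the crossings, `true` being the `1`-smoothing. -/
def val : BaseState → Fin 2 → Bool
  | s00 _ => ![false, false]
  | s10 _ _ => ![true, false]
  | s01 _ _ => ![false, true]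
  | s11 _ _ _ => ![true, true]

/-- Labels of the circles: `0` for the circle through the left strand, `-3` for the one through the
right strand if it is different, `-2` for the circle inside the clasp. -/
def lab : BaseState → Site → ℤ
  | s10 _ _, .left => 0
  | s10 _ _, _ => -3
  | s01 _ _, .right => -3
  | s11 _ _ _, .right => -3
  | s11 _ _ _, .bot => -2
  | s11 _ _ _, .top => -2
  | _, _ => 0

/-- The sign of the circle at a place. -/
def sgn : BaseState → Site → Bool
  | s00 a, _ => a
  | s10 x _, .left => x
  | s10 _ y, _ => y
  | s01 _ y, .right => y
  | s01 x _, _ => x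
  | s11 x _ _, .left => x
  | s11 _ y _, .right => y
  | s11 _ _ c, _ => c

/-- The number of `1`-smoothings. -/
def deg : BaseState → ℕ
  | s00 _ => 0
  | s10 _ _ => 1
  | s01 _ _ => 1
  | s11 _ _ _ => 2

/-- The labels that occur, one for each circle. -/
def labels : BaseState → Finset ℤ
  | s00 _ => {0}
  | s10 _ _ => {0, -3}
  | s01 _ _ => {0, -3}
  | s11 _ _ _ => {0, -3, -2}

/-- Sum of the signs of the circles. -/
def sum : BaseState → ℤ
  | s00 a => sgnInt a
  | s10 x y => sgnInt x + sgnInt y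
  | s01 x y => sgnInt x + sgnInt y
  | s11 x y c => sgnInt x + sgnInt y + sgnInt c

/-- Sum of the signs of the essential circles. -/
def ann : BaseState → ℤ
  | s00 _ => 0
  | s10 x y => sgnInt x + sgnInt y
  | s01 x y => sgnInt x + sgnInt y
  | s11 x y _ => sgnInt x + sgnInt y

/-- Matrix coefficients of the differential. -/
def inc : BaseState → BaseState → ℤ
  | s00 a, s10 x y => if a && x != y then 1 else 0
  | s00 a, s01 x y => if a && x != y then 1 else 0
  | s10 x y, s11 x' y' c => if x == x' && y == y' && !c then -1 else 0
  | s01 x y, s11 x' y' c => if x == x' && y == y' && !c then 1 else 0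
  | _, _ => 0

end BaseState

/-- The saddle that joins the upper arc of the capped clasp to the lower one. -/
def HopfState.saddle : HopfState → BaseState → Bool
  | s00 t b, .s00 a => mulB t b a
  | s10 a, .s10 x y => a && x != y
  | s01 a, .s01 x y => a && x != y
  | s11 a c, .s11 x y c' => a && x != y && c == c'
  | _, _ => false

/-- Enhanced states of the diagram consisting of the clasp and of `m` half twists on top of it, whose
two upper ends and whose two lower ends are joined by arcs. The option belonging to a half twist
is `none` for the `1`-smoothing, and `some s` for the `0`-smoothing if `s` is the sign of the circle
that runs just above the crossing. -/
inductive DState : ℕ → Type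
  | nil (h : HopfState) : DState 0
  | cons {m : ℕ} (o : Option Bool) (x : DState m) : DState (m + 1)
  deriving DecidableEq

/-- Enhanced states of `L n`: those for which the uppermost half twist is `0`-smoothed, followed by
those for which it is `1`-smoothed. -/
inductive LState : ℕ → Type
  | nil (z : BaseState) : LState 0
  | inl {n : ℕ} (x : DState n) : LState (n + 1)
  | inr {n : ℕ} (y : LState n) : LState (n + 1)
  deriving DecidableEq

/-- The states of the capped clasp. -/
def DState.nilEquiv : HopfState ≃ DState 0 where
  toFun := .nil
  invFun | .nil h => h
  left_inv _ := rfl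
  right_inv | .nil _ => rfl

/-- Splitting off the uppermost half twist. -/
def DState.consEquiv (m : ℕ) : Option Bool × DState m ≃ DState (m + 1) where
  toFun p := .cons p.1 p.2
  invFun | .cons o x => (o, x)
  left_inv _ := rfl
  right_inv | .cons _ _ => rfl

/-- The states of `L 0`. -/
def LState.nilEquiv : BaseState ≃ LState 0 where
  toFun := .nil
  invFun | .nil z => z
  left_inv _ := rfl
  right_inv | .nil _ => rfl

/-- Smoothing the uppermost half twist. -/
def LState.succEquiv (n : ℕ) : DState n ⊕ LState n ≃ LState (n + 1) where
  toFun := Sum.elim .inl .inr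
  invFun
    | .inl x => Sum.inl x
    | .inr y => Sum.inr y
  left_inv := by rintro (_ | _) <;> rfl
  right_inv := by rintro (_ | _) <;> rfl

instance DState.instFintype : ∀ m, Fintype (DState m)
  | 0 => .ofEquiv _ DState.nilEquiv
  | m + 1 => haveI := DState.instFintype m; .ofEquiv _ (DState.consEquiv m)

instance LState.instFintype : ∀ n, Fintype (LState n)
  | 0 => .ofEquiv _ LState.nilEquiv
  | n + 1 => haveI := LState.instFintype n; .ofEquiv _ (LState.succEquiv n)

namespace DState

/-- The state of the clasp after removal of the half twists. -/
def base : ∀ {m}, DState m → HopfState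
  | _, .nil h => h
  | _, .cons _ x => base x

/-- The smoothings of the crossings, `true` being the `1`-smoothing. -/
def val : ∀ {m}, DState m → Fin (m + 2) → Bool
  | _, .nil h => HopfState.val h
  | _, .cons o x => Fin.snoc (α := fun _ => Bool) (val x) o.isNone

/-- Label of the circle at level `k`, that is, between the half twists `k + 1` and `k + 2`: the
number of the highest `0`-smoothed half twist below that level, or `0`. -/
def lab : ∀ {m}, DState m → ℕ → ℤ
  | _, .nil _, _ => 0
  | _, .cons (m := m) o x, k => if k ≤ m then lab x k else if o.isSome then m + 1 else lab x m

/-- Sign of the circle at level `k`. -/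
def sgn : ∀ {m}, DState m → ℕ → Bool
  | _, .nil h, _ => HopfState.sgn h .left
  | _, .cons (m := m) o x, k => if k ≤ m then sgn x k else o.getD (sgn x m)

/-- The number of `1`-smoothings. -/
def deg : ∀ {m}, DState m → ℕ
  | _, .nil h => HopfState.deg h
  | _, .cons none x => deg x + 1
  | _, .cons (some _) x => deg x

/-- Sum of the signs of the circles. -/
def sum : ∀ {m}, DState m → ℤ
  | _, .nil h => HopfState.sum h
  | _, .cons none x => sum x
  | _, .cons (some s) x => sgnInt s + sum x

/-- The labels that occur, one for each circle. -/
def labels : ∀ {m}, DState m → Finset ℤ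
  | _, .nil h => HopfState.labels h
  | _, .cons none x => labels x
  | _, .cons (m := m) (some _) x => insert (m + 1 : ℤ) (labels x)

/-- Multiplication of the sign of the circle through the upper arc. -/
def act (s : Bool) : ∀ {m}, DState m → DState m → Bool
  | _, .nil h, .nil h' => HopfState.act s h h'
  | _, .cons none x, .cons none y => act s x y
  | _, .cons (some t) x, .cons (some t') y => mulB s t t' && x == y
  | _, _, _ => false

/-- Multiplication of the sign of the circle through the lower arc. -/
def bact (s : Bool) : ∀ {m}, DState m → DState m → Bool
  | _, .nil h, .nil h' => HopfState.bact s h h'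
  | _, .cons o x, .cons o' y => o == o' && bact s x y

/-- Matrix coefficients of the differential. -/
def inc : ∀ {m}, DState m → DState m → ℤ
  | _, .nil h, .nil h' => HopfState.inc h h'
  | _, .cons none x, .cons none y => inc x y
  | _, .cons (some s) x, .cons (some t) y => if s = t then inc x y else 0
  | _, .cons (some s) x, .cons none y => if act s x y then (-1) ^ deg x else 0
  | _, .cons none _, .cons (some _) _ => 0

/-- The saddle that joins the upper arc to the lower one. -/
def saddle : ∀ {n}, DState n → LState n → Bool
  | _, .nil h, .nil z => HopfState.saddle h z
  | _, .cons none x, .inr y => saddle x y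
  | _, .cons (some s) x, .inl y => bact s x y
  | _, _, _ => false

/-- Labels of the circles through the crossing `c`. -/
def Thru {m} (x : DState m) : ℕ → ℤ → Prop
  | k + 2, t => t = x.lab k ∨ t = x.lab (k + 1)
  | _, t => ∃ e, t = x.base.lab e

/-- `x` and `y` have the same signs off the circles of `x` whose label satisfies `p`. -/
def Agree {m} (p : ℤ → Prop) (x y : DState m) : Prop :=
  (∀ k ≤ m, ¬ p (x.lab k) → x.sgn k = y.sgn k) ∧
    ∀ e, ¬ p (x.base.lab e) → x.base.sgn e = y.base.sgn e

end DState

namespace LState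

/-- The smoothings of the crossings, `true` being the `1`-smoothing. -/
def val : ∀ {n}, LState n → Fin (n + 2) → Bool
  | _, .nil z => BaseState.val z
  | _, .inl x => Fin.snoc (α := fun _ => Bool) x.val false
  | _, .inr y => Fin.snoc (α := fun _ => Bool) (val y) true

/-- Label of the circle at a place: `left` and `right` stand for the left and the right strand
at level `k`. -/
def lab : ∀ {n}, LState n → ℕ → Site → ℤ
  | _, .nil z, _, e => BaseState.lab z e
  | _, .inl (n := n) x, k, .left => if k ≤ n then x.lab k else x.base.lab .right
  | _, .inl (n := n) x, k, .right => if k ≤ n then x.lab k else x.base.lab .right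
  | _, .inl x, _, e => x.base.lab e
  | _, .inr (n := n) y, k, e => lab y (min k n) e

/-- Sign of the circle at a place. -/
def sgn : ∀ {n}, LState n → ℕ → Site → Bool
  | _, .nil z, _, e => BaseState.sgn z e
  | _, .inl (n := n) x, k, .left => if k ≤ n then x.sgn k else x.base.sgn .right
  | _, .inl (n := n) x, k, .right => if k ≤ n then x.sgn k else x.base.sgn .right
  | _, .inl x, _, e => x.base.sgn e
  | _, .inr (n := n) y, k, e => sgn y (min k n) e

/-- The number of `1`-smoothings. -/
def deg : ∀ {n}, LState n → ℕ
  | _, .nil z => BaseState.deg z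
  | _, .inl x => x.deg
  | _, .inr y => deg y + 1

/-- Sum of the signs of the circles. -/
def sum : ∀ {n}, LState n → ℤ
  | _, .nil z => BaseState.sum z
  | _, .inl x => x.sum
  | _, .inr y => sum y

/-- Sum of the signs of the essential circles. -/
def ann : ∀ {n}, LState n → ℤ
  | _, .nil z => BaseState.ann z
  | _, .inl _ => 0
  | _, .inr y => ann y

/-- The labels that occur, one for each circle. -/
def labels : ∀ {n}, LState n → Finset ℤ
  | _, .nil z => BaseState.labels z
  | _, .inl x => x.labels
  | _, .inr y => labels y

/-- Matrix coefficients of the differential. -/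
def inc : ∀ {n}, LState n → LState n → ℤ
  | _, .nil z, .nil z' => BaseState.inc z z'
  | _, .inl x, .inl y => x.inc y
  | _, .inl x, .inr y => if x.saddle y then (-1) ^ x.deg else 0
  | _, .inr x, .inr y => inc x y
  | _, .inr _, .inl _ => 0

/-- Levels and places of the four ends of the edges at the crossing `c`, in the order SW, SE, NE,
NW. -/
def corner (n : ℕ) : ℕ → Fin 4 → ℕ × Site
  | 0 => ![(n, .left), (0, .bot), (0, .top), (0, .left)]
  | 1 => ![(0, .bot), (n, .right), (0, .right), (0, .top)]
  | k + 2 => ![(k, .left), (k, .right), (k + 1, .right), (k + 1, .left)]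

/-- Labels of the circles through the crossing `c`. -/
def Thru {n} (x : LState n) (c : ℕ) (t : ℤ) : Prop :=
  ∃ i, t = x.lab (corner n c i).1 (corner n c i).2

/-- `x` and `y` have the same signs off the circles of `x` whose label satisfies `p`. -/
def Agree {n} (p : ℤ → Prop) (x y : LState n) : Prop :=
  ∀ k ≤ n, ∀ e, ¬ p (x.lab k e) → x.sgn k e = y.sgn k e

end LState

/-- The smoothing `w` arises from `v` by a change from `0` to `1` at `c`. -/
def Flip {N : ℕ} (c : Fin N) (v w : Fin N → Bool) : Prop :=
  v c = false ∧ w = Function.update v c true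

instance {N : ℕ} (c : Fin N) (v w : Fin N → Bool) : Decidable (Flip c v w) := by
  unfold Flip; infer_instance

/-- The conditions under which `y` occurs in the edge map at `c` applied to `x`. -/
def DState.Inc {m} (c : Fin (m + 2)) (x y : DState m) : Prop :=
  Flip c x.val y.val ∧ x.Agree (x.Thru c) y ∧ x.sum = y.sum + 1

/-- The conditions under which `y` occurs in the edge map at `c` applied to `x`. -/
def LState.Inc {n} (c : Fin (n + 2)) (x y : LState n) : Prop :=
  Flip c x.val y.val ∧ x.Agree (x.Thru c) y ∧ x.sum = y.sum + 1 ∧ x.ann = y.ann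

/-- The number of `1`-smoothings before `c`. -/
def onesBefore {N : ℕ} (v : Fin N → Bool) (c : Fin N) : ℕ :=
  (Finset.univ.filter fun c' => c' < c ∧ v c' = true).card

/-- The number of `1`-smoothings. -/
def onesCount {N : ℕ} (v : Fin N → Bool) : ℕ :=
  (Finset.univ.filter fun c => v c = true).card

theorem onesCount_snoc {N : ℕ} (v : Fin N → Bool) (b : Bool) :
    onesCount (Fin.snoc (α := fun _ => Bool) v b) = onesCount v + if b then 1 else 0 := by
  unfold onesCount
  rw [Finset.card_filter, Finset.card_filter, Fin.sum_univ_castSucc]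
  simp only [Fin.snoc_castSucc, Fin.snoc_last]

theorem onesBefore_snoc_castSucc {N : ℕ} (v : Fin N → Bool) (b : Bool) (c : Fin N) :
    onesBefore (Fin.snoc (α := fun _ => Bool) v b) c.castSucc = onesBefore v c := by
  have : ¬ Fin.last N < c.castSucc := not_lt.2 (Fin.le_last _)
  unfold onesBefore
  rw [Finset.card_filter, Finset.card_filter, Fin.sum_univ_castSucc]
  simp only [Fin.snoc_castSucc, this, Fin.castSucc_lt_castSucc_iff, false_and, if_false, add_zero]

theorem onesBefore_snoc_last {N : ℕ} (v : Fin N → Bool) (b : Bool) :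
    onesBefore (Fin.snoc (α := fun _ => Bool) v b) (Fin.last N) = onesCount v := by
  unfold onesBefore onesCount
  rw [Finset.card_filter, Finset.card_filter, Fin.sum_univ_castSucc]
  simp only [Fin.snoc_castSucc, Fin.castSucc_lt_last, lt_irrefl, false_and, true_and, if_false,
    add_zero]

theorem flip_snoc_castSucc {N : ℕ} (v w : Fin N → Bool) (a b : Bool) (c : Fin N) :
    Flip c.castSucc (Fin.snoc (α := fun _ => Bool) v a) (Fin.snoc (α := fun _ => Bool) w b) ↔
      Flip c v w ∧ a = b := by
  unfold Flip
  rw [← Fin.snoc_update, Fin.snoc_inj]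
  simp; tauto

theorem flip_snoc_last {N : ℕ} (v w : Fin N → Bool) (a b : Bool) :
    Flip (Fin.last N) (Fin.snoc (α := fun _ => Bool) v a) (Fin.snoc (α := fun _ => Bool) w b) ↔
      a = false ∧ b = true ∧ v = w := by
  unfold Flip
  rw [Fin.update_snoc_last, Fin.snoc_inj]
  simp; tauto

/-! ### The differential in terms of sign sequences -/

theorem Site.exists {p : Site → Prop} :
    (∃ e, p e) ↔ p .left ∨ p .right ∨ p .bot ∨ p .top := by
  constructor
  · rintro ⟨_ | _ | _ | _, h⟩ <;> simp [h]
  · rintro (h | h | h | h) <;> exact ⟨_, h⟩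

namespace HopfState

theorem act_iff (s : Bool) (x y : HopfState) :
    (x.val = y.val ∧ (∀ e, x.lab e ≠ 0 → x.sgn e = y.sgn e) ∧ sgnInt s + x.sum = y.sum + 1) ↔
      act s x y = true := by
  revert s x y; decide

theorem bact_iff (s : Bool) (x y : HopfState) :
    (x.val = y.val ∧ (∀ e, x.lab e ≠ x.lab .right → x.sgn e = y.sgn e) ∧
      (0 ≠ x.lab .right → x.sgn .left = y.sgn .left) ∧
      sgnInt s + x.sum = y.sum + 1) ↔ bact s x y = true := by
  revert s x y; decide

theorem saddle_iff (x : HopfState) (y : BaseState) :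
    (x.val = y.val ∧ (∀ e, x.lab e ≠ 0 → x.lab e ≠ x.lab .right → x.sgn e = y.sgn e) ∧
      x.sum = y.sum + 1 ∧ 0 = y.ann) ↔ saddle x y = true := by
  revert x y; decide

theorem sum_inc (x y : HopfState) :
    (∑ c, if Flip c x.val y.val ∧ x.sum = y.sum + 1 then (-1) ^ onesBefore x.val c else 0) =
      x.inc y := by
  revert x y; decide

theorem eq_of_sgn {x y : HopfState} (h : x.val = y.val) (h' : ∀ e, x.sgn e = y.sgn e) : x = y := by
  revert x y; decide

theorem lab_nonpos (x : HopfState) (e : Site) : x.lab e ≤ 0 := by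
  revert x e; decide

theorem onesCount_val (x : HopfState) : onesCount x.val = x.deg := by
  revert x; decide

theorem lab_left (x : HopfState) : x.lab .left = 0 := by
  revert x; decide

end HopfState

namespace BaseState

theorem sum_inc (x y : BaseState) :
    (∑ c : Fin 2, if Flip c x.val y.val ∧ (∀ e, (¬ ∃ i, x.lab e =
      x.lab (LState.corner 0 c i).2) → x.sgn e = y.sgn e) ∧ x.sum = y.sum + 1 ∧ x.ann = y.ann
        then (-1) ^ onesBefore x.val c else 0) = x.inc y := by
  revert x y; decide

theorem onesCount_val (x : BaseState) : onesCount x.val = x.deg := by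
  revert x; decide

end BaseState

namespace DState

theorem lab_le : ∀ {m} (x : DState m) (k : ℕ), x.lab k ≤ m
  | _, .nil _, _ => le_rfl
  | _, .cons (m := m) o x, k => by
    have h1 := lab_le x k
    have h2 := lab_le x m
    simp only [lab]
    split_ifs <;> push_cast <;> linarith

theorem lab_cons_of_le {m} (o : Option Bool) (x : DState m) {k : ℕ} (h : k ≤ m) :
    lab (.cons o x) k = x.lab k := by simp [lab, h]

theorem sgn_cons_of_le {m} (o : Option Bool) (x : DState m) {k : ℕ} (h : k ≤ m) :
    sgn (.cons o x) k = x.sgn k := by simp [sgn, h]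

theorem lab_cons_none_top {m} (x : DState m) :
    lab (.cons none x) (m + 1) = x.lab m := by simp [lab]

theorem lab_cons_some_top {m} (s : Bool) (x : DState m) :
    lab (.cons (some s) x) (m + 1) = m + 1 := by simp [lab]

theorem sgn_cons_none_top {m} (x : DState m) :
    sgn (.cons none x) (m + 1) = x.sgn m := by simp [sgn]

theorem sgn_cons_some_top {m} (s : Bool) (x : DState m) :
    sgn (.cons (some s) x) (m + 1) = s := by simp [sgn]

theorem lab_zero : ∀ {m} (x : DState m), x.lab 0 = x.base.lab .left
  | _, .nil x => (HopfState.lab_left x).symm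
  | _, .cons o x => by simpa [lab, base] using lab_zero x

theorem sgn_zero : ∀ {m} (x : DState m), x.sgn 0 = x.base.sgn .left
  | _, .nil x => rfl
  | _, .cons o x => by simpa [sgn, base] using sgn_zero x

theorem val_cons {m} (o : Option Bool) (x : DState m) :
    val (.cons o x) = Fin.snoc (α := fun _ => Bool) x.val o.isNone := rfl

theorem base_cons {m} (o : Option Bool) (x : DState m) :
    base (.cons o x) = base x := rfl

theorem val_cons_eq_iff {m} (o o' : Option Bool) (x y : DState m) :
    val (.cons o x) = val (.cons o' y) ↔ x.val = y.val ∧ o.isNone = o'.isNone :=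
  Fin.snoc_inj

theorem agree_cons_none {m} (p : ℤ → Prop) (x y : DState m) :
    Agree p (.cons none x) (.cons none y) ↔ Agree p x y := by
  unfold Agree
  simp only [base_cons]
  refine and_congr_left fun _ => ⟨fun h k hk => ?_, fun h k hk => ?_⟩
  · simpa only [lab_cons_of_le _ _ hk, sgn_cons_of_le _ _ hk] using h k (by omega)
  · rcases Nat.le_succ_iff.1 hk with hk | rfl
    · simpa only [lab_cons_of_le _ _ hk, sgn_cons_of_le _ _ hk] using h k hk
    · simpa only [lab_cons_none_top, sgn_cons_none_top] using h m le_rfl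

theorem agree_cons_some {m} (p : ℤ → Prop) (s t : Bool) (x y : DState m) :
    Agree p (.cons (some s) x) (.cons (some t) y) ↔ Agree p x y ∧ (¬ p ((m : ℤ) + 1) → s = t) := by
  unfold Agree
  simp only [base_cons]
  constructor
  · rintro ⟨h, h'⟩
    refine ⟨⟨fun k hk => ?_, h'⟩, ?_⟩
    · simpa only [lab_cons_of_le _ _ hk, sgn_cons_of_le _ _ hk] using h k (by omega)
    · simpa only [lab_cons_some_top, sgn_cons_some_top] using h (m + 1) le_rfl
  · rintro ⟨⟨h, h'⟩, h''⟩
    refine ⟨fun k hk => ?_, h'⟩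
    rcases Nat.le_succ_iff.1 hk with hk | rfl
    · simpa only [lab_cons_of_le _ _ hk, sgn_cons_of_le _ _ hk] using h k hk
    · simpa only [lab_cons_some_top, sgn_cons_some_top] using h''

/-- The sign of the circle above a half twist is irrelevant to the agreement off a set of circles
that contains this circle. -/
theorem agree_cons_top {m : ℕ} (p : ℤ → Prop) (hp : p ((m : ℤ) + 1)) (s : Bool) (x y : DState m) :
    Agree p (.cons (some s) x) (.cons none y) ↔ Agree p x y := by
  unfold Agree
  simp only [base_cons]
  refine and_congr_left fun _ => ⟨fun h k hk => ?_, fun h k hk => ?_⟩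
  · simpa only [lab_cons_of_le _ _ hk, sgn_cons_of_le _ _ hk] using h k (by omega)
  · rcases Nat.le_succ_iff.1 hk with hk | rfl
    · simpa only [lab_cons_of_le _ _ hk, sgn_cons_of_le _ _ hk] using h k hk
    · simp only [lab_cons_some_top, hp, not_true, false_imp_iff]

theorem eq_of_sgn : ∀ {m} {x y : DState m}, x.val = y.val → (∀ k ≤ m, x.sgn k = y.sgn k) →
    (∀ e, x.base.sgn e = y.base.sgn e) → x = y
  | _, .nil x, .nil y, h, _, h' => congrArg _ (HopfState.eq_of_sgn h h')
  | _, .cons (m := m) o x, .cons o' y, h, hk, h' => by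
    rw [val_cons_eq_iff] at h
    have := eq_of_sgn h.1 (fun k hk' => by
      simpa only [sgn_cons_of_le _ _ hk'] using hk k (by omega)) h'
    subst this
    have := hk (m + 1) le_rfl
    rcases o with _ | s <;> rcases o' with _ | s' <;> simp_all [sgn]

theorem agree_iff_sgn_eq {m} {p : ℤ → Prop} {x y : DState m} (hp : ∀ t ≤ (m : ℤ), ¬ p t) :
    x.Agree p y ↔ (∀ k ≤ m, x.sgn k = y.sgn k) ∧ ∀ e, x.base.sgn e = y.base.sgn e :=
  ⟨fun h => ⟨fun k hk => h.1 k hk (hp _ (lab_le _ _)), fun e => h.2 e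
    (hp _ ((HopfState.lab_nonpos _ _).trans (Int.natCast_nonneg m)))⟩,
    fun h => ⟨fun k hk _ => h.1 k hk, fun e _ => h.2 e⟩⟩

theorem val_eq_and_agree_iff {m} {p : ℤ → Prop} {x y : DState m} (hp : ∀ t ≤ (m : ℤ), ¬ p t) :
    x.val = y.val ∧ x.Agree p y ↔ x = y := by
  rw [agree_iff_sgn_eq hp]
  exact ⟨fun h => eq_of_sgn h.1 h.2.1 h.2.2, by rintro rfl; simp⟩

theorem mulB_iff (a b c : Bool) : mulB a b c = true ↔ sgnInt a + sgnInt b = sgnInt c + 1 := by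
  revert a b c; decide

/-- Merging a circle of sign `s` into the circle through the upper arc is described by the signs of
the remaining circles and by the quantum grading. -/
theorem act_iff (s : Bool) : ∀ {m} (x y : DState m),
    (x.val = y.val ∧ x.Agree (fun t => t = x.lab m) y ∧ sgnInt s + x.sum = y.sum + 1) ↔
      act s x y = true
  | _, .nil x, .nil y => by
    rw [act, ← HopfState.act_iff]
    simp [Agree, lab, val, sum, base]
  | _, .cons (m := m) none x, .cons none y => by
    rw [act, ← act_iff s x y, val_cons_eq_iff, agree_cons_none, lab_cons_none_top]
    simp [sum]
  | _, .cons (m := m) (some t) x, .cons (some t') y => by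
    rw [lab_cons_some_top, agree_cons_some, val_cons_eq_iff]
    simp only [act, sum, Option.isNone_some, and_true, not_true, false_imp_iff,
      Bool.and_eq_true, beq_iff_eq, mulB_iff]
    rw [← and_assoc, val_eq_and_agree_iff (by intro t ht; omega)]
    constructor
    · rintro ⟨rfl, h⟩; exact ⟨by linarith, rfl⟩
    · rintro ⟨h, rfl⟩; exact ⟨rfl, by linarith⟩
  | _, .cons (m := m) none x, .cons (some t') y => by simp [val_cons_eq_iff, act]
  | _, .cons (m := m) (some t) x, .cons none y => by simp [val_cons_eq_iff, act]

/-- Merging a circle of sign `s` into the circle through the lower arc is described by the signs of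
the remaining circles and by the quantum grading. -/
theorem bact_iff (s : Bool) : ∀ {m} (x y : DState m),
    (x.val = y.val ∧ x.Agree (fun t => t = x.base.lab .right) y ∧ sgnInt s + x.sum = y.sum + 1) ↔
      bact s x y = true
  | _, .nil x, .nil y => by
    rw [bact, ← HopfState.bact_iff]
    simp only [Agree, lab, val, sum, base, sgn]
    constructor
    · rintro ⟨h, ⟨h1, h2⟩, h3⟩; exact ⟨h, h2, h1 0 le_rfl, h3⟩
    · rintro ⟨h, h2, h1, h3⟩; exact ⟨h, ⟨fun _ _ => h1, h2⟩, h3⟩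
  | _, .cons (m := m) none x, .cons none y => by
    simp only [bact, beq_self_eq_true, Bool.true_and]
    rw [← bact_iff s x y, val_cons_eq_iff, agree_cons_none, base_cons]
    simp [sum]
  | _, .cons (m := m) (some t) x, .cons (some t') y => by
    have h0 := HopfState.lab_nonpos x.base .right
    have h1 : ¬ ((m + 1 : ℤ) = x.base.lab .right) := by omega
    simp only [bact, Bool.and_eq_true, beq_iff_eq, Option.some.injEq]
    rw [base_cons, agree_cons_some, val_cons_eq_iff, ← bact_iff s x y]
    simp only [sum, Option.isNone_some, and_true, h1, not_false_eq_true, true_imp_iff]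
    constructor
    · rintro ⟨h, ⟨h', rfl⟩, h3⟩; exact ⟨rfl, h, h', by linarith⟩
    · rintro ⟨rfl, h, h', h3⟩; exact ⟨h, ⟨h', rfl⟩, by linarith⟩
  | _, .cons (m := m) none x, .cons (some t') y => by simp [val_cons_eq_iff, bact]
  | _, .cons (m := m) (some t) x, .cons none y => by simp [val_cons_eq_iff, bact]

theorem onesCount_val : ∀ {m} (x : DState m), onesCount x.val = x.deg
  | _, .nil x => HopfState.onesCount_val x
  | _, .cons (m := m) o x => by
    rw [val_cons, onesCount_snoc, onesCount_val x]
    rcases o <;> simp [deg]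

theorem thru_cons_castSucc {m} (o : Option Bool) (x : DState m) (c : Fin (m + 2)) :
    Thru (.cons o x) (c.castSucc : Fin (m + 3)) = x.Thru c := by
  obtain ⟨c, hc⟩ := c
  rcases c with _ | _ | k
  · rfl
  · rfl
  · funext t
    simp only [Thru, Fin.castSucc_mk, lab_cons_of_le o x (show k ≤ m by omega),
      lab_cons_of_le o x (show k + 1 ≤ m by omega)]

theorem thru_le {m} {x : DState m} {c : Fin (m + 2)} {t : ℤ} (h : x.Thru c t) : t ≤ m := by
  obtain ⟨c, hc⟩ := c
  rcases c with _ | _ | k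
  · obtain ⟨e, rfl⟩ := h; exact (HopfState.lab_nonpos _ _).trans (Int.natCast_nonneg m)
  · obtain ⟨e, rfl⟩ := h; exact (HopfState.lab_nonpos _ _).trans (Int.natCast_nonneg m)
  · rcases h with rfl | rfl <;> exact lab_le _ _

open scoped Classical in
/-- The matrix coefficients of the differential, in terms of sign sequences. -/
theorem sum_inc : ∀ {m} (x y : DState m),
    (∑ c, if x.Inc c y then (-1) ^ onesBefore x.val c else 0) = x.inc y
  | _, .nil x, .nil y => by
    rw [inc, ← HopfState.sum_inc]
    refine Finset.sum_congr rfl fun c _ => if_congr ?_ rfl rfl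
    have : (nil x).Agree ((nil x).Thru c) (nil y) := by
      have h0 : ∃ e, (0 : ℤ) = x.lab e := ⟨.left, (HopfState.lab_left x).symm⟩
      obtain ⟨c, hc⟩ := c
      rcases c with _ | _ | k
      · exact ⟨fun k _ h => absurd h0 h, fun e h => absurd ⟨e, rfl⟩ h⟩
      · exact ⟨fun k _ h => absurd h0 h, fun e h => absurd ⟨e, rfl⟩ h⟩
      · omega
    simp only [Inc, this, true_and, val, sum]
  | _, .cons (m := m) o x, .cons o' y => by
    rw [Fin.sum_univ_castSucc]
    simp only [Inc, val_cons, flip_snoc_castSucc, flip_snoc_last, onesBefore_snoc_castSucc,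
      onesBefore_snoc_last, thru_cons_castSucc]
    rcases o with _ | s <;> rcases o' with _ | t
    · simp only [agree_cons_none, sum, inc, ← sum_inc x y, Inc]
      simp only [Option.isNone_none, and_true, reduceCtorEq, false_and, if_false, add_zero]
      exact Finset.sum_congr rfl fun c _ => by congr
    · simp [inc]
    · have h : Thru (.cons (some s) x) (Fin.last (m + 2) : Fin (m + 3)) =
          fun t => t = x.lab m ∨ t = m + 1 := by
        funext t
        simp only [Thru, Fin.val_last, lab_cons_of_le _ x le_rfl, lab_cons_some_top]
      rw [h, agree_cons_top _ (Or.inr rfl)]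
      simp only [inc, ← act_iff s x y, sum, onesCount_val]
      have h' : x.Agree (fun t => t = x.lab m ∨ t = m + 1) y ↔ x.Agree (fun t => t = x.lab m) y := by
        unfold Agree
        refine and_congr (forall_congr' fun k => forall_congr' fun hk => ?_)
          (forall_congr' fun e => ?_)
        · have := lab_le x k
          have : x.lab k ≠ m + 1 := by omega
          simp [this]
        · have := HopfState.lab_nonpos x.base e
          have : x.base.lab e ≠ m + 1 := by omega
          simp [this]
      simp [h']
    · simp only [inc, ← sum_inc x y, Inc]
      have : ∀ c : Fin (m + 2), ¬ x.Thru c (m + 1) := fun c h => by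
        have := thru_le h; omega
      simp only [agree_cons_some, this, sum]
      by_cases h : s = t
      · subst h
        simp [add_assoc]
        exact Finset.sum_congr rfl fun c _ => by congr
      · simp [h]

end DState

namespace LState

theorem onesCount_val : ∀ {n} (x : LState n), onesCount x.val = x.deg
  | _, .nil x => BaseState.onesCount_val x
  | _, .inl x => by simp [val, onesCount_snoc, DState.onesCount_val, deg]
  | _, .inr y => by simp [val, onesCount_snoc, onesCount_val y, deg]

theorem val_inl {n} (x : DState n) :
    val (.inl x) = Fin.snoc (α := fun _ => Bool) x.val false := rfl

theorem val_inr {n} (x : LState n) :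
    val (.inr x) = Fin.snoc (α := fun _ => Bool) x.val true := rfl

theorem lab_inr_of_le {n} (x : LState n) {k : ℕ} (hk : k ≤ n) (e : Site) :
    lab (.inr x) k e = x.lab k e := by simp [lab, hk]

theorem lab_inr_top {n} (x : LState n) (e : Site) :
    lab (.inr x) (n + 1) e = x.lab n e := by simp [lab]

theorem sgn_inr_of_le {n} (x : LState n) {k : ℕ} (hk : k ≤ n) (e : Site) :
    sgn (.inr x) k e = x.sgn k e := by simp [sgn, hk]

theorem sgn_inr_top {n} (x : LState n) (e : Site) :
    sgn (.inr x) (n + 1) e = x.sgn n e := by simp [sgn]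

theorem agree_inr {n} (p : ℤ → Prop) (x y : LState n) :
    Agree p (.inr x) (.inr y) ↔ Agree p x y := by
  unfold Agree
  refine ⟨fun h k hk e => ?_, fun h k hk e => ?_⟩
  · simpa only [lab_inr_of_le _ hk, sgn_inr_of_le _ hk] using h k (by omega) e
  · rcases Nat.le_succ_iff.1 hk with hk | rfl
    · simpa only [lab_inr_of_le _ hk, sgn_inr_of_le _ hk] using h k hk e
    · simpa only [lab_inr_top, sgn_inr_top] using h n le_rfl e

theorem agree_inl {n} (p : ℤ → Prop) (x y : DState n) :
    Agree p (.inl x) (.inl y) ↔ DState.Agree p x y := by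
  unfold Agree DState.Agree
  constructor
  · intro h
    refine ⟨fun k hk => ?_, fun e => ?_⟩
    · simpa [lab, sgn, hk] using h k (by omega) .left
    · rcases e with _ | _ | _ | _
      · simpa [lab, sgn, DState.lab_zero, DState.sgn_zero] using h 0 (by omega) .left
      · simpa [lab, sgn] using h (n + 1) le_rfl .left
      · simpa [lab, sgn] using h 0 (by omega) .bot
      · simpa [lab, sgn] using h 0 (by omega) .top
  · rintro ⟨h, h'⟩ k hk e
    rcases e with _ | _ | _ | _ <;> simp only [lab, sgn]
    · split_ifs with hk'
      exacts [h k hk', h' _]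
    · split_ifs with hk'
      exacts [h k hk', h' _]
    · exact h' _
    · exact h' _

theorem agree_inl_none {n} (p : ℤ → Prop) (x : DState n) (y : LState n) (h1 : p (x.lab n))
    (h2 : p (x.base.lab .right)) :
    Agree p (.inl (.cons none x)) (.inr (.inr y)) ↔ Agree p (.inl x) (.inr y) := by
  have key : ∀ k ≤ n, ∀ e, lab (.inl (.cons none x)) k e = lab (.inl x) k e ∧
      sgn (.inl (.cons none x)) k e = sgn (.inl x) k e ∧
      sgn (.inr (.inr y)) k e = sgn (.inr y) k e := by
    intro k hk e
    have hk' : k ≤ n + 1 := by omega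
    rcases e with _ | _ | _ | _ <;>
      simp [lab, sgn, hk, hk', DState.lab, DState.sgn, DState.base]
  have hc : ∀ k e, (e = Site.bot ∨ e = Site.top) →
      lab (.inl (.cons none x)) k e = lab (.inl x) 0 e ∧
      sgn (.inl (.cons none x)) k e = sgn (.inl x) 0 e := by
    rintro k e (rfl | rfl) <;> simp [lab, sgn, DState.base]
  constructor
  · intro h k hk e hp
    rcases Nat.le_succ_iff.1 hk with hk' | rfl
    · obtain ⟨a1, a2, a3⟩ := key k hk' e
      have := h k (by omega) e
      rw [a1, a2, a3] at this
      exact this hp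
    · rcases e with _ | _ | _ | _
      · simp [lab, h2] at hp
      · simp [lab, h2] at hp
      · simpa [sgn, DState.base] using h (n + 1) (by omega) .bot hp
      · simpa [sgn, DState.base] using h (n + 1) (by omega) .top hp
  · intro h k hk e hp
    by_cases hk' : k ≤ n
    · obtain ⟨a1, a2, a3⟩ := key k hk' e
      rw [a2, a3]; rw [a1] at hp
      exact h k (by omega) e hp
    · rcases e with _ | _ | _ | _
      · simp only [lab] at hp
        split_ifs at hp with h3
        · obtain rfl : k = n + 1 := by omega
          exact absurd h1 (by simpa [DState.lab] using hp)
        · exact absurd h2 hp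
      · simp only [lab] at hp
        split_ifs at hp with h3
        · obtain rfl : k = n + 1 := by omega
          exact absurd h1 (by simpa [DState.lab] using hp)
        · exact absurd h2 hp
      · have := h (n + 1) le_rfl .bot hp
        have h4 : min (min k (n + 1)) n = n := by omega
        simpa [sgn, DState.base, h4] using this
      · have := h (n + 1) le_rfl .top hp
        have h4 : min (min k (n + 1)) n = n := by omega
        simpa [sgn, DState.base, h4] using this

theorem agree_inl_some {n} (p : ℤ → Prop) (s : Bool) (x y : DState n) (h1 : p ((n : ℤ) + 1))
    (h2 : p (x.base.lab .right)) :
    Agree p (.inl (.cons (some s) x)) (.inr (.inl y)) ↔ DState.Agree p x y := by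
  rw [← agree_inl]
  have key : ∀ k ≤ n, ∀ e, lab (.inl (.cons (some s) x)) k e = lab (.inl x) k e ∧
      sgn (.inl (.cons (some s) x)) k e = sgn (.inl x) k e ∧
      sgn (.inr (.inl y)) k e = sgn (.inl y) k e := by
    intro k hk e
    have hk' : k ≤ n + 1 := by omega
    rcases e with _ | _ | _ | _ <;>
      simp [lab, sgn, hk, hk', DState.lab, DState.sgn, DState.base]
  constructor
  · intro h k hk e hp
    rcases Nat.le_succ_iff.1 hk with hk' | rfl
    · obtain ⟨a1, a2, a3⟩ := key k hk' e
      have := h k (by omega) e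
      rw [a1, a2, a3] at this
      exact this hp
    · rcases e with _ | _ | _ | _
      · simp [lab, h2] at hp
      · simp [lab, h2] at hp
      · simpa [sgn, DState.base] using h (n + 1) (by omega) .bot hp
      · simpa [sgn, DState.base] using h (n + 1) (by omega) .top hp
  · intro h k hk e hp
    by_cases hk' : k ≤ n
    · obtain ⟨a1, a2, a3⟩ := key k hk' e
      rw [a2, a3]; rw [a1] at hp
      exact h k (by omega) e hp
    · rcases e with _ | _ | _ | _
      · simp only [lab] at hp
        split_ifs at hp with h3
        · obtain rfl : k = n + 1 := by omega
          exact absurd h1 (by simpa [DState.lab] using hp)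
        · exact absurd h2 hp
      · simp only [lab] at hp
        split_ifs at hp with h3
        · obtain rfl : k = n + 1 := by omega
          exact absurd h1 (by simpa [DState.lab] using hp)
        · exact absurd h2 hp
      · simpa [sgn, DState.base] using h (n + 1) le_rfl .bot hp
      · simpa [sgn, DState.base] using h (n + 1) le_rfl .top hp

/-- The edge map of the uppermost half twist is described by the signs of the circles that do not
pass through it, and by the gradings. -/
theorem saddle_iff : ∀ {n} (x : DState n) (y : LState n),
    (x.val = y.val ∧ Agree (fun t => t = x.lab n ∨ t = x.base.lab .right) (.inl x) (.inr y) ∧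
      x.sum = y.sum + 1 ∧ 0 = y.ann) ↔ x.saddle y = true
  | _, .nil x, .nil y => by
    rw [DState.saddle, ← HopfState.saddle_iff]
    refine and_congr Iff.rfl (and_congr_left fun _ => ⟨fun h e => ?_, fun h k hk e => ?_⟩)
    · rcases e with _ | _ | _ | _
      · simp [HopfState.lab_left]
      · simp
      · simpa [lab, sgn, DState.base, DState.lab, not_or] using h 0 (by omega) .bot
      · simpa [lab, sgn, DState.base, DState.lab, not_or] using h 0 (by omega) .top
    · have := h e
      rcases e with _ | _ | _ | _
      · simp only [lab, DState.lab, DState.base]; split_ifs <;> simp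
      · simp only [lab, DState.lab, DState.base]; split_ifs <;> simp
      · simpa [lab, sgn, DState.base, DState.lab, not_or] using this
      · simpa [lab, sgn, DState.base, DState.lab, not_or] using this
  | _, .cons (m := n) none x, .inr y => by
    rw [DState.saddle, ← saddle_iff x y, DState.lab_cons_none_top, DState.base_cons,
      agree_inl_none _ _ _ (Or.inl rfl) (Or.inr rfl), DState.val_cons, val_inr, Fin.snoc_inj]
    simp [sum, ann, DState.sum]
  | _, .cons (m := n) (some s) x, .inl y => by
    rw [DState.saddle, ← DState.bact_iff s x y, DState.lab_cons_some_top, DState.base_cons,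
      agree_inl_some _ _ _ _ (Or.inl rfl) (Or.inr rfl), DState.val_cons, val_inl, Fin.snoc_inj]
    have h' : x.Agree (fun t => t = n + 1 ∨ t = x.base.lab .right) y ↔
        x.Agree (fun t => t = x.base.lab .right) y := by
      unfold DState.Agree
      refine and_congr (forall_congr' fun k => forall_congr' fun hk => ?_)
        (forall_congr' fun e => ?_)
      · have := DState.lab_le x k
        have : x.lab k ≠ n + 1 := by omega
        simp [this]
      · have := HopfState.lab_nonpos x.base e
        have : x.base.lab e ≠ n + 1 := by omega
        simp [this]
    simp [sum, ann, DState.sum, h']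
  | _, .cons (m := n) none x, .inl y => by
    simp [DState.saddle, DState.val_cons, val_inl, Fin.snoc_inj]
  | _, .cons (m := n) (some s) x, .inr y => by
    simp [DState.saddle, DState.val_cons, val_inr, Fin.snoc_inj]

theorem thru_inl_castSucc {n} (x : DState n) (c : Fin (n + 2)) :
    Thru (.inl x) (c.castSucc : Fin (n + 3)) = x.Thru c := by
  obtain ⟨c, hc⟩ := c
  funext t
  rcases c with _ | _ | k
  · simp [Thru, DState.Thru, corner, lab, Fin.exists_fin_succ, DState.lab_zero, Site.exists]
    tauto
  · simp [Thru, DState.Thru, corner, lab, Fin.exists_fin_succ, DState.lab_zero, Site.exists]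
    tauto
  · have h1 : k ≤ n := by omega
    have h2 : k + 1 ≤ n := by omega
    simp [Thru, DState.Thru, corner, lab, Fin.exists_fin_succ, h1, h2]

theorem thru_inr_castSucc {n} (x : LState n) (c : Fin (n + 2)) :
    Thru (.inr x) (c.castSucc : Fin (n + 3)) = x.Thru c := by
  obtain ⟨c, hc⟩ := c
  funext t
  rcases c with _ | _ | k
  · simp [Thru, corner, lab, Fin.exists_fin_succ]
  · simp [Thru, corner, lab, Fin.exists_fin_succ]
  · have h1 : k ≤ n := by omega
    have h2 : k + 1 ≤ n := by omega
    simp [Thru, corner, lab, Fin.exists_fin_succ, h1, h2]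

theorem thru_inl_last {n} (x : DState n) :
    Thru (.inl x) (Fin.last (n + 2) : Fin (n + 3)) = 
      fun t => t = x.lab n ∨ t = x.base.lab .right := by
  funext t
  simp [Thru, corner, lab, Fin.exists_fin_succ]

open scoped Classical in
/-- The matrix coefficients of the differential, in terms of sign sequences. -/
theorem sum_inc : ∀ {n} (x y : LState n),
    (∑ c, if x.Inc c y then (-1) ^ onesBefore x.val c else 0) = x.inc y
  | _, .nil x, .nil y => by
    rw [inc, ← BaseState.sum_inc]
    refine Finset.sum_congr rfl fun c _ => if_congr ?_ rfl rfl
    have : (nil x).Agree ((nil x).Thru c) (nil y) ↔ (∀ e, (¬ ∃ i, x.lab e =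
      x.lab (LState.corner 0 c i).2) → x.sgn e = y.sgn e) := by
      simp [Agree, Thru, lab, sgn]
    simp only [Inc, this, val, sum, ann]
  | _, .inl (n := n) x, .inl y => by
    rw [Fin.sum_univ_castSucc]
    simp only [Inc, val_inl, flip_snoc_castSucc, flip_snoc_last, onesBefore_snoc_castSucc,
      thru_inl_castSucc, agree_inl, sum, ann, inc, ← DState.sum_inc x y, DState.Inc]
    simp
    exact Finset.sum_congr rfl fun c _ => by congr
  | _, .inl (n := n) x, .inr y => by
    rw [Fin.sum_univ_castSucc]
    simp only [Inc, val_inl, val_inr, flip_snoc_castSucc, flip_snoc_last, onesBefore_snoc_last,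
      thru_inl_last, sum, ann, inc, ← saddle_iff x y, DState.onesCount_val]
    simp
  | _, .inr (n := n) x, .inl y => by
    rw [Fin.sum_univ_castSucc]
    simp only [Inc, val_inl, val_inr, flip_snoc_castSucc, flip_snoc_last, inc]
    simp
  | _, .inr (n := n) x, .inr y => by
    rw [Fin.sum_univ_castSucc]
    simp only [Inc, val_inr, flip_snoc_castSucc, flip_snoc_last, onesBefore_snoc_castSucc,
      thru_inr_castSucc, agree_inr, sum, ann, inc, ← sum_inc x y]
    simp
    exact Finset.sum_congr rfl fun c _ => by congr

end LState

/-! ### Circles of the smoothed clasp-braid -/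

/-- The function `F` of levels and places is constant along the arcs of the half twists. -/
def TwistCompat {α : Type*} (m : ℕ) (v : Fin (m + 2) → Bool) (F : ℕ → Site → α) : Prop :=
  ∀ j (hj : j < m), if v ⟨j + 2, by omega⟩
    then F j .left = F (j + 1) .left ∧ F j .right = F (j + 1) .right
    else F j .left = F j .right ∧ F (j + 1) .left = F (j + 1) .right

/-- The function `F` is constant along the arcs of the clasp, whose lower ends have values `lo` and
`ro`. -/
def ClaspCompat {α : Type*} (a b : Bool) (F : Site → α) (lo ro : α) : Prop :=
  (if a then lo = F .left ∧ F .bot = F .top else lo = F .bot ∧ F .top = F .left) ∧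
  (if b then F .bot = F .top ∧ ro = F .right else F .bot = ro ∧ F .right = F .top)

/-- The function `F` is constant along the arcs of the smoothing `v` of the clasp-braid, whose lower
ends have values `lo` and `ro`. -/
def Compat {α : Type*} (m : ℕ) (v : Fin (m + 2) → Bool) (F : ℕ → Site → α) (lo ro : α) : Prop :=
  ClaspCompat (v ⟨0, by omega⟩) (v ⟨1, by omega⟩) (F 0) lo ro ∧ TwistCompat m v F

theorem compat_zero {α : Type*} (v : Fin 2 → Bool) (F : ℕ → Site → α) (lo ro : α) :
    Compat 0 v F lo ro ↔ ClaspCompat (v 0) (v 1) (F 0) lo ro :=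
  and_iff_left fun _ h => absurd h (Nat.not_lt_zero _)

theorem compat_snoc {α : Type*} (m : ℕ) (v : Fin (m + 2) → Bool) (b : Bool) (F : ℕ → Site → α)
    (lo ro : α) : Compat (m + 1) (Fin.snoc (α := fun _ => Bool) v b) F lo ro ↔
      Compat m v F lo ro ∧ if b
        then F m .left = F (m + 1) .left ∧ F m .right = F (m + 1) .right
        else F m .left = F m .right ∧ F (m + 1) .left = F (m + 1) .right := by
  have key : ∀ (j : ℕ) (hj : j < m + 2), Fin.snoc (α := fun _ => Bool) v b ⟨j, by omega⟩ =
      v ⟨j, hj⟩ := fun j hj => Fin.snoc_castSucc (α := fun _ => Bool) b v ⟨j, hj⟩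
  have key' : Fin.snoc (α := fun _ => Bool) v b ⟨m + 2, by omega⟩ = b :=
    Fin.snoc_last (α := fun _ => Bool) b v
  unfold Compat
  rw [key 0, key 1, and_assoc]
  refine and_congr_right fun _ => ⟨fun h => ⟨fun j hj => ?_, ?_⟩, fun h j hj => ?_⟩
  · have := h j (by omega)
    rwa [key] at this
  · have := h m (by omega)
    rwa [key'] at this
  · rcases Nat.lt_succ_iff_lt_or_eq.1 hj with hj | rfl
    · rw [key _ (by omega)]; exact h.1 j hj
    · rw [key']; exact h.2

/-- The value of `F` at a representative of the circle with label `t`. -/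
def atLabel {α : Type*} (F : ℕ → Site → α) (t : ℤ) : α :=
  if 0 ≤ t then F t.toNat .left else if t = -1 then F 0 .bot else if t = -2 then F 0 .top
  else F 0 .right

theorem atLabel_congr {α : Type*} {F G : ℕ → Site → α} {t : ℤ} {m : ℕ} (ht : t ≤ m)
    (h : ∀ k ≤ m, ∀ e, F k e = G k e) : atLabel F t = atLabel G t := by
  unfold atLabel
  split_ifs
  · exact h _ (by omega) _
  all_goals exact h _ (by omega) _

namespace HopfState

theorem claspCompat_lab (x : HopfState) :
    ClaspCompat (x.val 0) (x.val 1) (fun e => if e = .right then x.lab .left else x.lab e)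
      (x.lab .right) (x.lab .right) := by
  unfold ClaspCompat; revert x; decide

theorem claspCompat_sgn (x : HopfState) :
    ClaspCompat (x.val 0) (x.val 1) (fun e => if e = .right then x.sgn .left else x.sgn e)
      (x.sgn .right) (x.sgn .right) := by
  unfold ClaspCompat; revert x; decide

end HopfState

namespace BaseState

theorem claspCompat_lab (x : BaseState) :
    ClaspCompat (x.val 0) (x.val 1) x.lab (x.lab .left) (x.lab .right) := by
  unfold ClaspCompat; revert x; decide

theorem claspCompat_sgn (x : BaseState) :
    ClaspCompat (x.val 0) (x.val 1) x.sgn (x.sgn .left) (x.sgn .right) := by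
  unfold ClaspCompat; revert x; decide

end BaseState

namespace DState

/-- Label of the circle at a place; `left` and `right` are the strands at level `k`, which belong to
the same circle. -/
def placeLab {m} (x : DState m) (k : ℕ) : Site → ℤ
  | .left => x.lab k
  | .right => x.lab k
  | e => x.base.lab e

/-- Sign of the circle at a place. -/
def placeSgn {m} (x : DState m) (k : ℕ) : Site → Bool
  | .left => x.sgn k
  | .right => x.sgn k
  | e => x.base.sgn e

theorem placeLab_cons_of_le {m} (o : Option Bool) (x : DState m) {k : ℕ} (h : k ≤ m) (e : Site) :
    placeLab (.cons o x) k e = x.placeLab k e := by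
  cases e <;> simp [placeLab, lab_cons_of_le _ _ h, base_cons]

theorem placeSgn_cons_of_le {m} (o : Option Bool) (x : DState m) {k : ℕ} (h : k ≤ m) (e : Site) :
    placeSgn (.cons o x) k e = x.placeSgn k e := by
  cases e <;> simp [placeSgn, sgn_cons_of_le _ _ h, base_cons]

end DState

theorem compat_congr {α : Type*} {m : ℕ} {v : Fin (m + 2) → Bool} {F G : ℕ → Site → α} {lo ro : α}
    (h : ∀ k ≤ m, ∀ e, F k e = G k e) : Compat m v F lo ro ↔ Compat m v G lo ro := by
  unfold Compat
  have h0 : F 0 = G 0 := funext fun e => h 0 (by omega) e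
  rw [h0]
  refine and_congr_right fun _ => forall_congr' fun j => forall_congr' fun hj => ?_
  rw [h j (by omega), h j (by omega), h (j + 1) (by omega), h (j + 1) (by omega)]

namespace DState

theorem compat_lab : ∀ {m} (x : DState m),
    Compat m x.val x.placeLab (x.base.lab .right) (x.base.lab .right)
  | _, .nil x => by
    rw [compat_zero]
    have h : (nil x).placeLab 0 = fun e => if e = .right then x.lab .left else x.lab e := by
      funext e
      cases e <;> simp [placeLab, lab, base, HopfState.lab_left]
    rw [h]
    exact HopfState.claspCompat_lab x
  | _, .cons (m := m) o x => by
    rw [val_cons, base_cons, compat_snoc, compat_congr fun k hk e => placeLab_cons_of_le o x hk e]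
    refine ⟨compat_lab x, ?_⟩
    rcases o with _ | s <;> simp [placeLab, lab]

theorem compat_sgn : ∀ {m} (x : DState m),
    Compat m x.val x.placeSgn (x.base.sgn .right) (x.base.sgn .right)
  | _, .nil x => by
    rw [compat_zero]
    have h : (nil x).placeSgn 0 = fun e => if e = .right then x.sgn .left else x.sgn e := by
      funext e
      cases e <;> simp [placeSgn, sgn, base]
    rw [h]
    exact HopfState.claspCompat_sgn x
  | _, .cons (m := m) o x => by
    rw [val_cons, base_cons, compat_snoc, compat_congr fun k hk e => placeSgn_cons_of_le o x hk e]
    refine ⟨compat_sgn x, ?_⟩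
    rcases o with _ | s <;> simp [placeSgn, sgn]

/-- A function that is constant along the arcs of the smoothing is constant on sets of places with
the same label. -/
theorem eq_atLabel {α : Type*} : ∀ {m} (x : DState m) {F : ℕ → Site → α} {lo ro : α},
    Compat m x.val F lo ro → F m .left = F m .right → lo = ro →
    (∀ k ≤ m, F k .left = atLabel F (x.lab k) ∧ F k .right = atLabel F (x.lab k)) ∧
      lo = atLabel F (x.base.lab .right) ∧ F 0 .bot = atLabel F (x.base.lab .bot) ∧
      F 0 .top = atLabel F (x.base.lab .top)
  | _, .nil x, F, lo, ro, h, h1, h2 => by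
    rw [compat_zero] at h
    have h3 : atLabel F 0 = F 0 .left := by simp [atLabel]
    have h4 : atLabel F (-1) = F 0 .bot := by simp [atLabel]
    have h5 : atLabel F (-2) = F 0 .top := by simp [atLabel]
    refine ⟨fun k hk => ?_, ?_⟩
    · obtain rfl : k = 0 := by omega
      simp [lab, h3, h1]
    · subst h2
      rcases x <;> simp [base, HopfState.lab, h3, h4, h5, ClaspCompat, val, HopfState.val] at h ⊢ <;>
        grind
  | _, .cons (m := m) o x, F, lo, ro, h, h1, h2 => by
    rw [val_cons, compat_snoc] at h
    have h3 : F m .left = F m .right := by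
      rcases o with _ | s
      · simp at h; rw [h.2.1, h.2.2, h1]
      · simp at h; exact h.2.1
    have ih := eq_atLabel x h.1 h3 h2
    refine ⟨fun k hk => ?_, ih.2⟩
    rcases Nat.le_succ_iff.1 hk with hk | rfl
    · simpa only [lab_cons_of_le _ _ hk] using ih.1 k hk
    · rcases o with _ | s
      · simp only [Option.isNone_none, if_true] at h
        have := ih.1 m le_rfl
        rw [h.2.1, h.2.2] at this
        rwa [Nat.succ_eq_add_one, lab_cons_none_top]
      · have h4 : atLabel F ((m : ℤ) + 1) = F (m + 1) .left := by
          have : (0 : ℤ) ≤ m + 1 := by omega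
          simp [atLabel, this]
        rw [Nat.succ_eq_add_one, lab_cons_some_top, h4, h1]
        exact ⟨rfl, rfl⟩

/-- Every choice of signs that is constant along the arcs of a smoothing comes from a sign
sequence. -/
theorem exists_of_compat : ∀ {m} (v : Fin (m + 2) → Bool) (F : ℕ → Site → Bool) (lo ro : Bool),
    Compat m v F lo ro → F m .left = F m .right → lo = ro →
    ∃ x : DState m, x.val = v ∧ (∀ k ≤ m, x.sgn k = F k .left ∧ x.sgn k = F k .right) ∧
      x.base.sgn .right = lo ∧ x.base.sgn .bot = F 0 .bot ∧ x.base.sgn .top = F 0 .top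
  | 0, v, F, lo, ro, h, h1, h2 => by
    rw [compat_zero] at h
    subst h2
    have hv : v = ![v 0, v 1] := by ext i; fin_cases i <;> rfl
    generalize v 0 = a at *
    generalize v 1 = b at *
    subst hv
    rcases a <;> rcases b <;> simp [ClaspCompat] at h
    · exact ⟨.nil (.s00 (F 0 .left) lo), rfl, by simp [sgn, HopfState.sgn, h1], rfl,
        by simp [base, HopfState.sgn]; grind, by simp [base, HopfState.sgn]; grind⟩
    · exact ⟨.nil (.s01 (F 0 .left)), rfl, by simp [sgn, HopfState.sgn, h1],
        by simp [base, HopfState.sgn]; grind,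
        by simp [base, HopfState.sgn]; grind, by simp [base, HopfState.sgn]; grind⟩
    · exact ⟨.nil (.s10 (F 0 .left)), rfl, by simp [sgn, HopfState.sgn, h1],
        by simp [base, HopfState.sgn]; grind,
        by simp [base, HopfState.sgn]; grind, by simp [base, HopfState.sgn]; grind⟩
    · exact ⟨.nil (.s11 (F 0 .left) (F 0 .bot)), rfl, by simp [sgn, HopfState.sgn, h1],
        by simp [base, HopfState.sgn]; grind,
        by simp [base, HopfState.sgn], by simp [base, HopfState.sgn]; grind⟩
  | m + 1, v, F, lo, ro, h, h1, h2 => by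
    obtain ⟨w, b, rfl⟩ : ∃ w b, v = Fin.snoc (α := fun _ => Bool) w b :=
      ⟨Fin.init v, v (Fin.last _), (Fin.snoc_init_self v).symm⟩
    rw [compat_snoc] at h
    have h3 : F m .left = F m .right := by
      rcases b
      · simp at h; exact h.2.1
      · simp at h; rw [h.2.1, h.2.2, h1]
    obtain ⟨x, rfl, hx, hx'⟩ := exists_of_compat w F lo ro h.1 h3 h2
    refine ⟨.cons (if b then none else some (F (m + 1) .left)) x, ?_, fun k hk => ?_, by rwa [base_cons]⟩
    · rw [val_cons]; rcases b <;> rfl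
    · rcases Nat.le_succ_iff.1 hk with hk | rfl
      · simpa only [sgn_cons_of_le _ _ hk] using hx k hk
      · have := hx m le_rfl
        rcases b <;> simp_all [sgn]

end DState

namespace LState

theorem lab_inl {n} (x : DState n) {k : ℕ} (hk : k ≤ n) (e : Site) :
    lab (.inl x) k e = x.placeLab k e := by
  cases e <;> simp [lab, DState.placeLab, hk]

theorem sgn_inl {n} (x : DState n) {k : ℕ} (hk : k ≤ n) (e : Site) :
    sgn (.inl x) k e = x.placeSgn k e := by
  cases e <;> simp [sgn, DState.placeSgn, hk]

theorem compat_lab : ∀ {n} (x : LState n), Compat n x.val x.lab (x.lab n .left) (x.lab n .right)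
  | _, .nil x => by
    rw [compat_zero]
    exact BaseState.claspCompat_lab x
  | _, .inl x => by
    rw [val_inl, compat_snoc, compat_congr fun k hk e => lab_inl x hk e]
    simpa [lab] using x.compat_lab
  | _, .inr x => by
    rw [val_inr, compat_snoc, compat_congr fun k hk e => lab_inr_of_le x hk e]
    simpa [lab] using x.compat_lab

theorem compat_sgn : ∀ {n} (x : LState n), Compat n x.val x.sgn (x.sgn n .left) (x.sgn n .right)
  | _, .nil x => by
    rw [compat_zero]
    exact BaseState.claspCompat_sgn x
  | _, .inl x => by
    rw [val_inl, compat_snoc, compat_congr fun k hk e => sgn_inl x hk e]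
    simpa [sgn] using x.compat_sgn
  | _, .inr x => by
    rw [val_inr, compat_snoc, compat_congr fun k hk e => sgn_inr_of_le x hk e]
    simpa [sgn] using x.compat_sgn

/-- Whether there is an edge at the given level and place. -/
def Valid (n k : ℕ) (e : Site) : Prop := k ≤ n ∧ ((e = .bot ∨ e = .top) → k = 0)

/-- A function that is constant along the arcs of the smoothing is constant on sets of places with
the same label. -/
theorem eq_atLabel {α : Type*} : ∀ {n} (x : LState n) {F : ℕ → Site → α} {lo ro : α},
    Compat n x.val F lo ro → lo = F n .left → ro = F n .right →
    ∀ {k e}, Valid n k e → F k e = atLabel F (x.lab k e)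
  | _, .nil x, F, lo, ro, h, h1, h2, k, e, hk => by
    rw [compat_zero] at h
    have h3 : atLabel F 0 = F 0 .left := by simp [atLabel]
    have h4 : atLabel F (-3) = F 0 .right := by simp [atLabel]
    have h5 : atLabel F (-2) = F 0 .top := by simp [atLabel]
    obtain rfl : k = 0 := by have := hk.1; omega
    rcases x <;> cases e <;>
      simp [lab, BaseState.lab, h3, h4, h5, ClaspCompat, val, BaseState.val] at h ⊢ <;> grind
  | _, .inl (n := n) x, F, lo, ro, h, h1, h2, k, e, hk => by
    rw [val_inl, compat_snoc] at h
    simp only [Bool.false_eq_true, if_false] at h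
    have ih := x.eq_atLabel h.1 h.2.1 (h1.trans (h.2.2.trans h2.symm))
    rcases e with _ | _ | _ | _
    · by_cases hk' : k ≤ n
      · simpa [lab, hk'] using (ih.1 k hk').1
      · obtain rfl : k = n + 1 := by have := hk.1; omega
        simpa [lab, ← h1] using ih.2.1
    · by_cases hk' : k ≤ n
      · simpa [lab, hk'] using (ih.1 k hk').2
      · obtain rfl : k = n + 1 := by have := hk.1; omega
        simpa [lab, ← h.2.2, ← h1] using ih.2.1
    · obtain rfl := hk.2 (by simp)
      exact ih.2.2.1
    · obtain rfl := hk.2 (by simp)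
      exact ih.2.2.2
  | _, .inr (n := n) x, F, lo, ro, h, h1, h2, k, e, hk => by
    rw [val_inr, compat_snoc] at h
    simp only [if_true] at h
    have ih := fun k e => @eq_atLabel _ _ x F lo ro h.1 (h1.trans h.2.1.symm) (h2.trans h.2.2.symm) k e
    by_cases hk' : k ≤ n
    · rw [lab_inr_of_le _ hk']
      exact ih _ _ ⟨hk', hk.2⟩
    · obtain rfl : k = n + 1 := by have := hk.1; omega
      rcases e with _ | _ | _ | _
      · rw [← h.2.1, lab_inr_top]; exact ih _ _ ⟨le_rfl, by simp⟩
      · rw [← h.2.2, lab_inr_top]; exact ih _ _ ⟨le_rfl, by simp⟩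
      · simp [Valid] at hk
      · simp [Valid] at hk

/-- Every choice of signs that is constant along the arcs of a smoothing comes from a sign
sequence. -/
theorem exists_of_compat : ∀ {n} (v : Fin (n + 2) → Bool) (F : ℕ → Site → Bool) (lo ro : Bool),
    Compat n v F lo ro → lo = F n .left → ro = F n .right →
    ∃ x : LState n, x.val = v ∧ ∀ k e, Valid n k e → x.sgn k e = F k e
  | 0, v, F, lo, ro, h, h1, h2 => by
    rw [compat_zero] at h
    subst h1 h2
    have hv : v = ![v 0, v 1] := by ext i; fin_cases i <;> rfl
    generalize v 0 = a at *
    generalize v 1 = b at *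
    subst hv
    suffices ∃ x : BaseState, x.val = ![a, b] ∧ ∀ e, x.sgn e = F 0 e by
      obtain ⟨x, hx, hx'⟩ := this
      refine ⟨.nil x, hx, fun k e hk => ?_⟩
      obtain rfl : k = 0 := by have := hk.1; omega
      exact hx' e
    rcases a <;> rcases b <;> simp [ClaspCompat] at h
    · exact ⟨.s00 (F 0 .left), rfl, by rintro (_ | _ | _ | _) <;> simp [BaseState.sgn] <;> grind⟩
    · exact ⟨.s01 (F 0 .left) (F 0 .right), rfl,
        by rintro (_ | _ | _ | _) <;> simp [BaseState.sgn] <;> grind⟩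
    · exact ⟨.s10 (F 0 .left) (F 0 .right), rfl,
        by rintro (_ | _ | _ | _) <;> simp [BaseState.sgn] <;> grind⟩
    · exact ⟨.s11 (F 0 .left) (F 0 .right) (F 0 .bot), rfl,
        by (rintro (_ | _ | _ | _) <;> simp [BaseState.sgn]); grind⟩
  | n + 1, v, F, lo, ro, h, h1, h2 => by
    obtain ⟨w, b, rfl⟩ : ∃ w b, v = Fin.snoc (α := fun _ => Bool) w b :=
      ⟨Fin.init v, v (Fin.last _), (Fin.snoc_init_self v).symm⟩
    rw [compat_snoc] at h
    rcases b
    · simp only [Bool.false_eq_true, if_false] at h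
      obtain ⟨x, rfl, hx, hx'⟩ := DState.exists_of_compat w F lo ro h.1 h.2.1
        (h1.trans (h.2.2.trans h2.symm))
      refine ⟨.inl x, rfl, fun k e hk => ?_⟩
      rcases e with _ | _ | _ | _ <;> simp only [sgn]
      · split_ifs with hk'
        · exact (hx k hk').1
        · obtain rfl : k = n + 1 := by have := hk.1; omega
          exact hx'.1.trans h1
      · split_ifs with hk'
        · exact (hx k hk').2
        · obtain rfl : k = n + 1 := by have := hk.1; omega
          exact hx'.1.trans (h1.trans h.2.2)
      · obtain rfl := hk.2 (by simp)
        exact hx'.2.1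
      · obtain rfl := hk.2 (by simp)
        exact hx'.2.2
    · simp only [if_true] at h
      obtain ⟨x, rfl, hx⟩ := exists_of_compat w F lo ro h.1 (h1.trans h.2.1.symm)
        (h2.trans h.2.2.symm)
      refine ⟨.inr x, rfl, fun k e hk => ?_⟩
      by_cases hk' : k ≤ n
      · rw [sgn_inr_of_le _ hk']
        exact hx k e ⟨hk', hk.2⟩
      · obtain rfl : k = n + 1 := by have := hk.1; omega
        rcases e with _ | _ | _ | _
        · rw [← h.2.1, sgn_inr_top]; exact hx _ _ ⟨le_rfl, by simp⟩
        · rw [← h.2.2, sgn_inr_top]; exact hx _ _ ⟨le_rfl, by simp⟩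
        · simp [Valid] at hk
        · simp [Valid] at hk

end LState

namespace DState

theorem lab_mem_labels : ∀ {m} (x : DState m) (k : ℕ), x.lab k ∈ x.labels
  | _, .nil x, _ => by rcases x <;> simp [lab, labels, HopfState.labels]
  | _, .cons (m := m) none x, k => by
    have h1 := lab_mem_labels x k
    have h2 := lab_mem_labels x m
    simp only [lab, labels]
    split_ifs <;> simp_all
  | _, .cons (m := m) (some s) x, k => by
    have h1 := lab_mem_labels x k
    simp only [lab, labels, Finset.mem_insert]
    split_ifs <;> simp_all

theorem base_lab_mem_labels : ∀ {m} (x : DState m) (e : Site), x.base.lab e ∈ x.labels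
  | _, .nil x, e => by revert x e; decide
  | _, .cons none x, e => base_lab_mem_labels x e
  | _, .cons (some _) x, e => Finset.mem_insert_of_mem (base_lab_mem_labels x e)

theorem exists_of_mem_labels : ∀ {m} (x : DState m) {t : ℤ}, t ∈ x.labels →
    (∃ k ≤ m, x.lab k = t) ∨ ∃ e, x.base.lab e = t
  | _, .nil x, t, h => Or.inr (by
      rw [Site.exists]
      rcases x <;> simp [labels, HopfState.labels, base, HopfState.lab] at h ⊢ <;> tauto)
  | _, .cons (m := m) none x, t, h => by
    rcases exists_of_mem_labels x h with ⟨k, hk, h⟩ | h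
    · exact Or.inl ⟨k, by omega, by rwa [lab_cons_of_le _ _ hk]⟩
    · exact Or.inr h
  | _, .cons (m := m) (some s) x, t, h => by
    rcases Finset.mem_insert.1 h with rfl | h
    · exact Or.inl ⟨m + 1, le_rfl, lab_cons_some_top s x⟩
    rcases exists_of_mem_labels x h with ⟨k, hk, h⟩ | h
    · exact Or.inl ⟨k, by omega, by rwa [lab_cons_of_le _ _ hk]⟩
    · exact Or.inr h

theorem le_of_mem_labels {m} (x : DState m) {t : ℤ} (h : t ∈ x.labels) : t ≤ m := by
  rcases exists_of_mem_labels x h with ⟨k, _, rfl⟩ | ⟨e, rfl⟩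
  · exact lab_le _ _
  · exact (HopfState.lab_nonpos _ _).trans (Int.natCast_nonneg m)

theorem sum_labels : ∀ {m} (x : DState m),
    ∑ t ∈ x.labels, sgnInt (atLabel x.placeSgn t) = x.sum
  | _, .nil x => by
    rcases x <;> simp [labels, HopfState.labels, atLabel, placeSgn, sgn, sum, HopfState.sum,
      HopfState.sgn, base]
  | _, .cons (m := m) none x => by
    rw [labels, sum, ← sum_labels x]
    refine Finset.sum_congr rfl fun t ht => ?_
    rw [atLabel_congr (le_of_mem_labels x ht) fun k hk e => placeSgn_cons_of_le _ x hk e]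
  | _, .cons (m := m) (some s) x => by
    have h1 : (m + 1 : ℤ) ∉ x.labels := fun h => by have := le_of_mem_labels x h; omega
    have h2 : atLabel (placeSgn (.cons (some s) x)) ((m : ℤ) + 1) = s := by
      have h3 : (0 : ℤ) ≤ m + 1 := by omega
      have h4 : ((m : ℤ) + 1).toNat = m + 1 := by omega
      simp [atLabel, h3, placeSgn, h4, sgn]
    rw [labels, sum, ← sum_labels x, Finset.sum_insert h1, h2]
    congr 1
    refine Finset.sum_congr rfl fun t ht => ?_
    rw [atLabel_congr (le_of_mem_labels x ht) fun k hk e => placeSgn_cons_of_le _ x hk e]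

end DState

namespace LState

theorem lab_mem_labels : ∀ {n} (x : LState n) (k : ℕ) (e : Site), x.lab k e ∈ x.labels
  | _, .nil x, _, e => by
    simp only [lab, labels]; revert x e; decide
  | _, .inl (n := n) x, k, e => by
    have h1 := x.lab_mem_labels k
    have h2 := x.base_lab_mem_labels
    cases e <;> simp only [lab, labels] <;> (try split_ifs) <;> simp [*]
  | _, .inr (n := n) x, k, e => lab_mem_labels x _ e

theorem exists_of_mem_labels : ∀ {n} (x : LState n) {t : ℤ}, t ∈ x.labels →
    ∃ k e, Valid n k e ∧ x.lab k e = t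
  | _, .nil x, t, h => by
    refine ⟨0, ?_⟩
    have : ∀ e, Valid 0 0 e := fun e => ⟨le_rfl, fun _ => rfl⟩
    simp only [this, true_and]
    rw [Site.exists]
    rcases x <;> simp [labels, BaseState.labels, lab, BaseState.lab] at h ⊢ <;> tauto
  | _, .inl (n := n) x, t, h => by
    rcases x.exists_of_mem_labels h with ⟨k, hk, h⟩ | ⟨e, h⟩
    · exact ⟨k, .left, ⟨by omega, by simp⟩, by simpa [lab, hk] using h⟩
    · rcases e with _ | _ | _ | _
      · exact ⟨0, .left, ⟨by omega, by simp⟩, by simpa [lab, DState.lab_zero] using h⟩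
      · exact ⟨n + 1, .right, ⟨by omega, by simp⟩, by simpa [lab] using h⟩
      · exact ⟨0, .bot, ⟨by omega, by simp⟩, by simpa [lab] using h⟩
      · exact ⟨0, .top, ⟨by omega, by simp⟩, by simpa [lab] using h⟩
  | _, .inr (n := n) x, t, h => by
    obtain ⟨k, e, hk, h⟩ := exists_of_mem_labels x h
    exact ⟨k, e, ⟨by have := hk.1; omega, hk.2⟩, by rwa [lab_inr_of_le _ hk.1]⟩

theorem le_of_mem_labels : ∀ {n} (x : LState n) {t : ℤ}, t ∈ x.labels → t ≤ n
  | _, .nil x, t, h => by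
    rcases x <;> simp [labels, BaseState.labels] at h <;> omega
  | _, .inl (n := n) x, t, h => by have := x.le_of_mem_labels h; push_cast; omega
  | _, .inr (n := n) x, t, h => by have := le_of_mem_labels x h; push_cast; omega

theorem sum_labels : ∀ {n} (x : LState n), ∑ t ∈ x.labels, sgnInt (atLabel x.sgn t) = x.sum
  | _, .nil x => by
    rcases x <;> simp [labels, BaseState.labels, atLabel, sgn, sum, BaseState.sum, BaseState.sgn,
      add_assoc]
  | _, .inl (n := n) x => by
    rw [labels, sum, ← x.sum_labels]
    refine Finset.sum_congr rfl fun t ht => ?_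
    rw [atLabel_congr (x.le_of_mem_labels ht) fun k hk e => sgn_inl x hk e]
  | _, .inr (n := n) x => by
    rw [labels, sum, ← sum_labels x]
    refine Finset.sum_congr rfl fun t ht => ?_
    rw [atLabel_congr (le_of_mem_labels x ht) fun k hk e => sgn_inr_of_le x hk e]

theorem ann_eq : ∀ {n} (x : LState n), x.ann =
    if x.lab n .left = x.lab n .right then 0 else sgnInt (x.sgn n .left) + sgnInt (x.sgn n .right)
  | _, .nil x => by rcases x <;> simp [ann, BaseState.ann, lab, BaseState.lab, sgn, BaseState.sgn]
  | _, .inl (n := n) x => by simp [ann, lab]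
  | _, .inr (n := n) x => by
    rw [lab_inr_top, lab_inr_top, sgn_inr_top, sgn_inr_top, ← ann_eq x, ann]

theorem eq_of_sgn : ∀ {n} {x y : LState n}, x.val = y.val →
    (∀ k e, Valid n k e → x.sgn k e = y.sgn k e) → x = y
  | _, .nil x, .nil y, h, h' => by
    have h1 : ∀ e, x.sgn e = y.sgn e := fun e => h' 0 e ⟨le_rfl, fun _ => rfl⟩
    simp only [val] at h
    congr 1
    clear h'
    revert x y; decide
  | _, .inl (n := n) x, .inl y, h, h' => by
    rw [val_inl, val_inl, Fin.snoc_inj] at h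
    congr 1
    refine DState.eq_of_sgn h.1 (fun k hk => ?_) fun e => ?_
    · simpa [sgn, hk] using h' k .left ⟨by omega, by simp⟩
    · rcases e with _ | _ | _ | _
      · simpa [sgn, DState.sgn_zero] using h' 0 .left ⟨by omega, by simp⟩
      · simpa [sgn] using h' (n + 1) .right ⟨by omega, by simp⟩
      · exact h' 0 .bot ⟨by omega, by simp⟩
      · exact h' 0 .top ⟨by omega, by simp⟩
  | _, .inr (n := n) x, .inr y, h, h' => by
    rw [val_inr, val_inr, Fin.snoc_inj] at h
    congr 1
    refine eq_of_sgn h.1 fun k e hk => ?_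
    have := h' k e ⟨by have := hk.1; omega, hk.2⟩
    rwa [sgn_inr_of_le _ hk.1, sgn_inr_of_le _ hk.1] at this
  | _, .inl (n := n) x, .inr y, h, _ => by simp [val_inl, val_inr, Fin.snoc_inj] at h
  | _, .inr (n := n) x, .inl y, h, _ => by simp [val_inl, val_inr, Fin.snoc_inj] at h

end LState

/-! ### Sign sequences and enhanced states -/

namespace LState

open AnnularDiagram

/-- Level and place of an edge. -/
def place {n : ℕ} : ClaspEdge n → ℕ × Site
  | .l k => (k, .left)
  | .r k => (k, .right)
  | .bot => (0, .bot)
  | .top => (0, .top)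

/-- The edge at a given level and place (for levels above `n`, that at level `n`). -/
def edge (n k : ℕ) : Site → ClaspEdge n
  | .left => .l ⟨min k n, by omega⟩
  | .right => .r ⟨min k n, by omega⟩
  | .bot => .bot
  | .top => .top

theorem valid_place {n : ℕ} (e : ClaspEdge n) : Valid n (place e).1 (place e).2 := by
  rcases e with ⟨k, hk⟩ | ⟨k, hk⟩ | _ | _ <;> simp [Valid, place] <;> omega

theorem edge_place {n : ℕ} (e : ClaspEdge n) : edge n (place e).1 (place e).2 = e := by
  rcases e with ⟨k, hk⟩ | ⟨k, hk⟩ | _ | _ <;> simp [edge, place] <;> omega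

theorem place_edge {n k : ℕ} {e : Site} (h : Valid n k e) : place (edge n k e) = (k, e) := by
  have h1 := h.1
  rcases e with _ | _ | _ | _
  · simp [edge, place, h1]
  · simp [edge, place, h1]
  · rw [h.2 (by simp)]; rfl
  · rw [h.2 (by simp)]; rfl

theorem place_corner (n : ℕ) (c : Fin (n + 2)) (i : Fin 4) :
    place ((claspBraid n).corner c i) = corner n c i := by
  obtain ⟨c, hc⟩ := c
  rcases c with _ | _ | k <;> fin_cases i <;> rfl

theorem eq_of_joinedAt {α : Type*} {n : ℕ} {v : Fin (n + 2) → Bool} {F : ℕ → Site → α}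
    (h : Compat n v F (F n .left) (F n .right)) {c : Fin (n + 2)} {e f : ClaspEdge n}
    (hj : (claspBraid n).JoinedAt c (v c) e f) :
    F (place e).1 (place e).2 = F (place f).1 (place f).2 := by
  obtain ⟨⟨h1, h2⟩, h3⟩ := h
  unfold JoinedAt at hj
  obtain ⟨c, hc⟩ := c
  rcases c with _ | _ | k
  · split_ifs at hj with hv
    · rw [if_pos hv] at h1
      rcases hj with ⟨rfl, rfl⟩ | ⟨rfl, rfl⟩ <;> simp only [place_corner] <;> simp [corner, h1]
    · rw [if_neg hv] at h1
      rcases hj with ⟨rfl, rfl⟩ | ⟨rfl, rfl⟩ <;> simp only [place_corner] <;> simp [corner, h1]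
  · split_ifs at hj with hv
    · rw [if_pos hv] at h2
      rcases hj with ⟨rfl, rfl⟩ | ⟨rfl, rfl⟩ <;> simp only [place_corner] <;> simp [corner, h2]
    · rw [if_neg hv] at h2
      rcases hj with ⟨rfl, rfl⟩ | ⟨rfl, rfl⟩ <;> simp only [place_corner] <;> simp [corner, h2]
  · have h4 := h3 k (by omega)
    split_ifs at hj with hv
    · rw [if_pos hv] at h4
      rcases hj with ⟨rfl, rfl⟩ | ⟨rfl, rfl⟩ <;> simp only [place_corner] <;> simp [corner, h4]
    · rw [if_neg hv] at h4
      rcases hj with ⟨rfl, rfl⟩ | ⟨rfl, rfl⟩ <;> simp only [place_corner] <;> simp [corner, h4]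

theorem circle_eq_of_joinedAt {n : ℕ} {v : Fin (n + 2) → Bool} {c : Fin (n + 2)}
    {e f : ClaspEdge n} (hj : (claspBraid n).JoinedAt c (v c) e f) :
    (claspBraid n).circle v e = (claspBraid n).circle v f :=
  Quotient.sound (Relation.EqvGen.rel _ _ ⟨c, hj⟩)

theorem circle_corner_eq {n : ℕ} (v : Fin (n + 2) → Bool) (c : Fin (n + 2)) :
    if v c then (claspBraid n).circle v ((claspBraid n).corner c 0) =
        (claspBraid n).circle v ((claspBraid n).corner c 3) ∧
        (claspBraid n).circle v ((claspBraid n).corner c 1) =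
        (claspBraid n).circle v ((claspBraid n).corner c 2)
      else (claspBraid n).circle v ((claspBraid n).corner c 0) =
        (claspBraid n).circle v ((claspBraid n).corner c 1) ∧
        (claspBraid n).circle v ((claspBraid n).corner c 2) =
        (claspBraid n).circle v ((claspBraid n).corner c 3) := by
  split_ifs with h
  · exact ⟨circle_eq_of_joinedAt (c := c) (by simp [JoinedAt, h]),
      circle_eq_of_joinedAt (c := c) (by simp [JoinedAt, h])⟩
  · exact ⟨circle_eq_of_joinedAt (c := c) (by simp [JoinedAt, h]),
      circle_eq_of_joinedAt (c := c) (by simp [JoinedAt, h])⟩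

theorem compat_circle {n : ℕ} (v : Fin (n + 2) → Bool) {α : Type*}
    (g : (claspBraid n).Circle v → α) :
    Compat n v (fun k e => g ((claspBraid n).circle v (edge n k e)))
      (g ((claspBraid n).circle v (edge n n .left)))
      (g ((claspBraid n).circle v (edge n n .right))) := by
  have key : ∀ c i, (claspBraid n).corner c i = edge n (corner n c i).1 (corner n c i).2 := by
    intro c i
    rw [← place_corner, edge_place]
  refine ⟨⟨?_, ?_⟩, fun j hj => ?_⟩
  · have h := circle_corner_eq v ⟨0, by omega⟩
    simp only [key] at h
    split_ifs at h ⊢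
    · exact ⟨congrArg g h.1, congrArg g h.2⟩
    · exact ⟨congrArg g h.1, congrArg g h.2⟩
  · have h := circle_corner_eq v ⟨1, by omega⟩
    simp only [key] at h
    split_ifs at h ⊢
    · exact ⟨congrArg g h.1, congrArg g h.2⟩
    · exact ⟨congrArg g h.1, congrArg g h.2⟩
  · have h := circle_corner_eq v ⟨j + 2, by omega⟩
    simp only [key] at h
    split_ifs at h ⊢
    · exact ⟨congrArg g h.1, congrArg g h.2⟩
    · exact ⟨congrArg g h.1, congrArg g h.2.symm⟩

/-- A function that is constant along the arcs of a smoothing, as a function of the circles. -/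
def onCircle {α : Type*} {n : ℕ} {v : Fin (n + 2) → Bool} (F : ℕ → Site → α)
    (h : Compat n v F (F n .left) (F n .right)) : (claspBraid n).Circle v → α :=
  Quotient.lift (fun e => F (place e).1 (place e).2) fun e f hef => by
    induction hef with
    | rel e f hj => obtain ⟨c, hj⟩ := hj; exact eq_of_joinedAt h hj
    | refl e => rfl
    | symm e f _ ih => exact ih.symm
    | trans e f g _ _ ih1 ih2 => exact ih1.trans ih2

theorem onCircle_circle {α : Type*} {n : ℕ} {v : Fin (n + 2) → Bool} (F : ℕ → Site → α)
    (h : Compat n v F (F n .left) (F n .right)) (e : ClaspEdge n) :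
    onCircle F h ((claspBraid n).circle v e) = F (place e).1 (place e).2 := rfl

theorem circle_eq_iff {n : ℕ} (x : LState n) (e f : ClaspEdge n) :
    (claspBraid n).circle x.val e = (claspBraid n).circle x.val f ↔
      x.lab (place e).1 (place e).2 = x.lab (place f).1 (place f).2 := by
  constructor
  · intro h
    have := congrArg (onCircle x.lab x.compat_lab) h
    simpa only [onCircle_circle] using this
  · intro h
    have key := @eq_atLabel _ n x _ _ _ (compat_circle x.val id) rfl rfl
    have h1 := key (valid_place e)
    have h2 := key (valid_place f)
    rw [h] at h1
    simp only [edge_place, id] at h1 h2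
    rw [h1, h2]

/-- The unit `±1` encoded by a Boolean. -/
def sgnUnit (a : Bool) : ℤˣ := if a then 1 else -1

theorem sgnUnit_val (a : Bool) : (sgnUnit a : ℤ) = sgnInt a := by
  cases a <;> rfl

theorem sgnUnit_inj {a b : Bool} : sgnUnit a = sgnUnit b ↔ a = b := by
  revert a b; decide

theorem exists_sgnUnit (u : ℤˣ) : ∃ a, sgnUnit a = u := by
  rcases Int.units_eq_one_or u with rfl | rfl
  · exact ⟨true, rfl⟩
  · exact ⟨false, rfl⟩

/-- The enhanced state of the clasp-braid that belongs to a sign sequence. -/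
def toState {n : ℕ} (x : LState n) : (claspBraid n).EnhancedState :=
  ⟨x.val, fun z => sgnUnit (onCircle x.sgn x.compat_sgn z)⟩

theorem toState_sign {n : ℕ} (x : LState n) (e : ClaspEdge n) :
    x.toState.sign ((claspBraid n).circle x.toState.v e) =
      sgnUnit (x.sgn (place e).1 (place e).2) := rfl

theorem toState_injective (n : ℕ) : Function.Injective (toState (n := n)) := by
  intro x y h
  have hv : x.val = y.val := congrArg EnhancedState.v h
  refine eq_of_sgn hv fun k e hk => ?_
  have key : ∀ (S T : (claspBraid n).EnhancedState), S = T → ∀ e,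
      S.sign ((claspBraid n).circle S.v e) = T.sign ((claspBraid n).circle T.v e) := by
    rintro S T rfl e; rfl
  have := key _ _ h (edge n k e)
  rwa [toState_sign, toState_sign, sgnUnit_inj, place_edge hk] at this

theorem toState_surjective (n : ℕ) : Function.Surjective (toState (n := n)) := by
  rintro ⟨v, s⟩
  choose u hu using exists_sgnUnit
  obtain ⟨x, rfl, hx⟩ := exists_of_compat v _ _ _ (compat_circle v fun z => u (s z)) rfl rfl
  refine ⟨x, ?_⟩
  unfold toState
  congr 1
  funext z
  induction z using Quotient.inductionOn with
  | h e =>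
    change sgnUnit (x.sgn (place e).1 (place e).2) = s ((claspBraid n).circle x.val e)
    rw [hx _ _ (valid_place e), hu, edge_place]

/-- Sign sequences are enhanced states. -/
noncomputable def stateEquiv (n : ℕ) : LState n ≃ (claspBraid n).EnhancedState :=
  Equiv.ofBijective toState ⟨toState_injective n, toState_surjective n⟩

theorem ones_toState {n : ℕ} (x : LState n) : x.toState.ones = x.deg := x.onesCount_val

theorem sum_sign_toState {n : ℕ} (x : LState n) : ∑ z, (x.toState.sign z : ℤ) = x.sum := by
  rw [← x.sum_labels]
  refine Finset.sum_bij (fun z _ => onCircle x.lab x.compat_lab z) ?_ ?_ ?_ ?_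
  · intro z _
    induction z using Quotient.inductionOn with
    | h e => exact x.lab_mem_labels _ _
  · intro z _ w _
    induction z using Quotient.inductionOn with
    | h e =>
      induction w using Quotient.inductionOn with
      | h f => exact (circle_eq_iff x e f).2
  · intro t ht
    obtain ⟨k, e, hk, rfl⟩ := x.exists_of_mem_labels ht
    refine ⟨(claspBraid n).circle x.val (edge n k e), Finset.mem_univ _, ?_⟩
    rw [onCircle_circle, place_edge hk]
  · intro z _
    induction z using Quotient.inductionOn with
    | h e =>
      change ((sgnUnit (x.sgn (place e).1 (place e).2) : ℤˣ) : ℤ) =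
        sgnInt (atLabel x.sgn (x.lab (place e).1 (place e).2))
      rw [sgnUnit_val, ← eq_atLabel x x.compat_sgn rfl rfl (valid_place e)]

theorem essential_iff {n : ℕ} (v : Fin (n + 2) → Bool) (z : (claspBraid n).Circle v) :
    (claspBraid n).Essential v z ↔
      ¬ ((claspBraid n).circle v (.l (Fin.last n)) = z ↔
        (claspBraid n).circle v (.r (Fin.last n)) = z) := by
  classical
  unfold Essential
  have h : ∑ e ∈ Finset.univ.filter (fun e => (claspBraid n).circle v e = z), (claspBraid n).cut e =
      (if (claspBraid n).circle v (.l (Fin.last n)) = z then 1 else 0) +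
      (if (claspBraid n).circle v (.r (Fin.last n)) = z then 1 else 0) := by
    rw [Finset.sum_filter]
    have h1 : ∀ e : ClaspEdge n, (if (claspBraid n).circle v e = z then (claspBraid n).cut e else 0) =
        (if e = .l (Fin.last n) then
          (if (claspBraid n).circle v (.l (Fin.last n)) = z then 1 else 0) else 0) +
        (if e = .r (Fin.last n) then
          (if (claspBraid n).circle v (.r (Fin.last n)) = z then 1 else 0) else 0) := by
      intro e
      have hcut : (claspBraid n).cut e =
        if e = .l (Fin.last n) ∨ e = .r (Fin.last n) then 1 else 0 := rfl
      rw [hcut]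
      by_cases hl : e = .l (Fin.last n)
      · subst hl; simp
      · by_cases hr : e = .r (Fin.last n)
        · subst hr; simp
        · simp [hl, hr]
    rw [Finset.sum_congr rfl fun e _ => h1 e, Finset.sum_add_distrib]
    simp
  rw [h]
  split_ifs with h1 h2 h2 <;> simp [h1, h2]

open scoped Classical in
theorem adeg_eq {n : ℕ} (S : (claspBraid n).EnhancedState) :
    S.adeg = if (claspBraid n).circle S.v (.l (Fin.last n)) =
        (claspBraid n).circle S.v (.r (Fin.last n)) then 0
      else (S.sign ((claspBraid n).circle S.v (.l (Fin.last n))) : ℤ) +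
        (S.sign ((claspBraid n).circle S.v (.r (Fin.last n))) : ℤ) := by
  unfold EnhancedState.adeg
  rw [Finset.sum_filter]
  simp only [essential_iff]
  split_ifs with h
  · rw [h]; simp
  · have h1 : ∀ z, (if ¬ ((claspBraid n).circle S.v (.l (Fin.last n)) = z ↔
        (claspBraid n).circle S.v (.r (Fin.last n)) = z) then (S.sign z : ℤ) else 0) =
        (if (claspBraid n).circle S.v (.l (Fin.last n)) = z then (S.sign z : ℤ) else 0) +
        (if (claspBraid n).circle S.v (.r (Fin.last n)) = z then (S.sign z : ℤ) else 0) := by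
      intro z
      by_cases hl : (claspBraid n).circle S.v (.l (Fin.last n)) = z
      · have hr : ¬ (claspBraid n).circle S.v (.r (Fin.last n)) = z := fun hr => h (hl.trans hr.symm)
        simp [hl, hr]
      · by_cases hr : (claspBraid n).circle S.v (.r (Fin.last n)) = z <;> simp [hl, hr]
    rw [Finset.sum_congr rfl fun z _ => h1 z, Finset.sum_add_distrib]
    simp

theorem adeg_toState {n : ℕ} (x : LState n) : x.toState.adeg = x.ann := by
  classical
  rw [adeg_eq, ann_eq, toState_sign, toState_sign, sgnUnit_val, sgnUnit_val]
  exact if_congr (circle_eq_iff x _ _) rfl rfl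

theorem incident_toState {n : ℕ} (c : Fin (n + 2)) (x y : LState n) :
    EnhancedState.Incident c x.toState y.toState ↔ x.Inc c y := by
  unfold EnhancedState.Incident Inc
  have hones : Flip c x.val y.val → y.deg = x.deg + 1 := by
    rintro ⟨h1, h2⟩
    rw [← onesCount_val, ← onesCount_val, h2]
    unfold onesCount
    rw [← Finset.card_insert_of_notMem (a := c) (by simp [h1])]
    congr 1
    ext c'
    by_cases hc : c' = c <;> simp [Function.update_apply, hc]
  have hq : Flip c x.val y.val → (x.toState.qdeg = y.toState.qdeg ↔ x.sum = y.sum + 1) := by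
    intro h
    unfold EnhancedState.qdeg
    rw [sum_sign_toState, sum_sign_toState, ones_toState, ones_toState, hones h]
    push_cast
    constructor <;> intro h <;> linarith
  have hs : (∀ e, (∀ i, (claspBraid n).circle x.toState.v e ≠
      (claspBraid n).circle x.toState.v ((claspBraid n).corner c i)) →
      x.toState.sign ((claspBraid n).circle x.toState.v e) =
        y.toState.sign ((claspBraid n).circle y.toState.v e)) ↔ x.Agree (x.Thru c) y := by
    have h1 : ∀ e, (∀ i, (claspBraid n).circle x.toState.v e ≠
        (claspBraid n).circle x.toState.v ((claspBraid n).corner c i)) ↔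
        ¬ x.Thru c (x.lab (place e).1 (place e).2) := by
      intro e
      unfold Thru
      push Not
      refine forall_congr' fun i => ?_
      rw [← place_corner]
      exact not_congr (circle_eq_iff x _ _)
    simp only [h1, toState_sign, sgnUnit_inj]
    constructor
    · intro h k hk e hp
      have h2 : ∀ {n} (x : LState n) (k : ℕ) (e : Site), (e = .bot ∨ e = .top) →
          x.lab k e = x.lab 0 e ∧ x.sgn k e = x.sgn 0 e := by
        intro n x
        induction x with
        | nil x => intro k e _; exact ⟨rfl, rfl⟩
        | inl x => rintro k e (rfl | rfl) <;> exact ⟨rfl, rfl⟩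
        | inr x ih =>
          intro k e he
          exact ⟨(ih _ e he).1.trans (by simp [lab]), (ih _ e he).2.trans (by simp [sgn])⟩
      by_cases he : e = .bot ∨ e = .top
      · rw [(h2 x k e he).1] at hp
        rw [(h2 x k e he).2, (h2 y k e he).2]
        have := h (edge n 0 e)
        rw [place_edge ⟨by omega, by simp⟩] at this
        exact this hp
      · have := h (edge n k e)
        rw [place_edge ⟨hk, fun h => absurd h he⟩] at this
        exact this hp
    · intro h e hp
      exact h _ (valid_place e).1 _ hp
  rw [hs, adeg_toState, adeg_toState, ← and_assoc]
  exact and_congr_right fun h => and_congr_right fun _ => and_congr_left fun _ => hq h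

theorem incidence_toState {n : ℕ} (x y : LState n) :
    EnhancedState.incidence x.toState y.toState = x.inc y := by
  classical
  rw [← sum_inc]
  unfold EnhancedState.incidence
  refine Finset.sum_congr rfl fun c _ => ?_
  exact if_congr (incident_toState c x y) rfl rfl

end LState

/-! ### Quasi-isomorphic subcomplexes -/

section Algebra

variable {𝕜 : Type*} [Field 𝕜]

/-- The linear map between spaces of functions with the given integer matrix coefficients. -/
noncomputable def opMap (𝕜 : Type*) [Field 𝕜] {B B' : Type*} [Fintype B] (a : B → B' → ℤ) :
    (B → 𝕜) →ₗ[𝕜] (B' → 𝕜) :=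
  Matrix.mulVecLin (Matrix.of fun T S => ((a S T : ℤ) : 𝕜))

theorem opMap_apply {B B' : Type*} [Fintype B] (a : B → B' → ℤ) (z : B → 𝕜) (T : B') :
    opMap 𝕜 a z T = ∑ S, (a S T : 𝕜) * z S := rfl

theorem opMap_opMap {B B' B'' : Type*} [Fintype B] [Fintype B'] (a : B → B' → ℤ)
    (b : B' → B'' → ℤ) (z : B → 𝕜) :
    opMap 𝕜 b (opMap 𝕜 a z) = opMap 𝕜 (fun S T => ∑ R, a S R * b R T) z := by
  funext T
  simp only [opMap_apply, Finset.mul_sum]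
  rw [Finset.sum_comm]
  refine Finset.sum_congr rfl fun S _ => ?_
  push_cast
  rw [Finset.sum_mul]
  exact Finset.sum_congr rfl fun R _ => by ring

/-- The map `f` into a complex with differential `d` has the following property: every chain whose
boundary lies in the image of `f` is itself in this image, up to a boundary. An injective chain map
with this property is a quasi-isomorphism. -/
def IsExhaustive {M C : Type*} [AddCommGroup M] [Module 𝕜 M] [AddCommGroup C] [Module 𝕜 C]
    (f : M →ₗ[𝕜] C) (d : C →ₗ[𝕜] C) : Prop :=
  ∀ z, d z ∈ LinearMap.range f → ∃ y, z - d y ∈ LinearMap.range f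

theorem IsExhaustive.comp {K M C : Type*} [AddCommGroup K] [Module 𝕜 K] [AddCommGroup M]
    [Module 𝕜 M] [AddCommGroup C] [Module 𝕜 C] {f : K →ₗ[𝕜] M} {g : M →ₗ[𝕜] C}
    {d : M →ₗ[𝕜] M} {D : C →ₗ[𝕜] C} (hf : IsExhaustive f d) (hg : IsExhaustive g D)
    (hinj : Function.Injective g) (hchain : ∀ m, D (g m) = g (d m)) (hD : ∀ z, D (D z) = 0) :
    IsExhaustive (g ∘ₗ f) D := by
  rintro z ⟨k, hk⟩
  obtain ⟨y, m, hm⟩ := hg z ⟨f k, hk⟩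
  have h1 : d m = f k := by
    apply hinj
    rw [← hchain, hm, map_sub, hD, sub_zero, ← hk, LinearMap.comp_apply]
  obtain ⟨y', k', hk'⟩ := hf m ⟨k, h1.symm⟩
  refine ⟨y + g y', k', ?_⟩
  rw [LinearMap.comp_apply, hk', map_sub, hm, map_add, hchain]
  abel

/-- A complex whose differential matches some basis elements with others is exhausted by the
unmatched basis elements. -/
theorem isExhaustive_of_matching {B M : Type*} [Fintype B] [DecidableEq B] (a : B → B → ℤ)
    (τ : B → Option B) (c : B → ℤ) (ha : ∀ S T, a S T = if τ S = some T then c S else 0)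
    (hc : ∀ S T, τ S = some T → (c S : 𝕜) ≠ 0)
    (hinj : ∀ S S' T, τ S = some T → τ S' = some T → S = S')
    (f : (M → 𝕜) →ₗ[𝕜] (B → 𝕜))
    (hf : ∀ z, z ∈ LinearMap.range f ↔ ∀ S, (τ S ≠ none ∨ ∃ S', τ S' = some S) → z S = 0) :
    IsExhaustive f (opMap 𝕜 a) := by
  have key : ∀ (z : B → 𝕜) S T, τ S = some T → opMap 𝕜 a z T = c S * z S := by
    intro z S T h
    rw [opMap_apply, Finset.sum_eq_single S]
    · simp [ha, h]
    · intro S' _ hS'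
      have : τ S' ≠ some T := fun h' => hS' (hinj _ _ _ h' h)
      simp [ha, this]
    · simp
  have key' : ∀ (z : B → 𝕜) T, (¬ ∃ S, τ S = some T) → opMap 𝕜 a z T = 0 := by
    intro z T h
    rw [opMap_apply]
    refine Finset.sum_eq_zero fun S _ => ?_
    have : τ S ≠ some T := fun h' => h ⟨S, h'⟩
    simp [ha, this]
  intro z hz
  rw [hf] at hz
  refine ⟨fun S => match τ S with | some T => z T / c S | none => 0, ?_⟩
  rw [hf]
  intro S hS
  rw [Pi.sub_apply]
  by_cases h : ∃ S', τ S' = some S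
  · obtain ⟨S', h⟩ := h
    rw [key _ _ _ h]
    simp only [h]
    rw [mul_div_cancel₀ _ (hc _ _ h), sub_self]
  · rw [key' _ _ h, sub_zero]
    obtain ⟨T, hT⟩ : ∃ T, τ S = some T := Option.ne_none_iff_exists'.1 (hS.resolve_right h)
    have h1 := hz T (Or.inr ⟨S, hT⟩)
    rw [key _ _ _ hT] at h1
    exact (mul_eq_zero.1 h1).resolve_left (hc _ _ hT)

end Algebra

/-! ### The complex of the capped clasp-braid -/

/-- A Boolean as an integer. -/
def boolInt (b : Bool) : ℤ := if b then 1 else 0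

theorem DState.sum_nil {α : Type*} [AddCommMonoid α] (f : DState 0 → α) :
    ∑ x, f x = ∑ h, f (.nil h) :=
  (DState.nilEquiv.sum_comp f).symm

theorem DState.sum_cons {α : Type*} [AddCommMonoid α] {m : ℕ} (f : DState (m + 1) → α) :
    ∑ x, f x = ∑ x, f (.cons none x) + (∑ x, f (.cons (some true) x) +
      ∑ x, f (.cons (some false) x)) := by
  rw [← (DState.consEquiv m).sum_comp f, Fintype.sum_prod_type, Fintype.sum_option,
    Fintype.sum_bool]
  rfl

theorem LState.sum_nil {α : Type*} [AddCommMonoid α] (f : LState 0 → α) :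
    ∑ x, f x = ∑ h, f (.nil h) :=
  (LState.nilEquiv.sum_comp f).symm

theorem LState.sum_succ {α : Type*} [AddCommMonoid α] {n : ℕ} (f : LState (n + 1) → α) :
    ∑ x, f x = ∑ x, f (.inl x) + ∑ y, f (.inr y) := by
  rw [← (LState.succEquiv n).sum_comp f, Fintype.sum_sum_type]
  rfl

namespace DState

variable (𝕜 : Type*) [Field 𝕜]

/-- The differential of the capped clasp-braid. -/
noncomputable def d (m : ℕ) : (DState m → 𝕜) →ₗ[𝕜] (DState m → 𝕜) := opMap 𝕜 inc

/-- Multiplication by `X = v₋` on the circle through the upper arc. -/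
noncomputable def X (m : ℕ) : (DState m → 𝕜) →ₗ[𝕜] (DState m → 𝕜) :=
  opMap 𝕜 fun x y => boolInt (act false x y)

/-- Multiplication by `X = v₋` on the circle through the lower arc. -/
noncomputable def Y (m : ℕ) : (DState m → 𝕜) →ₗ[𝕜] (DState m → 𝕜) :=
  opMap 𝕜 fun x y => boolInt (bact false x y)

/-- The grading involution. -/
noncomputable def ε (m : ℕ) : (DState m → 𝕜) →ₗ[𝕜] (DState m → 𝕜) :=
  LinearMap.pi fun x => ((-1) ^ x.deg : 𝕜) • LinearMap.proj x

/-- The chains with a prescribed state of the uppermost half twist. -/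
def part {m : ℕ} (o : Option Bool) : (DState (m + 1) → 𝕜) →ₗ[𝕜] (DState m → 𝕜) :=
  LinearMap.funLeft 𝕜 𝕜 (.cons o)

variable {𝕜}

theorem part_apply {m : ℕ} (o : Option Bool) (z : DState (m + 1) → 𝕜) (x : DState m) :
    part 𝕜 o z x = z (.cons o x) := rfl

theorem ext_part {m : ℕ} {z w : DState (m + 1) → 𝕜} (h : ∀ o, part 𝕜 o z = part 𝕜 o w) :
    z = w := by
  funext x
  cases x with
  | cons o x => exact congrFun (h o) x

theorem ε_apply {m : ℕ} (z : DState m → 𝕜) (x : DState m) : ε 𝕜 m z x = (-1) ^ x.deg * z x := rfl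

theorem ε_ε {m : ℕ} (z : DState m → 𝕜) : ε 𝕜 m (ε 𝕜 m z) = z := by
  funext x
  rw [ε_apply, ε_apply, ← mul_assoc, ← mul_pow]
  simp

theorem act_true : ∀ {m} (x y : DState m), act true x y = true ↔ x = y
  | _, .nil x, .nil y => by
    rw [nil.injEq]; simp only [act]; revert x y; decide
  | _, .cons none x, .cons none y => by simp [act, act_true x y]
  | _, .cons (some s) x, .cons (some t) y => by
    simp [act, mulB]
    exact fun _ => eq_comm
  | _, .cons none x, .cons (some t) y => by simp [act]
  | _, .cons (some s) x, .cons none y => by simp [act]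

theorem bact_true : ∀ {m} (x y : DState m), bact true x y = true ↔ x = y
  | _, .nil x, .nil y => by
    rw [nil.injEq]; simp only [bact]; revert x y; decide
  | _, .cons o x, .cons o' y => by simp [bact, bact_true x y]

theorem deg_eq_of_act {m} {s : Bool} {x y : DState m} (h : act s x y = true) : y.deg = x.deg := by
  have := ((act_iff s x y).2 h).1
  rw [← onesCount_val, ← onesCount_val, this]

theorem deg_eq_of_bact {m} {s : Bool} {x y : DState m} (h : bact s x y = true) :
    y.deg = x.deg := by
  have := ((bact_iff s x y).2 h).1
  rw [← onesCount_val, ← onesCount_val, this]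

theorem sum_eq_of_act {m} {s : Bool} {x y : DState m} (h : act s x y = true) :
    y.sum = x.sum + sgnInt s - 1 := by
  have := ((act_iff s x y).2 h).2.2
  linarith

theorem part_some_d {m : ℕ} (s : Bool) (z : DState (m + 1) → 𝕜) :
    part 𝕜 (some s) (d 𝕜 (m + 1) z) = d 𝕜 m (part 𝕜 (some s) z) := by
  funext y
  simp only [part_apply, d, opMap_apply, sum_cons]
  rcases s <;> simp [inc]

theorem part_none_d {m : ℕ} (z : DState (m + 1) → 𝕜) :
    part 𝕜 none (d 𝕜 (m + 1) z) = d 𝕜 m (part 𝕜 none z) +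
      (ε 𝕜 m (part 𝕜 (some true) z) + X 𝕜 m (ε 𝕜 m (part 𝕜 (some false) z))) := by
  funext y
  simp only [part_apply, d, X, opMap_apply, sum_cons, Pi.add_apply, ε_apply, inc, act_true, boolInt]
  congr 2
  · simp
  · refine Finset.sum_congr rfl fun x _ => ?_
    split_ifs <;> simp

theorem part_none_X {m : ℕ} (z : DState (m + 1) → 𝕜) :
    part 𝕜 none (X 𝕜 (m + 1) z) = X 𝕜 m (part 𝕜 none z) := by
  funext y
  simp [part_apply, X, opMap_apply, sum_cons, act, boolInt]

theorem part_true_X {m : ℕ} (z : DState (m + 1) → 𝕜) :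
    part 𝕜 (some true) (X 𝕜 (m + 1) z) = 0 := by
  funext y
  simp [part_apply, X, opMap_apply, sum_cons, act, boolInt, mulB]

theorem part_false_X {m : ℕ} (z : DState (m + 1) → 𝕜) :
    part 𝕜 (some false) (X 𝕜 (m + 1) z) = part 𝕜 (some true) z := by
  funext y
  simp [part_apply, X, opMap_apply, sum_cons, act, boolInt, mulB]

theorem part_Y {m : ℕ} (o : Option Bool) (z : DState (m + 1) → 𝕜) :
    part 𝕜 o (Y 𝕜 (m + 1) z) = Y 𝕜 m (part 𝕜 o z) := by
  funext y
  rcases o with _ | _ | _ <;> simp [part_apply, Y, opMap_apply, sum_cons, bact, boolInt]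

theorem part_none_ε {m : ℕ} (z : DState (m + 1) → 𝕜) :
    part 𝕜 none (ε 𝕜 (m + 1) z) = - ε 𝕜 m (part 𝕜 none z) := by
  funext y
  simp [part_apply, ε_apply, deg, pow_succ]

theorem part_some_ε {m : ℕ} (s : Bool) (z : DState (m + 1) → 𝕜) :
    part 𝕜 (some s) (ε 𝕜 (m + 1) z) = ε 𝕜 m (part 𝕜 (some s) z) := by
  funext y
  simp [part_apply, ε_apply, deg]

theorem X_ε {m : ℕ} (z : DState m → 𝕜) : X 𝕜 m (ε 𝕜 m z) = ε 𝕜 m (X 𝕜 m z) := by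
  funext y
  simp only [X, opMap_apply, ε_apply, Finset.mul_sum]
  refine Finset.sum_congr rfl fun x _ => ?_
  by_cases h : act false x y = true
  · rw [deg_eq_of_act h]; ring
  · simp [h, boolInt]

/-- Two composites of integer matrices on the capped clasp agree if their coefficients do. -/
theorem opMap_comp_nil (a b a' b' : DState 0 → DState 0 → ℤ) (k : ℤ)
    (h : ∀ S T, ∑ R, a (.nil S) (.nil R) * b (.nil R) (.nil T) =
      k * ∑ R, a' (.nil S) (.nil R) * b' (.nil R) (.nil T)) (z : DState 0 → 𝕜) :
    opMap 𝕜 b (opMap 𝕜 a z) = (k : 𝕜) • opMap 𝕜 b' (opMap 𝕜 a' z) := by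
  rw [opMap_opMap, opMap_opMap]
  funext T
  rw [Pi.smul_apply, opMap_apply, opMap_apply, smul_eq_mul, Finset.mul_sum]
  refine Finset.sum_congr rfl fun S _ => ?_
  cases S with
  | nil S =>
    cases T with
    | nil T =>
      rw [sum_nil, sum_nil, h]
      push_cast
      ring

theorem X_X {m : ℕ} (z : DState m → 𝕜) : X 𝕜 m (X 𝕜 m z) = 0 := by
  induction m with
  | zero =>
    have := opMap_comp_nil (𝕜 := 𝕜) (fun x y => boolInt (act false x y))
      (fun x y => boolInt (act false x y)) (fun x y => boolInt (act false x y))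
      (fun x y => boolInt (act false x y)) 0 (by simp only [act]; decide) z
    rwa [Int.cast_zero, zero_smul] at this
  | succ m ih =>
    refine ext_part fun o => ?_
    rcases o with _ | _ | _
    · rw [part_none_X, part_none_X, ih]; rfl
    · rw [part_false_X, part_true_X]; rfl
    · rw [part_true_X]; rfl

theorem Y_Y {m : ℕ} (z : DState m → 𝕜) : Y 𝕜 m (Y 𝕜 m z) = 0 := by
  induction m with
  | zero =>
    have := opMap_comp_nil (𝕜 := 𝕜) (fun x y => boolInt (bact false x y))
      (fun x y => boolInt (bact false x y)) (fun x y => boolInt (bact false x y))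
      (fun x y => boolInt (bact false x y)) 0 (by simp only [bact]; decide) z
    rwa [Int.cast_zero, zero_smul] at this
  | succ m ih => exact ext_part fun o => by rw [part_Y, part_Y, ih]; rfl

theorem X_Y {m : ℕ} (z : DState m → 𝕜) : X 𝕜 m (Y 𝕜 m z) = Y 𝕜 m (X 𝕜 m z) := by
  induction m with
  | zero =>
    have := opMap_comp_nil (𝕜 := 𝕜) (fun x y => boolInt (bact false x y))
      (fun x y => boolInt (act false x y)) (fun x y => boolInt (act false x y))
      (fun x y => boolInt (bact false x y)) 1 (by simp only [act, bact]; decide) z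
    rwa [Int.cast_one, one_smul] at this
  | succ m ih =>
    refine ext_part fun o => ?_
    rcases o with _ | _ | _ <;>
      simp only [part_Y, part_none_X, part_true_X, part_false_X, ih, map_zero]

theorem d_X {m : ℕ} (z : DState m → 𝕜) : d 𝕜 m (X 𝕜 m z) = X 𝕜 m (d 𝕜 m z) := by
  induction m with
  | zero =>
    have := opMap_comp_nil (𝕜 := 𝕜) (fun x y => boolInt (act false x y)) inc inc
      (fun x y => boolInt (act false x y)) 1 (by simp only [act, inc]; decide) z
    rwa [Int.cast_one, one_smul] at this
  | succ m ih =>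
    refine ext_part fun o => ?_
    rcases o with _ | _ | _
    · simp only [part_none_d, part_none_X, part_true_X, part_false_X, ih, map_zero, map_add, X_X,
        X_ε, zero_add, add_zero]
    · simp only [part_some_d, part_false_X]
    · simp only [part_some_d, part_true_X, map_zero]

theorem Y_ε {m : ℕ} (z : DState m → 𝕜) : Y 𝕜 m (ε 𝕜 m z) = ε 𝕜 m (Y 𝕜 m z) := by
  funext y
  simp only [Y, opMap_apply, ε_apply, Finset.mul_sum]
  refine Finset.sum_congr rfl fun x _ => ?_
  by_cases h : bact false x y = true
  · rw [deg_eq_of_bact h]; ring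
  · simp [h, boolInt]

theorem d_Y {m : ℕ} (z : DState m → 𝕜) : d 𝕜 m (Y 𝕜 m z) = Y 𝕜 m (d 𝕜 m z) := by
  induction m with
  | zero =>
    have := opMap_comp_nil (𝕜 := 𝕜) (fun x y => boolInt (bact false x y)) inc inc
      (fun x y => boolInt (bact false x y)) 1 (by simp only [bact, inc]; decide) z
    rwa [Int.cast_one, one_smul] at this
  | succ m ih =>
    refine ext_part fun o => ?_
    rcases o with _ | _ | _
    · simp only [part_none_d, part_Y, ih, map_add, X_ε, Y_ε, X_Y]
    · simp only [part_some_d, part_Y, ih]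
    · simp only [part_some_d, part_Y, ih]

theorem d_ε {m : ℕ} (z : DState m → 𝕜) : d 𝕜 m (ε 𝕜 m z) = - ε 𝕜 m (d 𝕜 m z) := by
  induction m with
  | zero =>
    have hdeg : ∀ x y : HopfState, x.inc y = 0 ∨ y.deg = x.deg + 1 := by decide
    funext y
    simp only [d, opMap_apply, ε_apply, Finset.mul_sum, Pi.neg_apply, ← Finset.sum_neg_distrib]
    refine Finset.sum_congr rfl fun x _ => ?_
    cases x with
    | nil x =>
      cases y with
      | nil y =>
        rcases hdeg x y with h | h
        · simp [inc, h]
        · simp only [deg, h, pow_succ]; ring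
  | succ m ih =>
    refine ext_part fun o => ?_
    rcases o with _ | _ | _
    · have h : ∀ w : DState (m + 1) → 𝕜, part 𝕜 none (-w) = - part 𝕜 none w := fun _ => rfl
      simp only [h, part_none_d, part_none_ε, part_some_ε, ih, map_neg, map_add, X_ε, ε_ε, neg_neg]
    · simp only [part_some_d, part_some_ε, ih, map_neg]
    · simp only [part_some_d, part_some_ε, ih, map_neg]

theorem d_d {m : ℕ} (z : DState m → 𝕜) : d 𝕜 m (d 𝕜 m z) = 0 := by
  induction m with
  | zero =>
    have := opMap_comp_nil (𝕜 := 𝕜) inc inc inc inc 0 (by simp only [inc]; decide) z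
    rwa [Int.cast_zero, zero_smul] at this
  | succ m ih =>
    refine ext_part fun o => ?_
    rcases o with _ | _ | _
    · simp only [part_none_d, part_some_d, map_add, map_zero, ih, X_ε, d_ε, d_X]
      abel
    · simp only [part_some_d, ih, map_zero]
    · simp only [part_some_d, ih, map_zero]

/-! ### Removing half twists from the capped clasp-braid -/

/-- The chain with prescribed parts. -/
def join {m : ℕ} {M : Type*} [AddCommGroup M] [Module 𝕜 M]
    (f : Option Bool → M →ₗ[𝕜] (DState m → 𝕜)) : M →ₗ[𝕜] (DState (m + 1) → 𝕜) where
  toFun z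
    | .cons o x => f o z x
  map_add' z w := by funext x; cases x; simp
  map_smul' a z := by funext x; cases x; simp

theorem part_join {m : ℕ} {M : Type*} [AddCommGroup M] [Module 𝕜 M]
    (f : Option Bool → M →ₗ[𝕜] (DState m → 𝕜)) (o : Option Bool) (z : M) :
    part 𝕜 o (join f z) = f o z := rfl

variable (𝕜) in
/-- The map `x ↦ x ⊗ X - X x ⊗ 1` to the chains with a `0`-smoothed uppermost half twist, which
realizes the invariance under the first Reidemeister move. -/
noncomputable def untwist (m : ℕ) : (DState m → 𝕜) →ₗ[𝕜] (DState (m + 1) → 𝕜) :=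
  join fun
    | none => 0
    | some true => - X 𝕜 m
    | some false => LinearMap.id

theorem part_none_untwist {m : ℕ} (z : DState m → 𝕜) : part 𝕜 none (untwist 𝕜 m z) = 0 := rfl

theorem part_true_untwist {m : ℕ} (z : DState m → 𝕜) :
    part 𝕜 (some true) (untwist 𝕜 m z) = - X 𝕜 m z := rfl

theorem part_false_untwist {m : ℕ} (z : DState m → 𝕜) :
    part 𝕜 (some false) (untwist 𝕜 m z) = z := rfl

theorem untwist_injective {m : ℕ} : Function.Injective (untwist 𝕜 m) := fun z w h => by
  rw [← part_false_untwist z, h, part_false_untwist]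

theorem d_untwist {m : ℕ} (z : DState m → 𝕜) :
    d 𝕜 (m + 1) (untwist 𝕜 m z) = untwist 𝕜 m (d 𝕜 m z) := by
  refine ext_part fun o => ?_
  rcases o with _ | _ | _
  · simp only [part_none_d, part_none_untwist, part_true_untwist, part_false_untwist, map_zero,
      map_neg, X_ε, neg_add_cancel, add_zero]
  · simp only [part_some_d, part_false_untwist]
  · simp only [part_some_d, part_true_untwist, map_neg, d_X]

theorem X_untwist {m : ℕ} (z : DState m → 𝕜) :
    X 𝕜 (m + 1) (untwist 𝕜 m z) = - untwist 𝕜 m (X 𝕜 m z) := by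
  refine ext_part fun o => ?_
  rw [map_neg]
  rcases o with _ | _ | _
  · simp only [part_none_X, part_none_untwist, map_zero, neg_zero]
  · simp only [part_false_X, part_false_untwist, part_true_untwist]
  · simp only [part_true_X, part_true_untwist, X_X, neg_zero]

theorem Y_untwist {m : ℕ} (z : DState m → 𝕜) :
    Y 𝕜 (m + 1) (untwist 𝕜 m z) = untwist 𝕜 m (Y 𝕜 m z) := by
  refine ext_part fun o => ?_
  rcases o with _ | _ | _
  · simp only [part_Y, part_none_untwist, map_zero]
  · simp only [part_Y, part_false_untwist]
  · simp only [part_Y, part_true_untwist, map_neg, X_Y]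

theorem ε_untwist {m : ℕ} (z : DState m → 𝕜) :
    ε 𝕜 (m + 1) (untwist 𝕜 m z) = untwist 𝕜 m (ε 𝕜 m z) := by
  refine ext_part fun o => ?_
  rcases o with _ | _ | _
  · simp only [part_none_ε, part_none_untwist, map_zero, neg_zero]
  · simp only [part_some_ε, part_false_untwist]
  · simp only [part_some_ε, part_true_untwist, map_neg, X_ε]

theorem isExhaustive_untwist (m : ℕ) : IsExhaustive (untwist 𝕜 m) (d 𝕜 (m + 1)) := by
  rintro z ⟨w, hw⟩
  have h := congrArg (part 𝕜 none) hw
  rw [part_none_untwist, part_none_d, X_ε] at h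
  -- the `1`-smoothed part of `z` is the boundary of a chain with positive sign on the new circle
  refine ⟨join (fun o => if o = some true then ε 𝕜 m else 0) (part 𝕜 none z),
    part 𝕜 (some false) z, ext_part fun o => ?_⟩
  rw [map_sub]
  rcases o with _ | _ | _
  · rw [part_none_untwist, part_none_d, part_join, part_join, part_join]
    simp [ε_ε]
  · rw [part_false_untwist, part_some_d, part_join]
    simp
  · rw [part_true_untwist, part_some_d, part_join]
    have h2 := congrArg (ε 𝕜 m) h
    simp only [map_add, map_zero, ε_ε] at h2
    simp only [if_true, d_ε, sub_neg_eq_add]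
    rw [eq_comm, ← sub_eq_zero, sub_neg_eq_add]
    refine Eq.trans ?_ h2.symm
    abel

end DState

/-! ### The complex of the clasp-braid -/

namespace LState

variable (𝕜 : Type*) [Field 𝕜]

/-- The differential of the clasp-braid. -/
noncomputable def d (n : ℕ) : (LState n → 𝕜) →ₗ[𝕜] (LState n → 𝕜) := opMap 𝕜 inc

/-- The saddle from the capped clasp-braid to the clasp-braid. -/
noncomputable def σ (n : ℕ) : (DState n → 𝕜) →ₗ[𝕜] (LState n → 𝕜) :=
  opMap 𝕜 fun x y => boolInt (x.saddle y)

/-- The part of a chain with a `0`-smoothed uppermost half twist. -/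
def fstPart (n : ℕ) : (LState (n + 1) → 𝕜) →ₗ[𝕜] (DState n → 𝕜) := LinearMap.funLeft 𝕜 𝕜 .inl

/-- The part of a chain with a `1`-smoothed uppermost half twist. -/
def sndPart (n : ℕ) : (LState (n + 1) → 𝕜) →ₗ[𝕜] (LState n → 𝕜) := LinearMap.funLeft 𝕜 𝕜 .inr

variable {𝕜}

/-- The chain with prescribed parts. -/
def join {n : ℕ} {M : Type*} [AddCommGroup M] [Module 𝕜 M] (f : M →ₗ[𝕜] (DState n → 𝕜))
    (g : M →ₗ[𝕜] (LState n → 𝕜)) : M →ₗ[𝕜] (LState (n + 1) → 𝕜) where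
  toFun z
    | .inl x => f z x
    | .inr x => g z x
  map_add' z w := by funext x; cases x <;> simp
  map_smul' a z := by funext x; cases x <;> simp

theorem ext_parts {n : ℕ} {z w : LState (n + 1) → 𝕜} (h1 : fstPart 𝕜 n z = fstPart 𝕜 n w)
    (h2 : sndPart 𝕜 n z = sndPart 𝕜 n w) : z = w := by
  funext x
  cases x with
  | inl x => exact congrFun h1 x
  | inr x => exact congrFun h2 x

theorem fstPart_apply {n : ℕ} (z : LState (n + 1) → 𝕜) (x : DState n) :
    fstPart 𝕜 n z x = z (.inl x) := rfl

theorem sndPart_apply {n : ℕ} (z : LState (n + 1) → 𝕜) (x : LState n) :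
    sndPart 𝕜 n z x = z (.inr x) := rfl

theorem fstPart_d {n : ℕ} (z : LState (n + 1) → 𝕜) :
    fstPart 𝕜 n (d 𝕜 (n + 1) z) = DState.d 𝕜 n (fstPart 𝕜 n z) := by
  funext y
  simp [fstPart_apply, d, DState.d, opMap_apply, sum_succ, inc]

theorem sndPart_d {n : ℕ} (z : LState (n + 1) → 𝕜) :
    sndPart 𝕜 n (d 𝕜 (n + 1) z) =
      d 𝕜 n (sndPart 𝕜 n z) + σ 𝕜 n (DState.ε 𝕜 n (fstPart 𝕜 n z)) := by
  funext y
  simp only [sndPart_apply, d, σ, opMap_apply, sum_succ, inc, Pi.add_apply, DState.ε_apply,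
    fstPart_apply, boolInt]
  rw [add_comm]
  congr 1
  refine Finset.sum_congr rfl fun x _ => ?_
  split_ifs <;> simp

theorem fstPart_σ {n : ℕ} (z : DState (n + 1) → 𝕜) :
    fstPart 𝕜 n (σ 𝕜 (n + 1) z) =
      DState.part 𝕜 (some true) z + DState.Y 𝕜 n (DState.part 𝕜 (some false) z) := by
  funext y
  simp [fstPart_apply, σ, DState.Y, opMap_apply, DState.sum_cons, DState.saddle, boolInt,
    DState.bact_true, DState.part_apply]

theorem sndPart_σ {n : ℕ} (z : DState (n + 1) → 𝕜) :
    sndPart 𝕜 n (σ 𝕜 (n + 1) z) = σ 𝕜 n (DState.part 𝕜 none z) := by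
  funext y
  simp [sndPart_apply, σ, opMap_apply, DState.sum_cons, DState.saddle, boolInt, DState.part_apply]

theorem σ_nil_eq (a b : DState 0 → DState 0 → ℤ)
    (h : ∀ S T, ∑ R, a (.nil S) (.nil R) * boolInt (HopfState.saddle R T) =
      ∑ R, b (.nil S) (.nil R) * boolInt (HopfState.saddle R T)) (z : DState 0 → 𝕜) :
    σ 𝕜 0 (opMap 𝕜 a z) = σ 𝕜 0 (opMap 𝕜 b z) := by
  rw [σ, opMap_opMap, opMap_opMap]
  congr 2
  funext S T
  cases S with
  | nil S =>
    cases T with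
    | nil T => rw [DState.sum_nil, DState.sum_nil]; exact h S T

theorem σ_X {n : ℕ} (z : DState n → 𝕜) : σ 𝕜 n (DState.X 𝕜 n z) = σ 𝕜 n (DState.Y 𝕜 n z) := by
  induction n with
  | zero => exact σ_nil_eq _ _ (by simp only [DState.act, DState.bact]; decide) z
  | succ n ih =>
    refine ext_parts ?_ ?_
    · rw [fstPart_σ, fstPart_σ, DState.part_true_X, DState.part_false_X, DState.part_Y,
        DState.part_Y, DState.Y_Y, zero_add, add_zero]
    · rw [sndPart_σ, sndPart_σ, DState.part_none_X, DState.part_Y, ih]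

theorem d_σ {n : ℕ} (z : DState n → 𝕜) : d 𝕜 n (σ 𝕜 n z) = σ 𝕜 n (DState.d 𝕜 n z) := by
  induction n with
  | zero =>
    have h : ∀ S T, ∑ R, boolInt (HopfState.saddle S R) * BaseState.inc R T =
        ∑ R, HopfState.inc S R * boolInt (HopfState.saddle R T) := by decide
    rw [d, σ, DState.d, opMap_opMap, opMap_opMap]
    congr 2
    funext S T
    cases S with
    | nil S =>
      cases T with
      | nil T => rw [DState.sum_nil, sum_nil]; exact h S T
  | succ n ih =>
    refine ext_parts ?_ ?_
    · simp only [fstPart_d, fstPart_σ, DState.part_some_d, map_add, DState.d_Y]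
    · simp only [sndPart_d, fstPart_σ, sndPart_σ, DState.part_none_d, map_add, ih, σ_X,
        DState.Y_ε]

theorem d_d {n : ℕ} (z : LState n → 𝕜) : d 𝕜 n (d 𝕜 n z) = 0 := by
  induction n with
  | zero =>
    have h : ∀ S T, ∑ R, BaseState.inc S R * BaseState.inc R T = 0 := by decide
    rw [d, opMap_opMap]
    funext T
    rw [opMap_apply, Pi.zero_apply]
    refine Finset.sum_eq_zero fun S _ => ?_
    cases S with
    | nil S =>
      cases T with
      | nil T =>
        have : ∑ R : LState 0, inc (.nil S) R * inc R (.nil T) = 0 := by rw [sum_nil]; exact h S T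
        simp [this]
  | succ n ih =>
    refine ext_parts ?_ ?_
    · rw [fstPart_d, fstPart_d, DState.d_d, map_zero]
    · simp only [sndPart_d, fstPart_d, map_add, ih, d_σ, DState.d_ε, map_neg, map_zero]
      abel

end LState

/-! ### A small model of the complex -/

/-- Generators of the homology of the capped clasp, with `1 = v₊` and `X = v₋`: the chains
`X ⊗ 1 - 1 ⊗ X` and `X ⊗ X` of the smoothing `00`, the first factor belonging to the circle through
the upper arc, and the chains `1`, `X` of the smoothing `11`, with a positive sign on the circle
inside the clasp. -/
inductive CapGen
  | diff | prod | pos | neg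
  deriving DecidableEq

instance : Fintype CapGen :=
  ⟨{.diff, .prod, .pos, .neg}, by rintro (_ | _ | _ | _) <;> simp⟩

/-- Generators of the homology of `L 0`. The option encodes the signs of the two essential circles:
`some true` for two positive ones, `some false` for two negative ones, `none` for a positive left
circle and a negative right one. `mid` is the sum of chains of the smoothings `10` and `01`, `high`
belongs to the smoothing `11` with a positive sign on the circle inside the clasp, and `sym` is the
sum of the two such states with opposite signs on the essential circles. -/
inductive BaseGen
  | low | mid (w : Option Bool) | high (w : Option Bool) | sym
  deriving DecidableEq

instance : Fintype BaseGen :=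
  ⟨{.low, .mid none, .mid (some true), .mid (some false), .high none, .high (some true),
    .high (some false), .sym}, by rintro (_ | (_ | _ | _) | (_ | _ | _) | _) <;> simp⟩

theorem CapGen.sum_univ {α : Type*} [AddCommMonoid α] (f : CapGen → α) :
    ∑ u, f u = f .diff + (f .prod + (f .pos + f .neg)) := by
  change Finset.sum {.diff, .prod, .pos, .neg} f = _
  simp

theorem BaseGen.sum_univ {α : Type*} [AddCommMonoid α] (f : BaseGen → α) :
    ∑ u, f u = f .low + (f (.mid none) + (f (.mid (some true)) + (f (.mid (some false)) +
      (f (.high none) + (f (.high (some true)) + (f (.high (some false)) + f .sym)))))) := by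
  change Finset.sum {.low, .mid none, .mid (some true), .mid (some false), .high none,
    .high (some true), .high (some false), .sym} f = _
  simp

theorem HopfState.sum_univ {α : Type*} [AddCommMonoid α] (f : HopfState → α) :
    ∑ x, f x = (∑ t, ∑ b, f (.s00 t b)) + (∑ a, f (.s10 a)) + (∑ a, f (.s01 a)) +
      ∑ a, ∑ c, f (.s11 a c) := by
  have : (Finset.univ : Finset HopfState) = {.s00 true true, .s00 true false, .s00 false true,
    .s00 false false, .s10 true, .s10 false, .s01 true, .s01 false, .s11 true true, .s11 true false,
    .s11 false true, .s11 false false} := by decide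
  rw [this]
  simp [add_assoc]

theorem BaseState.sum_univ {α : Type*} [AddCommMonoid α] (f : BaseState → α) :
    ∑ x, f x = (∑ a, f (.s00 a)) + (∑ x, ∑ y, f (.s10 x y)) + (∑ x, ∑ y, f (.s01 x y)) +
      ∑ x, ∑ y, ∑ c, f (.s11 x y c) := by
  have : (Finset.univ : Finset BaseState) = {.s00 true, .s00 false, .s10 true true, .s10 true false,
    .s10 false true, .s10 false false, .s01 true true, .s01 true false, .s01 false true,
    .s01 false false, .s11 true true true, .s11 true true false, .s11 true false true,
    .s11 true false false, .s11 false true true, .s11 false true false,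
    .s11 false false true, .s11 false false false} := by decide
  rw [this]
  simp [add_assoc]

/-- Coefficients of the generators of the homology of the capped clasp. -/
def CapGen.coef : CapGen → DState 0 → ℤ
  | .diff, .nil (.s00 false true) => 1
  | .diff, .nil (.s00 true false) => -1
  | .prod, .nil (.s00 false false) => 1
  | .pos, .nil (.s11 true true) => 1
  | .neg, .nil (.s11 false true) => 1
  | _, _ => 0

/-- Coefficients of the generators of the homology of `L 0`. -/
def BaseGen.coef : BaseGen → LState 0 → ℤ
  | .low, .nil (.s00 false) => 1
  | .mid (some s), .nil (.s10 x y) => if x = s ∧ y = s then 1 else 0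
  | .mid (some s), .nil (.s01 x y) => if x = s ∧ y = s then 1 else 0
  | .mid none, .nil (.s10 true false) => 1
  | .mid none, .nil (.s01 true false) => 1
  | .high (some s), .nil (.s11 x y true) => if x = s ∧ y = s then 1 else 0
  | .high none, .nil (.s11 true false true) => 1
  | .sym, .nil (.s11 x y true) => if x = y then 0 else 1
  | _, _ => 0

/-- Multiplication by `X` on the circle through the upper arc. -/
def CapGen.X : CapGen → CapGen → ℤ
  | .diff, .prod => -1
  | .pos, .neg => 1
  | _, _ => 0

/-- Multiplication by `X` on the circle through the lower arc. -/
def CapGen.Y : CapGen → CapGen → ℤ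
  | .diff, .prod => 1
  | .pos, .neg => 1
  | _, _ => 0

section

variable (𝕜 : Type*) [Field 𝕜]

/-- The generators of the homology of the capped clasp as cycles of the capped clasp-braid. -/
noncomputable def CapGen.embed : ∀ m, (CapGen → 𝕜) →ₗ[𝕜] (DState m → 𝕜)
  | 0 => opMap 𝕜 CapGen.coef
  | m + 1 => DState.untwist 𝕜 m ∘ₗ CapGen.embed m

end

namespace CapGen

variable {𝕜 : Type*} [Field 𝕜]

theorem embed_succ (m : ℕ) (u : CapGen → 𝕜) :
    embed 𝕜 (m + 1) u = DState.untwist 𝕜 m (embed 𝕜 m u) := rfl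

theorem embed_zero_apply (u : CapGen → 𝕜) (x : HopfState) : embed 𝕜 0 u (.nil x) =
    match x with
    | .s00 false true => u .diff
    | .s00 true false => - u .diff
    | .s00 false false => u .prod
    | .s11 true true => u .pos
    | .s11 false true => u .neg
    | _ => 0 := by
  change opMap 𝕜 coef u (.nil x) = _
  rw [opMap_apply, sum_univ]
  rcases x with (_ | _) | _ | _ | (_ | _) <;> rename_i a <;> (try cases a) <;> simp [coef]

theorem embed_injective (m : ℕ) : Function.Injective (embed 𝕜 m) := by
  induction m with
  | zero =>
    intro u v h
    have h' := fun x => congrFun h (.nil x)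
    simp only [embed_zero_apply] at h'
    funext w
    cases w
    · exact h' (.s00 false true)
    · exact h' (.s00 false false)
    · exact h' (.s11 true true)
    · exact h' (.s11 false true)
  | succ m ih => exact DState.untwist_injective.comp ih

theorem d_embed (m : ℕ) (u : CapGen → 𝕜) : DState.d 𝕜 m (embed 𝕜 m u) = 0 := by
  induction m with
  | zero =>
    funext x
    cases x with
    | nil x =>
      rw [DState.d, opMap_apply, DState.sum_nil, HopfState.sum_univ]
      simp only [embed_zero_apply, Fintype.sum_bool, DState.inc]
      rcases x with (_ | _) | _ | _ | (_ | _) <;> rename_i a <;> (try cases a) <;>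
        simp [HopfState.inc, mulB, splitB]
  | succ m ih => rw [embed_succ, DState.d_untwist, ih, map_zero]

theorem ε_embed (m : ℕ) (u : CapGen → 𝕜) : DState.ε 𝕜 m (embed 𝕜 m u) = embed 𝕜 m u := by
  induction m with
  | zero =>
    funext x
    cases x with
    | nil x =>
      rw [DState.ε_apply, embed_zero_apply]
      rcases x with (_ | _) | _ | _ | (_ | _) <;> rename_i a <;> (try cases a) <;>
        simp [DState.deg, HopfState.deg]
  | succ m ih => rw [embed_succ, DState.ε_untwist, ih]

theorem X_embed (m : ℕ) (u : CapGen → 𝕜) :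
    DState.X 𝕜 m (embed 𝕜 m u) = (-1 : 𝕜) ^ m • embed 𝕜 m (opMap 𝕜 X u) := by
  induction m with
  | zero =>
    funext x
    cases x with
    | nil x =>
      rw [DState.X, opMap_apply, DState.sum_nil, HopfState.sum_univ, pow_zero, one_smul]
      simp only [embed_zero_apply, Fintype.sum_bool, DState.act, opMap_apply, sum_univ]
      rcases x with (_ | _) | _ | _ | (_ | _) <;> rename_i a <;> (try cases a) <;>
        simp [HopfState.act, mulB, boolInt, X]
  | succ m ih => rw [embed_succ, DState.X_untwist, ih, map_smul, embed_succ, pow_succ]; simp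

theorem Y_embed (m : ℕ) (u : CapGen → 𝕜) :
    DState.Y 𝕜 m (embed 𝕜 m u) = embed 𝕜 m (opMap 𝕜 Y u) := by
  induction m with
  | zero =>
    funext x
    cases x with
    | nil x =>
      rw [DState.Y, opMap_apply, DState.sum_nil, HopfState.sum_univ]
      simp only [embed_zero_apply, Fintype.sum_bool, DState.bact, opMap_apply, sum_univ]
      rcases x with (_ | _) | _ | _ | (_ | _) <;> rename_i a <;> (try cases a) <;>
        simp [HopfState.bact, mulB, boolInt, Y]
  | succ m ih => rw [embed_succ, DState.Y_untwist, ih, embed_succ]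

theorem isExhaustive_embed (m : ℕ) : IsExhaustive (embed 𝕜 m) (DState.d 𝕜 m) := by
  induction m with
  | zero =>
    rintro z ⟨k, hk⟩
    have h := fun x => congrFun hk (.nil x)
    simp only [embed_zero_apply, DState.d, opMap_apply, DState.sum_nil, HopfState.sum_univ,
      Fintype.sum_bool, DState.inc] at h
    have h1 := h (.s10 true)
    have h2 := h (.s10 false)
    have h3 := h (.s11 true false)
    have h4 := h (.s11 false false)
    simp [HopfState.inc, mulB, splitB] at h1 h2 h3 h4
    let y : DState 0 → 𝕜
      | .nil (.s00 true b) => z (.nil (.s10 b))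
      | .nil (.s01 a) => z (.nil (.s11 a false))
      | _ => 0
    have hy : ∀ x, DState.d 𝕜 0 y (.nil x) = _ := fun x => by
      rw [DState.d, opMap_apply, DState.sum_nil, HopfState.sum_univ]
    simp only [Fintype.sum_bool, DState.inc, y] at hy
    refine ⟨y, fun
      | .diff => z (.nil (.s00 false true))
      | .prod => z (.nil (.s00 false false))
      | .pos => z (.nil (.s11 true true))
      | .neg => z (.nil (.s11 false true)) - z (.nil (.s11 true false)), ?_⟩
    funext x
    cases x with
    | nil x =>
      rw [embed_zero_apply, Pi.sub_apply, hy]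
      rcases x with (_ | _) | _ | _ | (_ | _) <;> rename_i a <;> (try cases a) <;>
        simp [HopfState.inc, mulB, splitB] <;> grind
  | succ m ih =>
    exact ih.comp (DState.isExhaustive_untwist m) DState.untwist_injective DState.d_untwist DState.d_d

end CapGen

/-- Generators of the small model of the complex of `L n`: one copy of `CapGen` for each possible
position of the uppermost `0`-smoothed half twist, and one copy of `BaseGen`. -/
inductive SState : ℕ → Type
  | nil (b : BaseGen) : SState 0
  | inl {n : ℕ} (u : CapGen) : SState (n + 1)
  | inr {n : ℕ} (y : SState n) : SState (n + 1)
  deriving DecidableEq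

/-- The generators for `n = 0`. -/
def SState.nilEquiv : BaseGen ≃ SState 0 where
  toFun := .nil
  invFun | .nil z => z
  left_inv _ := rfl
  right_inv | .nil _ => rfl

/-- Smoothing the uppermost half twist. -/
def SState.succEquiv (n : ℕ) : CapGen ⊕ SState n ≃ SState (n + 1) where
  toFun := Sum.elim .inl .inr
  invFun
    | .inl x => Sum.inl x
    | .inr y => Sum.inr y
  left_inv := by rintro (_ | _) <;> rfl
  right_inv := by rintro (_ | _) <;> rfl

instance SState.instFintype : ∀ n, Fintype (SState n)
  | 0 => .ofEquiv _ SState.nilEquiv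
  | n + 1 => haveI := SState.instFintype n; .ofEquiv _ (SState.succEquiv n)

namespace SState

theorem sum_nil {α : Type*} [AddCommMonoid α] (f : SState 0 → α) :
    ∑ x, f x = ∑ h, f (.nil h) :=
  (SState.nilEquiv.sum_comp f).symm

theorem sum_succ {α : Type*} [AddCommMonoid α] {n : ℕ} (f : SState (n + 1) → α) :
    ∑ x, f x = ∑ x, f (.inl x) + ∑ y, f (.inr y) := by
  rw [← (SState.succEquiv n).sum_comp f, Fintype.sum_sum_type]
  rfl

/-- The generator that occurs in the saddle map applied to a generator of the capped clasp-braid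
with `n` half twists. -/
def next : ∀ n, CapGen → Option (SState n)
  | 0, .pos => some (.nil .sym)
  | n + 1, .diff => if Even n then some (.inl .prod) else none
  | n + 1, .pos => if Even n then none else some (.inl .neg)
  | _, _ => none

/-- The generator that occurs in the differential of a generator. -/
def match? : ∀ {n}, SState n → Option (SState n)
  | _, .nil _ => none
  | _, .inl (n := n) u => (next n u).map .inr
  | _, .inr y => (match? y).map .inr

/-- The coefficient of the generator that occurs in the differential of a generator. -/
def coef : ∀ {n}, SState n → ℤ
  | _, .nil _ => 1
  | _, .inl (n := n) _ => if n = 0 then 1 else 2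
  | _, .inr y => coef y

/-- Matrix coefficients of the differential of the small model. -/
def inc {n : ℕ} (x y : SState n) : ℤ := if match? x = some y then coef x else 0

variable (𝕜 : Type*) [Field 𝕜]

/-- The differential of the small model. -/
noncomputable def d (n : ℕ) : (SState n → 𝕜) →ₗ[𝕜] (SState n → 𝕜) := opMap 𝕜 inc

/-- The saddle map on the generators. -/
noncomputable def δ (n : ℕ) : (CapGen → 𝕜) →ₗ[𝕜] (SState n → 𝕜) :=
  opMap 𝕜 fun u y => if next n u = some y then (if n = 0 then 1 else 2) else 0

/-- The first component of a chain of the small model. -/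
def fstPart (n : ℕ) : (SState (n + 1) → 𝕜) →ₗ[𝕜] (CapGen → 𝕜) := LinearMap.funLeft 𝕜 𝕜 .inl

/-- The second component of a chain of the small model. -/
def sndPart (n : ℕ) : (SState (n + 1) → 𝕜) →ₗ[𝕜] (SState n → 𝕜) := LinearMap.funLeft 𝕜 𝕜 .inr

/-- The embedding of the small model. -/
noncomputable def embed : ∀ n, (SState n → 𝕜) →ₗ[𝕜] (LState n → 𝕜)
  | 0 => opMap 𝕜 BaseGen.coef ∘ₗ LinearMap.funLeft 𝕜 𝕜 .nil
  | n + 1 => LState.join (CapGen.embed 𝕜 n ∘ₗ fstPart 𝕜 n) (embed n ∘ₗ sndPart 𝕜 n)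

variable {𝕜}

theorem ext_parts {n : ℕ} {z w : SState (n + 1) → 𝕜} (h1 : fstPart 𝕜 n z = fstPart 𝕜 n w)
    (h2 : sndPart 𝕜 n z = sndPart 𝕜 n w) : z = w := by
  funext x
  cases x with
  | inl x => exact congrFun h1 x
  | inr x => exact congrFun h2 x

theorem fstPart_embed {n : ℕ} (z : SState (n + 1) → 𝕜) :
    LState.fstPart 𝕜 n (embed 𝕜 (n + 1) z) = CapGen.embed 𝕜 n (fstPart 𝕜 n z) := rfl

theorem sndPart_embed {n : ℕ} (z : SState (n + 1) → 𝕜) :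
    LState.sndPart 𝕜 n (embed 𝕜 (n + 1) z) = embed 𝕜 n (sndPart 𝕜 n z) := rfl

theorem embed_zero_apply (z : SState 0 → 𝕜) (x : BaseState) : embed 𝕜 0 z (.nil x) =
    match x with
    | .s00 false => z (.nil .low)
    | .s10 true true => z (.nil (.mid (some true)))
    | .s10 false false => z (.nil (.mid (some false)))
    | .s10 true false => z (.nil (.mid none))
    | .s01 true true => z (.nil (.mid (some true)))
    | .s01 false false => z (.nil (.mid (some false)))
    | .s01 true false => z (.nil (.mid none))
    | .s11 true true true => z (.nil (.high (some true)))
    | .s11 false false true => z (.nil (.high (some false)))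
    | .s11 true false true => z (.nil (.high none)) + z (.nil .sym)
    | .s11 false true true => z (.nil .sym)
    | _ => 0 := by
  change opMap 𝕜 BaseGen.coef (LinearMap.funLeft 𝕜 𝕜 .nil z) (.nil x) = _
  rw [opMap_apply, BaseGen.sum_univ]
  rcases x with (_ | _) | ⟨_ | _, _ | _⟩ | ⟨_ | _, _ | _⟩ | ⟨_ | _, _ | _, _ | _⟩ <;>
    simp [BaseGen.coef, LinearMap.funLeft_apply]

theorem embed_injective (n : ℕ) : Function.Injective (embed 𝕜 n) := by
  induction n with
  | zero =>
    intro z w h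
    have h' := fun x => congrFun h (.nil x)
    simp only [embed_zero_apply] at h'
    funext x
    have h1 := h' (.s11 false true true)
    have h2 := h' (.s11 true false true)
    simp only [h1, add_left_inj] at h1 h2
    rcases x with ⟨_ | (_ | _ | _) | (_ | _ | _) | _⟩
    · exact h' (.s00 false)
    · exact h' (.s10 true false)
    · exact h' (.s10 false false)
    · exact h' (.s10 true true)
    · exact h2
    · exact h' (.s11 false false true)
    · exact h' (.s11 true true true)
    · exact h' (.s11 false true true)
  | succ n ih =>
    intro z w h
    refine ext_parts (CapGen.embed_injective n ?_) (ih ?_)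
    · rw [← fstPart_embed, h, fstPart_embed]
    · rw [← sndPart_embed, h, sndPart_embed]

theorem fstPart_d {n : ℕ} (z : SState (n + 1) → 𝕜) : fstPart 𝕜 n (d 𝕜 (n + 1) z) = 0 := by
  funext y
  simp [fstPart, d, LinearMap.funLeft_apply, opMap_apply, sum_succ, inc, match?]

theorem sndPart_d {n : ℕ} (z : SState (n + 1) → 𝕜) :
    sndPart 𝕜 n (d 𝕜 (n + 1) z) = d 𝕜 n (sndPart 𝕜 n z) + δ 𝕜 n (fstPart 𝕜 n z) := by
  funext y
  simp [sndPart, fstPart, d, δ, LinearMap.funLeft_apply, opMap_apply, sum_succ, inc, match?, coef,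
    add_comm]

theorem fstPart_δ {n : ℕ} (u : CapGen → 𝕜) : fstPart 𝕜 n (δ 𝕜 (n + 1) u) =
    opMap 𝕜 CapGen.Y u - (-1 : 𝕜) ^ n • opMap 𝕜 CapGen.X u := by
  funext y
  simp only [fstPart, δ, LinearMap.funLeft_apply, opMap_apply, CapGen.sum_univ, Pi.sub_apply,
    Pi.smul_apply]
  rcases Nat.even_or_odd n with hn | hn
  · cases y <;> simp [next, hn, CapGen.X, CapGen.Y]
    ring
  · have hn' := Nat.not_even_iff_odd.2 hn
    cases y <;> simp [next, hn', hn.neg_one_pow, CapGen.X, CapGen.Y]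
    ring

theorem sndPart_δ {n : ℕ} (u : CapGen → 𝕜) : sndPart 𝕜 n (δ 𝕜 (n + 1) u) = 0 := by
  funext y
  simp only [sndPart, δ, LinearMap.funLeft_apply, opMap_apply, CapGen.sum_univ, Pi.zero_apply]
  simp [next]

theorem σ_embed (n : ℕ) (u : CapGen → 𝕜) :
    LState.σ 𝕜 n (CapGen.embed 𝕜 n u) = embed 𝕜 n (δ 𝕜 n u) := by
  cases n with
  | zero =>
    funext x
    cases x with
    | nil x =>
      rw [LState.σ, opMap_apply, DState.sum_nil, HopfState.sum_univ]
      simp only [embed_zero_apply, CapGen.embed_zero_apply, Fintype.sum_bool, DState.saddle, δ,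
        opMap_apply, CapGen.sum_univ, next]
      rcases x with (_ | _) | ⟨_ | _, _ | _⟩ | ⟨_ | _, _ | _⟩ | ⟨_ | _, _ | _, _ | _⟩ <;>
        simp [HopfState.saddle, mulB, boolInt]
  | succ n =>
    refine LState.ext_parts ?_ ?_
    · rw [LState.fstPart_σ, CapGen.embed_succ, DState.part_true_untwist, DState.part_false_untwist,
        fstPart_embed, fstPart_δ, CapGen.X_embed, CapGen.Y_embed, map_sub, map_smul]
      abel
    · rw [LState.sndPart_σ, CapGen.embed_succ, DState.part_none_untwist, map_zero,
        sndPart_embed, sndPart_δ, map_zero]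

theorem d_embed {n : ℕ} (z : SState n → 𝕜) :
    LState.d 𝕜 n (embed 𝕜 n z) = embed 𝕜 n (d 𝕜 n z) := by
  induction n with
  | zero =>
    have h : d 𝕜 0 z = 0 := by
      funext x
      cases x
      simp [d, opMap_apply, sum_nil, inc, match?]
    rw [h, map_zero]
    funext x
    cases x with
    | nil x =>
      rw [LState.d, opMap_apply, LState.sum_nil, BaseState.sum_univ]
      simp only [embed_zero_apply, Fintype.sum_bool, LState.inc]
      rcases x with (_ | _) | ⟨_ | _, _ | _⟩ | ⟨_ | _, _ | _⟩ | ⟨_ | _, _ | _, _ | _⟩ <;>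
        simp [BaseState.inc]
  | succ n ih =>
    refine LState.ext_parts ?_ ?_
    · rw [LState.fstPart_d, fstPart_embed, fstPart_embed, CapGen.d_embed, fstPart_d, map_zero]
    · rw [LState.sndPart_d, fstPart_embed, sndPart_embed, sndPart_embed, sndPart_d, ih,
        CapGen.ε_embed, σ_embed, map_add]

theorem isExhaustive_embed (n : ℕ) : IsExhaustive (embed 𝕜 n) (LState.d 𝕜 n) := by
  induction n with
  | zero =>
    rintro z ⟨k, hk⟩
    have h := fun x => congrFun hk (.nil x)
    simp only [embed_zero_apply, LState.d, opMap_apply, LState.sum_nil, BaseState.sum_univ,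
      Fintype.sum_bool, LState.inc] at h
    have h1 := h (.s10 false true)
    have h2 := h (.s11 true true false)
    have h3 := h (.s11 true false false)
    have h4 := h (.s11 false true false)
    have h5 := h (.s11 false false false)
    simp [BaseState.inc] at h1 h2 h3 h4 h5
    let y : LState 0 → 𝕜
      | .nil (.s00 true) => z (.nil (.s10 false true))
      | .nil (.s01 a b) => z (.nil (.s11 a b false))
      | _ => 0
    have hy : ∀ x, LState.d 𝕜 0 y (.nil x) = _ := fun x => by
      rw [LState.d, opMap_apply, LState.sum_nil, BaseState.sum_univ]
    simp only [Fintype.sum_bool, LState.inc, y] at hy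
    refine ⟨y, fun
      | .nil .low => z (.nil (.s00 false))
      | .nil (.mid none) => z (.nil (.s10 true false)) - z (.nil (.s10 false true))
      | .nil (.mid (some s)) => z (.nil (.s10 s s))
      | .nil (.high none) => z (.nil (.s11 true false true)) - z (.nil (.s11 false true true))
      | .nil (.high (some s)) => z (.nil (.s11 s s true))
      | .nil .sym => z (.nil (.s11 false true true)), ?_⟩
    funext x
    cases x with
    | nil x =>
      rw [embed_zero_apply, Pi.sub_apply, hy]
      rcases x with (_ | _) | ⟨_ | _, _ | _⟩ | ⟨_ | _, _ | _⟩ | ⟨_ | _, _ | _, _ | _⟩ <;>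
        simp [BaseState.inc] <;> grind
  | succ n ih =>
    rintro z ⟨k, hk⟩
    have h1 := congrArg (LState.fstPart 𝕜 n) hk
    have h2 := congrArg (LState.sndPart 𝕜 n) hk
    rw [fstPart_embed, LState.fstPart_d] at h1
    rw [sndPart_embed, LState.sndPart_d] at h2
    obtain ⟨y₁, u, hu⟩ := CapGen.isExhaustive_embed n _ ⟨_, h1⟩
    -- the second component, corrected by the contribution of `y₁`, has its boundary in the image
    obtain ⟨y₂, w, hw⟩ := ih (LState.sndPart 𝕜 n z - LState.σ 𝕜 n (DState.ε 𝕜 n y₁))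
      ⟨sndPart 𝕜 n k - δ 𝕜 n u, by
        have h3 : LState.σ 𝕜 n (DState.ε 𝕜 n (LState.fstPart 𝕜 n z)) = embed 𝕜 n (δ 𝕜 n u) +
            LState.σ 𝕜 n (DState.ε 𝕜 n (DState.d 𝕜 n y₁)) := by
          rw [← σ_embed, ← map_add]
          congr 1
          rw [← CapGen.ε_embed, ← map_add, hu, sub_add_cancel]
        rw [map_sub, h2, h3, map_sub, LState.d_σ, DState.d_ε, map_neg]
        abel⟩
    refine ⟨LState.join (LinearMap.fst 𝕜 _ _) (LinearMap.snd 𝕜 _ _) (y₁, y₂), fun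
        | .inl a => u a
        | .inr b => w b, LState.ext_parts ?_ ?_⟩
    · rw [fstPart_embed, map_sub, LState.fstPart_d]
      exact hu
    · rw [sndPart_embed, map_sub, LState.sndPart_d]
      refine hw.trans ?_
      change _ = LState.sndPart 𝕜 n z - (LState.d 𝕜 n y₂ + LState.σ 𝕜 n (DState.ε 𝕜 n y₁))
      abel

end SState

/-! ### The generators of the homology -/

section Extension

variable (𝕜 : Type*) [Field 𝕜] {B : Type*} (p : B → Prop)

/-- Extension by zero of a function defined on a subtype. -/
noncomputable def extendZero : ({x // p x} → 𝕜) →ₗ[𝕜] (B → 𝕜) :=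
  open scoped Classical in
  { toFun z x := if h : p x then z ⟨x, h⟩ else 0
    map_add' z w := by funext x; by_cases h : p x <;> simp [h]
    map_smul' a z := by funext x; by_cases h : p x <;> simp [h] }

/-- Restriction of a function to a subtype. -/
def restrict : (B → 𝕜) →ₗ[𝕜] ({x // p x} → 𝕜) := LinearMap.funLeft 𝕜 𝕜 Subtype.val

variable {𝕜 p}

theorem extendZero_of_mem (z : {x // p x} → 𝕜) {x : B} (h : p x) :
    extendZero 𝕜 p z x = z ⟨x, h⟩ := by
  simp [extendZero, h]

theorem extendZero_of_not_mem (z : {x // p x} → 𝕜) {x : B} (h : ¬ p x) :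
    extendZero 𝕜 p z x = 0 := by
  simp [extendZero, h]

theorem restrict_apply (z : B → 𝕜) (x : {x // p x}) : restrict 𝕜 p z x = z x.1 := rfl

theorem restrict_extendZero (z : {x // p x} → 𝕜) : restrict 𝕜 p (extendZero 𝕜 p z) = z := by
  funext x
  rw [restrict_apply, extendZero_of_mem z x.2]

theorem extendZero_injective : Function.Injective (extendZero 𝕜 p) :=
  Function.LeftInverse.injective restrict_extendZero

theorem extendZero_restrict {z : B → 𝕜} (h : ∀ x, z x ≠ 0 → p x) :
    extendZero 𝕜 p (restrict 𝕜 p z) = z := by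
  funext x
  by_cases hx : p x
  · rw [extendZero_of_mem _ hx, restrict_apply]
  · rw [extendZero_of_not_mem _ hx]
    by_contra h'
    exact hx (h x (Ne.symm h'))

theorem mem_range_extendZero {z : B → 𝕜} :
    z ∈ LinearMap.range (extendZero 𝕜 p) ↔ ∀ x, ¬ p x → z x = 0 := by
  constructor
  · rintro ⟨w, rfl⟩ x hx
    exact extendZero_of_not_mem w hx
  · intro h
    exact ⟨restrict 𝕜 p z, extendZero_restrict fun x hx => by
      by_contra h'
      exact hx (h x h')⟩

theorem mem_of_extendZero_ne_zero {z : {x // p x} → 𝕜} {x : B} (h : extendZero 𝕜 p z x ≠ 0) :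
    ∃ hx : p x, z ⟨x, hx⟩ ≠ 0 := by
  by_cases hx : p x
  · rw [extendZero_of_mem z hx] at h
    exact ⟨hx, h⟩
  · exact absurd (extendZero_of_not_mem z hx) h

end Extension

namespace SState

/-- A generator is critical if neither it nor its image occurs in the differential. -/
def IsCritical {n : ℕ} (S : SState n) : Prop := match? S = none ∧ ∀ S', match? S' ≠ some S

theorem next_injective {n : ℕ} {u u' : CapGen} {t : SState n} (h : next n u = some t)
    (h' : next n u' = some t) : u = u' := by
  rcases n with _ | n <;> cases u <;> cases u' <;> simp [next] at h h' ⊢ <;> grind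

theorem match?_ne_next : ∀ {n : ℕ} {u : CapGen} {s t : SState n}, next n u = some t →
    match? s ≠ some t
  | 0, _, .nil _, _, _ => by simp [match?]
  | n + 1, u, s, t, h => by
    have : ∃ v, t = .inl v := by
      cases u <;> simp [next] at h
      · exact ⟨_, h.2.symm⟩
      · exact ⟨_, h.2.symm⟩
    obtain ⟨v, rfl⟩ := this
    cases s <;> simp [match?]

theorem match?_injective : ∀ {n : ℕ} (S S' T : SState n), match? S = some T →
    match? S' = some T → S = S'
  | _, .nil _, _, _, h, _ => by simp [match?] at h
  | _, .inl u, .inl u', T, h, h' => by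
    simp only [match?, Option.map_eq_some_iff] at h h'
    obtain ⟨t, h1, rfl⟩ := h
    obtain ⟨t', h2, h3⟩ := h'
    rw [inr.injEq] at h3
    subst h3
    rw [next_injective h1 h2]
  | _, .inl u, .inr s, T, h, h' => by
    simp only [match?, Option.map_eq_some_iff] at h h'
    obtain ⟨t, h1, rfl⟩ := h
    obtain ⟨t', h2, h3⟩ := h'
    rw [inr.injEq] at h3
    subst h3
    exact absurd h2 (match?_ne_next h1)
  | _, .inr s, .inl u, T, h, h' => by
    simp only [match?, Option.map_eq_some_iff] at h h'
    obtain ⟨t, h1, rfl⟩ := h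
    obtain ⟨t', h2, h3⟩ := h'
    rw [inr.injEq] at h3
    subst h3
    exact absurd h1 (match?_ne_next h2)
  | _, .inr s, .inr s', T, h, h' => by
    simp only [match?, Option.map_eq_some_iff] at h h'
    obtain ⟨t, h1, rfl⟩ := h
    obtain ⟨t', h2, h3⟩ := h'
    rw [inr.injEq] at h3
    subst h3
    rw [match?_injective s s' _ h1 h2]

theorem coef_eq : ∀ {n : ℕ} (S : SState n), coef S = 1 ∨ coef S = 2
  | _, .nil _ => .inl rfl
  | _, .inl (n := n) _ => by rw [coef]; split_ifs <;> simp
  | _, .inr y => coef_eq y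

variable {𝕜 : Type*} [Field 𝕜]

theorem coef_ne_zero (h2 : (2 : 𝕜) ≠ 0) {n : ℕ} (S : SState n) : (coef S : 𝕜) ≠ 0 := by
  rcases coef_eq S with h | h <;> simp [h, h2]

theorem isExhaustive_extendZero (h2 : (2 : 𝕜) ≠ 0) (n : ℕ) :
    IsExhaustive (extendZero 𝕜 (IsCritical (n := n))) (d 𝕜 n) := by
  refine isExhaustive_of_matching inc match? coef (fun _ _ => rfl) (fun S _ _ => coef_ne_zero h2 S)
    match?_injective _ fun z => ?_
  rw [mem_range_extendZero]
  refine forall_congr' fun S => ?_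
  rw [IsCritical, not_and_or]
  push Not
  rfl

theorem d_extendZero {n : ℕ} (z : {S : SState n // IsCritical S} → 𝕜) :
    d 𝕜 n (extendZero 𝕜 IsCritical z) = 0 := by
  funext T
  rw [d, opMap_apply]
  refine Finset.sum_eq_zero fun S _ => ?_
  by_cases hS : IsCritical S
  · simp [inc, hS.1]
  · rw [extendZero_of_not_mem z hS, mul_zero]

end SState

/-! ### Gradings of the generators -/

/-- The number of `1`-smoothings. -/
def CapGen.deg : CapGen → ℕ
  | .diff => 0
  | .prod => 0
  | .pos => 2
  | .neg => 2

/-- The sum of the signs of the circles, in the absence of half twists. -/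
def CapGen.sum : CapGen → ℤ
  | .diff => 0
  | .prod => -2
  | .pos => 2
  | .neg => 0

/-- The sum of the signs of the essential circles. -/
def BaseGen.ann : BaseGen → ℤ
  | .mid (some s) => 2 * sgnInt s
  | .high (some s) => 2 * sgnInt s
  | _ => 0

/-- The number of `1`-smoothings. -/
def BaseGen.deg : BaseGen → ℕ
  | .low => 0
  | .mid _ => 1
  | .high _ => 2
  | .sym => 2

/-- The sum of the signs of the circles. -/
def BaseGen.sum : BaseGen → ℤ
  | .low => -1
  | .mid w => (mid w).ann
  | .high w => (high w).ann + 1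
  | .sym => 1

namespace SState

/-- The number of `1`-smoothings. -/
def deg : ∀ {n}, SState n → ℕ
  | _, .nil b => b.deg
  | _, .inl u => u.deg
  | _, .inr y => deg y + 1

/-- The sum of the signs of the circles. -/
def sum : ∀ {n}, SState n → ℤ
  | _, .nil b => b.sum
  | _, .inl (n := n) u => u.sum - n
  | _, .inr y => sum y

/-- The sum of the signs of the essential circles. -/
def ann : ∀ {n}, SState n → ℤ
  | _, .nil b => b.ann
  | _, .inl _ => 0
  | _, .inr y => ann y

end SState

section

variable {𝕜 : Type*} [Field 𝕜]

theorem CapGen.exists_of_embed_ne_zero : ∀ (m : ℕ) (u : CapGen → 𝕜) (x : DState m),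
    embed 𝕜 m u x ≠ 0 → ∃ g, u g ≠ 0 ∧ x.deg = g.deg ∧ x.sum = g.sum - m
  | 0, u, .nil x, h => by
    rw [embed_zero_apply] at h
    rcases x with ⟨_ | _, _ | _⟩ | _ | _ | ⟨_ | _, _ | _⟩ <;> simp at h
    · exact ⟨_, h, rfl, by simp [DState.sum, HopfState.sum, sgnInt, sum]⟩
    · exact ⟨_, h, rfl, by simp [DState.sum, HopfState.sum, sgnInt, sum]⟩
    · exact ⟨_, h, rfl, by simp [DState.sum, HopfState.sum, sgnInt, sum]⟩
    · exact ⟨_, h, rfl, by simp [DState.sum, HopfState.sum, sgnInt, sum]⟩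
    · exact ⟨_, h, rfl, by simp [DState.sum, HopfState.sum, sgnInt, sum]⟩
  | m + 1, u, .cons none x, h => absurd rfl h
  | m + 1, u, .cons (some false) x, h => by
    obtain ⟨g, h1, h2, h3⟩ := exists_of_embed_ne_zero m u x h
    refine ⟨g, h1, h2, ?_⟩
    rw [DState.sum, h3, sgnInt]
    rw [if_neg Bool.false_ne_true]
    push_cast
    ring
  | m + 1, u, .cons (some true) x, h => by
    have h' : DState.X 𝕜 m (embed 𝕜 m u) x ≠ 0 := fun h' => h (by
      have := congrFun (DState.part_true_untwist (embed 𝕜 m u)) x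
      rw [Pi.neg_apply, h', neg_zero] at this
      exact this)
    rw [DState.X, opMap_apply] at h'
    obtain ⟨y, -, hy⟩ := Finset.exists_ne_zero_of_sum_ne_zero h'
    obtain ⟨hy1, hy2⟩ := ne_zero_and_ne_zero_of_mul hy
    have hact : DState.act false y x = true := by
      by_contra hact
      simp [boolInt, hact] at hy1
    obtain ⟨g, h1, h2, h3⟩ := exists_of_embed_ne_zero m u y hy2
    refine ⟨g, h1, (DState.deg_eq_of_act hact).trans h2, ?_⟩
    rw [DState.sum, DState.sum_eq_of_act hact, h3, sgnInt, sgnInt]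
    rw [if_pos rfl, if_neg Bool.false_ne_true]
    push_cast
    ring

theorem SState.exists_of_embed_ne_zero : ∀ (n : ℕ) (z : SState n → 𝕜) (x : LState n),
    embed 𝕜 n z x ≠ 0 → ∃ S, z S ≠ 0 ∧ x.deg = S.deg ∧ x.sum = S.sum ∧ x.ann = S.ann
  | 0, z, .nil x, h => by
    rw [embed_zero_apply] at h
    rcases x with (_ | _) | ⟨_ | _, _ | _⟩ | ⟨_ | _, _ | _⟩ | ⟨_ | _, _ | _, _ | _⟩ <;>
      simp at h
    case s11.true.false.true =>
      by_cases h' : z (.nil .sym) = 0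
      · rw [h', add_zero] at h
        exact ⟨_, h, by decide⟩
      · exact ⟨_, h', by decide⟩
    all_goals exact ⟨_, h, by decide⟩
  | n + 1, z, .inl x, h => by
    obtain ⟨g, h1, h2, h3⟩ := CapGen.exists_of_embed_ne_zero n (fstPart 𝕜 n z) x h
    exact ⟨.inl g, h1, h2, h3, rfl⟩
  | n + 1, z, .inr x, h => by
    obtain ⟨S, h1, h2, h3, h4⟩ := exists_of_embed_ne_zero n (sndPart 𝕜 n z) x h
    exact ⟨.inr S, h1, by rw [LState.deg, h2, deg], h3, h4⟩

end

/-! ### Annular Khovanov homology from an exhaustive family of cycles -/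

namespace AnnularDiagram

variable {N : ℕ} {E : Type} [Fintype E] {D : AnnularDiagram N E}

theorem EnhancedState.gradings_of_incidence_ne_zero {S T : D.EnhancedState}
    (h : incidence S T ≠ 0) : T.hdeg = S.hdeg + 1 ∧ T.qdeg = S.qdeg ∧ T.adeg = S.adeg := by
  classical
  obtain ⟨c, -, hc⟩ := Finset.exists_ne_zero_of_sum_ne_zero h
  have hI : Incident c S T := by
    by_contra hI
    simp [hI] at hc
  obtain ⟨h1, h2, -, h4, h5⟩ := hI
  refine ⟨?_, h4.symm, h5.symm⟩
  have : T.ones = S.ones + 1 := by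
    have h3 : (Finset.univ.filter fun c' => T.v c' = true) =
        insert c (Finset.univ.filter fun c' => S.v c' = true) := by
      ext c'
      by_cases hc' : c' = c
      · subst hc'; simp [h2]
      · simp [h2, hc']
    rw [ones, h3, Finset.card_insert_of_notMem (by simp [h1])]
    rfl
  rw [hdeg, hdeg, this]
  push_cast
  ring

variable (D) in
/-- Trigrading `(i, j, k)`. -/
def HasGrade (i j k : ℤ) (S : D.EnhancedState) : Prop := S.hdeg = i ∧ S.qdeg = j ∧ S.adeg = k

variable (𝕜 : Type*) [Field 𝕜]

variable (D) in
/-- The total differential of the annular Khovanov complex. -/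
noncomputable def totalD : (D.EnhancedState → 𝕜) →ₗ[𝕜] (D.EnhancedState → 𝕜) :=
  opMap 𝕜 EnhancedState.incidence

variable {𝕜}

variable (𝕜 D) in
/-- Extension by zero of a chain of trigrading `(i, j, k)`. -/
noncomputable def extendChain (i j k : ℤ) : (D.StateOf i j k → 𝕜) →ₗ[𝕜] (D.EnhancedState → 𝕜) :=
  extendZero 𝕜 (D.HasGrade i j k)

variable (𝕜 D) in
/-- The component of trigrading `(i, j, k)` of a chain. -/
def component (i j k : ℤ) : (D.EnhancedState → 𝕜) →ₗ[𝕜] (D.StateOf i j k → 𝕜) :=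
  restrict 𝕜 (D.HasGrade i j k)

theorem component_extendChain {i j k : ℤ} (v : D.StateOf i j k → 𝕜) :
    component D 𝕜 i j k (extendChain D 𝕜 i j k v) = v := restrict_extendZero v

theorem extendChain_injective {i j k : ℤ} : Function.Injective (extendChain D 𝕜 i j k) :=
  extendZero_injective

theorem extendChain_component {i j k : ℤ} {w : D.EnhancedState → 𝕜}
    (h : ∀ T, w T ≠ 0 → D.HasGrade i j k T) :
    extendChain D 𝕜 i j k (component D 𝕜 i j k w) = w := extendZero_restrict h

theorem extendChain_of_not_mem {i j k : ℤ} (v : D.StateOf i j k → 𝕜) {T : D.EnhancedState}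
    (hT : ¬ D.HasGrade i j k T) : extendChain D 𝕜 i j k v T = 0 := extendZero_of_not_mem v hT

theorem component_totalD (w : D.EnhancedState → 𝕜) {i i' : ℤ} (j k : ℤ) (hi : i' = i + 1) :
    component D 𝕜 i' j k (totalD D 𝕜 w) = D.d 𝕜 i i' j k (component D 𝕜 i j k w) := by
  classical
  funext T
  change ∑ S, _ = ∑ S : D.StateOf i j k, ((EnhancedState.incidence S.1 T.1 : ℤ) : 𝕜) * w S.1
  rw [← Finset.sum_filter_add_sum_filter_not Finset.univ (D.HasGrade i j k)]
  rw [Finset.sum_eq_zero (s := Finset.univ.filter fun S => ¬ D.HasGrade i j k S), add_zero]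
  · rw [← Finset.sum_subtype_eq_sum_filter]
    refine Finset.sum_congr ?_ fun _ _ => rfl
    ext S
    exact iff_of_true (by simp) (@Finset.mem_univ (D.StateOf i j k) _ S)
  · intro S hS
    rw [Finset.mem_filter] at hS
    by_contra h
    change ((EnhancedState.incidence S T.1 : ℤ) : 𝕜) * w S ≠ 0 at h
    obtain ⟨h1, h2, h3⟩ := EnhancedState.gradings_of_incidence_ne_zero
      (fun h0 => h (by rw [h0]; simp) : EnhancedState.incidence S T.1 ≠ 0)
    obtain ⟨t1, t2, t3⟩ := T.2
    exact hS.2 ⟨by linarith, by rw [← h2, t2], by rw [← h3, t3]⟩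

theorem totalD_extendChain (i j k : ℤ) (v : D.StateOf i j k → 𝕜) :
    totalD D 𝕜 (extendChain D 𝕜 i j k v) =
      extendChain D 𝕜 (i + 1) j k (D.d 𝕜 i (i + 1) j k v) := by
  have hsupp : ∀ T, totalD D 𝕜 (extendChain D 𝕜 i j k v) T ≠ 0 → D.HasGrade (i + 1) j k T := by
    intro T hT
    obtain ⟨S, -, hS⟩ := Finset.exists_ne_zero_of_sum_ne_zero hT
    obtain ⟨h0, hv⟩ := ne_zero_and_ne_zero_of_mul
      (show ((EnhancedState.incidence S T : ℤ) : 𝕜) * extendChain D 𝕜 i j k v S ≠ 0 from hS)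
    obtain ⟨h1, h2, h3⟩ := EnhancedState.gradings_of_incidence_ne_zero
      (fun h => h0 (by rw [h, Int.cast_zero]) : EnhancedState.incidence S T ≠ 0)
    have hg : D.HasGrade i j k S := by
      by_contra hg
      exact hv (extendChain_of_not_mem v hg)
    obtain ⟨s1, s2, s3⟩ := hg
    exact ⟨by rw [h1, s1], by rw [h2, s2], by rw [h3, s3]⟩
  rw [← extendChain_component hsupp, component_totalD _ _ _ rfl, component_extendChain]

end AnnularDiagram

open AnnularDiagram in
/-- A homogeneous, injective and exhaustive family of cycles is a basis of the homology. -/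
theorem AKh.nonempty_linearEquiv.{u} {𝕜 : Type u} [Field 𝕜] {N : ℕ} {E : Type} [Fintype E]
    {D : AnnularDiagram N E} {M : Type*} (h q a : M → ℤ)
    (f : (M → 𝕜) →ₗ[𝕜] (D.EnhancedState → 𝕜)) (hinj : Function.Injective f)
    (hcycle : ∀ z, totalD D 𝕜 (f z) = 0) (hex : IsExhaustive f (totalD D 𝕜))
    (hsq : ∀ z, totalD D 𝕜 (totalD D 𝕜 z) = 0)
    (hhom : ∀ z T, f z T ≠ 0 → ∃ m, z m ≠ 0 ∧ T.hdeg = h m ∧ T.qdeg = q m ∧ T.adeg = a m)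
    (i j k : ℤ) :
    Nonempty (({m // h m = i ∧ q m = j ∧ a m = k} → 𝕜) ≃ₗ[𝕜] AKh 𝕜 D i j k) := by
  let p : M → Prop := fun m => h m = i ∧ q m = j ∧ a m = k
  -- `f` maps chains of trigrading `(i, j, k)` to such chains
  have hsupp : ∀ z : {m // p m} → 𝕜,
      extendChain D 𝕜 i j k (component D 𝕜 i j k (f (extendZero 𝕜 p z))) = f (extendZero 𝕜 p z) := by
    intro z
    refine extendChain_component fun T hT => ?_
    obtain ⟨m, h1, h2, h3, h4⟩ := hhom _ _ hT
    obtain ⟨⟨g1, g2, g3⟩, -⟩ := mem_of_extendZero_ne_zero h1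
    exact ⟨h2.trans g1, h3.trans g2, h4.trans g3⟩
  -- the part of trigrading `(i, j, k)` of `f z` depends only on that of `z`
  have hpart : ∀ z : M → 𝕜,
      component D 𝕜 i j k (f z) = component D 𝕜 i j k (f (extendZero 𝕜 p (restrict 𝕜 p z))) := by
    intro z
    rw [← sub_eq_zero, ← map_sub, ← map_sub]
    funext T
    by_contra hT
    obtain ⟨m, h1, h2, h3, h4⟩ := hhom _ _ hT
    obtain ⟨t1, t2, t3⟩ := T.2
    have hm : p m := ⟨h2.symm.trans t1, h3.symm.trans t2, h4.symm.trans t3⟩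
    refine h1 ?_
    rw [Pi.sub_apply, extendZero_of_mem _ hm, restrict_apply, sub_self]
  have hker : ∀ z : {m // p m} → 𝕜,
      component D 𝕜 i j k (f (extendZero 𝕜 p z)) ∈ LinearMap.ker (D.d 𝕜 i (i + 1) j k) := by
    intro z
    rw [LinearMap.mem_ker]
    apply extendChain_injective (𝕜 := 𝕜)
    rw [map_zero]
    refine (totalD_extendChain i j k _).symm.trans ?_
    exact (congrArg (totalD D 𝕜) (hsupp z)).trans (hcycle _)
  let g : ({m // p m} → 𝕜) →ₗ[𝕜] LinearMap.ker (D.d 𝕜 i (i + 1) j k) :=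
    LinearMap.codRestrict _ (component D 𝕜 i j k ∘ₗ f ∘ₗ extendZero 𝕜 p) hker
  let B := (LinearMap.range (D.d 𝕜 (i - 1) i j k)).submoduleOf (LinearMap.ker (D.d 𝕜 i (i + 1) j k))
  refine ⟨LinearEquiv.ofBijective (B.mkQ ∘ₗ g) ⟨?_, ?_⟩⟩
  · rw [← LinearMap.ker_eq_bot, LinearMap.ker_eq_bot']
    intro z hz
    have hz' : g z ∈ B := (Submodule.Quotient.mk_eq_zero B).1 hz
    obtain ⟨v, hv⟩ : component D 𝕜 i j k (f (extendZero 𝕜 p z)) ∈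
      LinearMap.range (D.d 𝕜 (i - 1) i j k) := hz'
    -- a boundary in the image of `f` vanishes
    have h1 : totalD D 𝕜 (extendChain D 𝕜 (i - 1) j k v) = f (extendZero 𝕜 p z) := by
      rw [totalD_extendChain, ← hsupp z, ← hv, sub_add_cancel]
    obtain ⟨y, w, hw⟩ := hex _ ⟨_, h1.symm⟩
    have h2 := hcycle w
    rw [hw, map_sub, hsq, sub_zero, h1] at h2
    exact extendZero_injective (hinj (by rw [h2, map_zero, map_zero]))
  · intro c
    obtain ⟨⟨v, hv⟩, rfl⟩ := B.mkQ_surjective c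
    rw [LinearMap.mem_ker] at hv
    have h1 : totalD D 𝕜 (extendChain D 𝕜 i j k v) = 0 := by
      refine (totalD_extendChain i j k v).trans ?_
      rw [hv, map_zero]
    obtain ⟨y, w, hw⟩ := hex (extendChain D 𝕜 i j k v) ⟨0, by rw [h1, map_zero]⟩
    refine ⟨restrict 𝕜 p w, (Submodule.Quotient.eq B).2 ?_⟩
    refine ⟨- component D 𝕜 (i - 1) j k y, ?_⟩
    rw [map_neg]
    change _ = component D 𝕜 i j k (f (extendZero 𝕜 p (restrict 𝕜 p w))) - v
    rw [← hpart, hw, map_sub, component_extendChain, sub_sub_cancel_left]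
    rw [component_totalD y j k (sub_add_cancel i 1).symm]

/-! ### The number of generators of the homology -/

/-- The indicator of a proposition. -/
noncomputable def ind (p : Prop) : ℤ := open scoped Classical in if p then 1 else 0

theorem ind_eq (p : Prop) [Decidable p] : ind p = if p then 1 else 0 := by
  unfold ind
  congr

theorem ind_congr {p q : Prop} (h : p ↔ q) : ind p = ind q := by rw [propext h]

namespace SState

/-- The number of `1`-smoothings is `d`, the unnormalized quantum grading is `q`, and the annular
grading is `k`. -/
def HasDegrees {n : ℕ} (S : SState n) (d q k : ℤ) : Prop :=
  S.deg = d ∧ S.deg + S.sum = q ∧ S.ann = k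

/-- The number of critical generators with the given degrees. -/
noncomputable def criticalCount (n : ℕ) (d q k : ℤ) : ℤ :=
  ∑ S : SState n, ind (S.IsCritical ∧ S.HasDegrees d q k)

/-- The number of critical generators with the given degrees that remain critical after the addition
of a half twist. -/
noncomputable def stableCount (n : ℕ) (d q k : ℤ) : ℤ :=
  ∑ S : SState n, ind (S.IsCritical ∧ (∀ u, next n u ≠ some S) ∧ S.HasDegrees d q k)

theorem isCritical_nil (b : BaseGen) : IsCritical (.nil b) :=
  ⟨rfl, fun | .nil _ => by simp [match?]⟩

theorem isCritical_inl {n : ℕ} (u : CapGen) :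
    IsCritical (.inl u : SState (n + 1)) ↔ next n u = none := by
  refine ⟨fun h => by simpa [match?] using h.1, fun h => ⟨by simp [match?, h], ?_⟩⟩
  rintro (_ | _ | _) <;> simp [match?]

theorem isCritical_inr {n : ℕ} (y : SState n) :
    IsCritical (.inr y) ↔ IsCritical y ∧ ∀ u, next n u ≠ some y := by
  constructor
  · rintro ⟨h1, h2⟩
    refine ⟨⟨by simpa [match?] using h1, fun S' h => h2 (.inr S') (by simp [match?, h])⟩,
      fun u h => h2 (.inl u) (by simp [match?, h])⟩
  · rintro ⟨⟨h1, h2⟩, h3⟩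
    refine ⟨by simp [match?, h1], ?_⟩
    rintro (_ | _ | S')
    · simpa [match?] using h3 _
    · simpa [match?] using h2 S'

theorem hasDegrees_inr {n : ℕ} (y : SState n) (d q k : ℤ) :
    HasDegrees (.inr y) d q k ↔ y.HasDegrees (d - 1) (q - 1) k := by
  simp only [HasDegrees, deg, sum, ann]
  push_cast
  constructor <;> rintro ⟨h1, h2, h3⟩ <;> refine ⟨?_, ?_, h3⟩ <;> linarith

theorem next_ne_inr {n : ℕ} (u : CapGen) (y : SState n) : next (n + 1) u ≠ some (.inr y) := by
  cases u <;> simp [next]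

theorem criticalCount_succ (n : ℕ) (d q k : ℤ) : criticalCount (n + 1) d q k =
    ∑ u, ind (next n u = none ∧ HasDegrees (.inl u : SState (n + 1)) d q k) +
      stableCount n (d - 1) (q - 1) k := by
  rw [criticalCount, stableCount, sum_succ]
  simp only [isCritical_inl, isCritical_inr, hasDegrees_inr, and_assoc]

theorem stableCount_succ (n : ℕ) (d q k : ℤ) : stableCount (n + 1) d q k =
    ∑ u, ind (next n u = none ∧ (∀ v, next (n + 1) v ≠ some (.inl u)) ∧
      HasDegrees (.inl u : SState (n + 1)) d q k) + stableCount n (d - 1) (q - 1) k := by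
  rw [stableCount, stableCount, sum_succ]
  simp only [isCritical_inl, isCritical_inr, hasDegrees_inr, and_assoc, ne_eq, next_ne_inr,
    not_false_eq_true, implies_true, true_and]

theorem hasDegrees_inl {n : ℕ} (u : CapGen) (d q k : ℤ) :
    HasDegrees (.inl u : SState (n + 1)) d q k ↔
      (u.deg : ℤ) = d ∧ u.deg + (u.sum - n) = q ∧ 0 = k := Iff.rfl

theorem next_diff_eq_none (n : ℕ) : next n .diff = none ↔ n % 2 = 0 := by
  rcases n with _ | n
  · simp [next]
  · simp [next]
    grind

theorem next_prod_eq_none (n : ℕ) : next n .prod = none ↔ True := by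
  cases n <;> simp [next]

theorem next_pos_eq_none (n : ℕ) : next n .pos = none ↔ n % 2 = 1 := by
  rcases n with _ | n
  · simp [next]
  · simp [next]
    grind

theorem next_neg_eq_none (n : ℕ) : next n .neg = none ↔ True := by
  cases n <;> simp [next]

theorem forall_capGen {p : CapGen → Prop} : (∀ u, p u) ↔ p .diff ∧ p .prod ∧ p .pos ∧ p .neg :=
  ⟨fun h => ⟨h _, h _, h _, h _⟩, fun h u => by cases u <;> simp [h]⟩

theorem next_ne_diff (n : ℕ) : (∀ v, next (n + 1) v ≠ some (.inl .diff)) ↔ True := by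
  simp [forall_capGen, next]

theorem next_ne_prod (n : ℕ) : (∀ v, next (n + 1) v ≠ some (.inl .prod)) ↔ n % 2 = 1 := by
  simp [forall_capGen, next]
  grind

theorem next_ne_pos (n : ℕ) : (∀ v, next (n + 1) v ≠ some (.inl .pos)) ↔ True := by
  simp [forall_capGen, next]

theorem next_ne_neg (n : ℕ) : (∀ v, next (n + 1) v ≠ some (.inl .neg)) ↔ n % 2 = 0 := by
  simp [forall_capGen, next]
  grind

/-- Contribution to `stableCount` of the generators of annular grading zero whose quantum grading is
one more than `2 * d - n`. -/
def upperCount (n : ℕ) (d : ℤ) : ℤ :=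
  (if 0 ≤ d ∧ d ≤ n - 1 ∧ (n - 1 - d) % 2 = 0 then 1 else 0) +
    (if 2 ≤ d ∧ d ≤ n + 1 ∧ (n + 1 - d) % 2 = 1 then 1 else 0)

/-- Contribution to `stableCount` of the generators of annular grading zero whose quantum grading is
one less than `2 * d - n`. -/
def lowerCount (n : ℕ) (d : ℤ) : ℤ :=
  (if 0 ≤ d ∧ d ≤ n - 1 ∧ (n - 1 - d) % 2 = 1 then 1 else 0) +
    (if 2 ≤ d ∧ d ≤ n + 1 ∧ (n + 1 - d) % 2 = 0 then 1 else 0) +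
    (if n ≤ d ∧ d ≤ n + 2 then 1 else 0)

theorem upperCount_succ (n : ℕ) (d : ℤ) : upperCount (n + 1) d =
    upperCount n (d - 1) + (if d = 0 ∧ n % 2 = 0 then 1 else 0) +
      (if d = 2 ∧ n % 2 = 1 then 1 else 0) := by
  simp only [upperCount]
  push_cast
  split_ifs <;> omega

theorem lowerCount_succ (n : ℕ) (d : ℤ) : lowerCount (n + 1) d =
    lowerCount n (d - 1) + (if d = 0 ∧ n % 2 = 1 then 1 else 0) +
      (if d = 2 ∧ n % 2 = 0 then 1 else 0) := by
  simp only [lowerCount]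
  push_cast
  split_ifs <;> omega

/-- The value of `stableCount`. -/
def stableFormula (n : ℕ) (d q k : ℤ) : ℤ :=
  (if k = 0 ∧ q = 2 * d - n + 1 then upperCount n d else 0) +
    (if k = 0 ∧ q = 2 * d - n - 1 then lowerCount n d else 0) +
    (if (k = 2 ∨ k = -2) ∧ d = n + 1 ∧ q = d + k then 1 else 0) +
    (if (k = 2 ∨ k = -2) ∧ d = n + 2 ∧ q = d + k + 1 then 1 else 0)

theorem stableCount_eq (n : ℕ) (d q k : ℤ) : stableCount n d q k = stableFormula n d q k := by
  induction n generalizing d q k with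
  | zero =>
    have h : ∀ b, IsCritical (.nil b) ∧ (∀ u, next 0 u ≠ some (.nil b)) ∧
        HasDegrees (.nil b) d q k ↔ b ≠ .sym ∧ (b.deg : ℤ) = d ∧ b.deg + b.sum = q ∧ b.ann = k := by
      intro b
      refine (and_iff_right (isCritical_nil b)).trans (and_congr_left' ⟨?_, ?_⟩)
      · rintro h rfl
        exact h .pos rfl
      · intro h u
        cases u <;> simp [next, h.symm]
    rw [stableCount, sum_nil, BaseGen.sum_univ]
    simp only [ind_congr (h _), ind_eq]
    by_cases hd : d = 0 ∨ d = 1 ∨ d = 2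
    · by_cases hk : k = 0 ∨ k = 2 ∨ k = -2
      · rcases hd with rfl | rfl | rfl <;> rcases hk with rfl | rfl | rfl <;>
          simp [BaseGen.deg, BaseGen.sum, BaseGen.ann, sgnInt, stableFormula, upperCount,
            lowerCount] <;> grind
      · have hk' : ∀ b : BaseGen, b.ann ≠ k := fun b hb => hk (by
          subst hb; clear h; revert b; decide)
        simp only [hk', and_false, if_false, stableFormula]
        grind
    · have hd' : ∀ b : BaseGen, (b.deg : ℤ) ≠ d := fun b hb => hd (by
        subst hb; clear h; revert b; decide)
      simp only [hd', and_false, false_and, if_false, stableFormula, upperCount, lowerCount]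
      grind
  | succ n ih =>
    rw [stableCount_succ, ih, CapGen.sum_univ]
    simp only [next_diff_eq_none, next_prod_eq_none, next_pos_eq_none, next_neg_eq_none,
      next_ne_diff, next_ne_prod, next_ne_pos, next_ne_neg, hasDegrees_inl, CapGen.deg, CapGen.sum,
      ind_eq, stableFormula, upperCount_succ, lowerCount_succ]
    push_cast
    by_cases hk : k = 0
    · subst hk
      by_cases h1 : q = 2 * d - n
      · subst h1
        grind (splits := 20)
      · by_cases h2 : q = 2 * d - n - 2
        · subst h2
          grind (splits := 20)
        · grind
    · grind

/-- The value of `criticalCount` for at least one half twist. -/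
def criticalFormula (n : ℕ) (d q k : ℤ) : ℤ :=
  (if k = 0 ∧ (n % 2 = 0 ∧ d = 0 ∧ q = - n ∨ d = 0 ∧ q = - n - 2 ∨
    n % 2 = 1 ∧ d = 2 ∧ q = 4 - n ∨ d = 2 ∧ q = 2 - n) then 1 else 0) +
    stableFormula n (d - 1) (q - 1) k

theorem criticalCount_eq (n : ℕ) (d q k : ℤ) :
    criticalCount (n + 1) d q k = criticalFormula n d q k := by
  rw [criticalCount_succ, stableCount_eq, CapGen.sum_univ, criticalFormula]
  congr 1
  simp only [next_diff_eq_none, next_prod_eq_none, next_pos_eq_none, next_neg_eq_none,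
    hasDegrees_inl, CapGen.deg, CapGen.sum, ind_eq]
  push_cast
  grind (splits := 20)

theorem criticalCount_zero (d q k : ℤ) : criticalCount 0 d q k =
    ∑ b : BaseGen, if (b.deg : ℤ) = d ∧ b.deg + b.sum = q ∧ b.ann = k then 1 else 0 := by
  rw [criticalCount, sum_nil]
  refine Finset.sum_congr rfl fun b _ => ?_
  exact (ind_congr (and_iff_right (isCritical_nil b))).trans (ind_eq (_ ∧ _ ∧ _))

end SState

/-! ### Dimensions -/

theorem isPositive_zero (n : ℕ) :
    (claspBraid n).IsPositive 0 ↔ ¬ n % 2 = 0 := by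
  change false ≠ !decide (Even n) ↔ _
  rw [← Nat.even_iff]
  simp

theorem isPositive_one (n : ℕ) :
    (claspBraid n).IsPositive (Fin.succ 0) ↔ ¬ n % 2 = 0 := by
  change decide (Even n) ≠ true ↔ _
  rw [← Nat.even_iff]
  simp

theorem isPositive_twist (n k : ℕ) (hk : k + 2 < n + 2) :
    (claspBraid n).IsPositive ⟨k + 2, hk⟩ := by
  change (!decide (Even (n + k))) ≠ decide (Even (n + k))
  simp

theorem nMinus_claspBraid (n : ℕ) : (claspBraid n).nMinus = if n % 2 = 0 then 2 else 0 := by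
  unfold AnnularDiagram.nMinus
  rw [Finset.card_filter, Fin.sum_univ_succ, Fin.sum_univ_succ, Finset.sum_eq_zero, add_zero]
  · rw [if_congr (not_congr (isPositive_zero n)) rfl rfl,
      if_congr (not_congr (isPositive_one n)) rfl rfl]
    by_cases h : n % 2 = 0 <;> simp [h]
  · intro k _
    rw [if_neg]
    exact not_not.2 (isPositive_twist n k (by omega))

theorem nPlus_claspBraid (n : ℕ) : (claspBraid n).nPlus = if n % 2 = 0 then n else n + 2 := by
  have h : (claspBraid n).nPlus + (claspBraid n).nMinus = n + 2 := by
    unfold AnnularDiagram.nPlus AnnularDiagram.nMinus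
    rw [Finset.card_filter_add_card_filter_not, Finset.card_univ, Fintype.card_fin]
  rw [nMinus_claspBraid] at h
  split_ifs at h ⊢ <;> omega

namespace LState

variable {𝕜 : Type*} [Field 𝕜]

/-- Chains of `L n` as chains of its annular Khovanov complex. -/
noncomputable def transport (𝕜 : Type*) [Field 𝕜] (n : ℕ) :
    (LState n → 𝕜) ≃ₗ[𝕜] ((claspBraid n).EnhancedState → 𝕜) :=
  LinearEquiv.funCongrLeft 𝕜 𝕜 (stateEquiv n).symm

theorem transport_toState {n : ℕ} (z : LState n → 𝕜) (x : LState n) :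
    transport 𝕜 n z x.toState = z x :=
  congrArg z ((stateEquiv n).symm_apply_apply x)

theorem totalD_transport {n : ℕ} (z : LState n → 𝕜) :
    (claspBraid n).totalD 𝕜 (transport 𝕜 n z) = transport 𝕜 n (d 𝕜 n z) := by
  funext T
  obtain ⟨y, rfl⟩ := toState_surjective n T
  rw [transport_toState, AnnularDiagram.totalD, opMap_apply, d, opMap_apply,
    ← (stateEquiv n).sum_comp]
  refine Finset.sum_congr rfl fun x _ => ?_
  change ((AnnularDiagram.EnhancedState.incidence x.toState y.toState : ℤ) : 𝕜) *
    transport 𝕜 n z x.toState = _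
  rw [incidence_toState, transport_toState]

end LState

namespace SState

variable {𝕜 : Type*} [Field 𝕜]

/-- The critical generators as cycles of the annular Khovanov complex. -/
noncomputable def criticalCycles (𝕜 : Type*) [Field 𝕜] (n : ℕ) :
    ({S : SState n // S.IsCritical} → 𝕜) →ₗ[𝕜] ((claspBraid n).EnhancedState → 𝕜) :=
  (LState.transport 𝕜 n).toLinearMap ∘ₗ embed 𝕜 n ∘ₗ extendZero 𝕜 IsCritical

theorem criticalCycles_apply {n : ℕ} (z : {S : SState n // S.IsCritical} → 𝕜) :
    criticalCycles 𝕜 n z = LState.transport 𝕜 n (embed 𝕜 n (extendZero 𝕜 IsCritical z)) := rfl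

theorem criticalCycles_injective (n : ℕ) : Function.Injective (criticalCycles 𝕜 n) :=
  (LState.transport 𝕜 n).injective.comp ((embed_injective n).comp extendZero_injective)

theorem totalD_criticalCycles {n : ℕ} (z : {S : SState n // S.IsCritical} → 𝕜) :
    (claspBraid n).totalD 𝕜 (criticalCycles 𝕜 n z) = 0 := by
  rw [criticalCycles_apply, LState.totalD_transport, d_embed, d_extendZero, map_zero, map_zero]

theorem totalD_totalD {n : ℕ} (z : (claspBraid n).EnhancedState → 𝕜) :
    (claspBraid n).totalD 𝕜 ((claspBraid n).totalD 𝕜 z) = 0 := by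
  obtain ⟨w, rfl⟩ := (LState.transport 𝕜 n).surjective z
  rw [LState.totalD_transport, LState.totalD_transport, LState.d_d, map_zero]

theorem isExhaustive_criticalCycles (h2 : (2 : 𝕜) ≠ 0) (n : ℕ) :
    IsExhaustive (criticalCycles 𝕜 n) ((claspBraid n).totalD 𝕜) := by
  have h : IsExhaustive (embed 𝕜 n ∘ₗ extendZero 𝕜 IsCritical) (LState.d 𝕜 n) :=
    (isExhaustive_extendZero h2 n).comp (isExhaustive_embed n) (embed_injective n) d_embed
      LState.d_d
  intro z hz
  obtain ⟨w, rfl⟩ := (LState.transport 𝕜 n).surjective z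
  obtain ⟨c, hc⟩ := hz
  rw [LState.totalD_transport] at hc
  obtain ⟨y, m, hm⟩ := h w ⟨c, (LState.transport 𝕜 n).injective hc⟩
  refine ⟨LState.transport 𝕜 n y, m, ?_⟩
  rw [LState.totalD_transport, ← map_sub, ← hm]
  rfl

theorem exists_of_criticalCycles_ne_zero {n : ℕ} (z : {S : SState n // S.IsCritical} → 𝕜)
    (T : (claspBraid n).EnhancedState) (h : criticalCycles 𝕜 n z T ≠ 0) :
    ∃ S, z S ≠ 0 ∧ T.hdeg = S.1.deg - (claspBraid n).nMinus ∧
      T.qdeg = S.1.deg + S.1.sum + (claspBraid n).nPlus - 2 * (claspBraid n).nMinus ∧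
      T.adeg = S.1.ann := by
  obtain ⟨x, rfl⟩ := LState.toState_surjective n T
  rw [criticalCycles_apply, LState.transport_toState] at h
  obtain ⟨S, h1, h2, h3, h4⟩ := exists_of_embed_ne_zero n _ x h
  obtain ⟨hS, h5⟩ := mem_of_extendZero_ne_zero h1
  refine ⟨⟨S, hS⟩, h5, ?_, ?_, ?_⟩
  · rw [AnnularDiagram.EnhancedState.hdeg, LState.ones_toState, h2]
  · rw [AnnularDiagram.EnhancedState.qdeg, LState.ones_toState, LState.sum_sign_toState, h2, h3]
    ring
  · rw [LState.adeg_toState, h4]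

end SState

/-- The components of the bigraded vector space `A` are finite-dimensional, with dimensions given by
`f`. -/
def Bigraded.HasDim.{u} {𝕜 : Type u} [Field 𝕜] (A : Bigraded 𝕜) (f : ℤ → ℤ → ℤ) : Prop :=
  ∀ j k, Module.Finite 𝕜 (A j k) ∧ (Module.finrank 𝕜 (A j k) : ℤ) = f j k

namespace Bigraded

universe u

variable {𝕜 : Type u} [Field 𝕜]

theorem HasDim.iso {A B : Bigraded 𝕜} {f g : ℤ → ℤ → ℤ} (hA : A.HasDim f) (hB : B.HasDim g)
    (h : ∀ j k, f j k = g j k) : A.Iso B := by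
  intro j k
  have := (hA j k).1
  have := (hB j k).1
  refine FiniteDimensional.nonempty_linearEquiv_of_finrank_eq ?_
  have h' := h j k
  rw [← (hA j k).2, ← (hB j k).2] at h'
  exact_mod_cast h'

theorem HasDim.sum {A B : Bigraded 𝕜} {f g : ℤ → ℤ → ℤ} (hA : A.HasDim f) (hB : B.HasDim g) :
    (A.sum B).HasDim fun j k => f j k + g j k := by
  intro j k
  have := (hA j k).1
  have := (hB j k).1
  refine ⟨inferInstanceAs (Module.Finite 𝕜 (A j k × B j k)), ?_⟩
  change (Module.finrank 𝕜 (A j k × B j k) : ℤ) = _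
  rw [Module.finrank_prod, Nat.cast_add, (hA j k).2, (hB j k).2]

theorem HasDim.shift {A : Bigraded 𝕜} {f : ℤ → ℤ → ℤ} (hA : A.HasDim f) (b : ℤ) :
    (A.shift b).HasDim fun j k => f (j - b) k := fun j k => hA (j - b) k

theorem HasDim.congr {A : Bigraded 𝕜} {f g : ℤ → ℤ → ℤ} (hA : A.HasDim f)
    (h : ∀ j k, f j k = g j k) : A.HasDim g := fun j k => h j k ▸ hA j k

theorem finite_and_finrank_punit :
    Module.Finite 𝕜 PUnit.{u + 1} ∧ (Module.finrank 𝕜 PUnit.{u + 1} : ℤ) = 0 :=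
  ⟨inferInstance, by rw [Module.finrank_zero_of_subsingleton, Nat.cast_zero]⟩

theorem hasDim_zero : (zero 𝕜).HasDim fun _ _ => 0 := fun _ _ => finite_and_finrank_punit

theorem hasDim_V (m : ℕ) :
    (V 𝕜 m).HasDim fun j k => if j = k ∧ |k| ≤ m ∧ Even (k - m) then 1 else 0 := by
  intro j k
  by_cases h : j = k ∧ |k| ≤ m ∧ Even (k - m)
  · have hV : V 𝕜 m j k = ModuleCat.of 𝕜 𝕜 := if_pos h
    have h1 : (Module.finrank 𝕜 𝕜 : ℤ) = 1 := by rw [Module.finrank_self, Nat.cast_one]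
    rw [hV]
    beta_reduce
    rw [if_pos h]
    exact ⟨inferInstanceAs (Module.Finite 𝕜 𝕜), h1⟩
  · have hV : V 𝕜 m j k = ModuleCat.of 𝕜 PUnit := if_neg h
    rw [hV]
    beta_reduce
    rw [if_neg h]
    exact finite_and_finrank_punit

theorem hasDim_V_zero : (V 𝕜 0).HasDim fun j k => if j = 0 ∧ k = 0 then 1 else 0 := by
  refine (hasDim_V 0).congr fun j k => if_congr ?_ rfl rfl
  rw [Nat.cast_zero, abs_nonpos_iff]
  constructor
  · rintro ⟨rfl, rfl, -⟩
    exact ⟨rfl, rfl⟩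
  · rintro ⟨rfl, rfl⟩
    simp

theorem hasDim_V_two :
    (V 𝕜 2).HasDim fun j k => if j = k ∧ (k = 0 ∨ k = 2 ∨ k = -2) then 1 else 0 := by
  refine (hasDim_V 2).congr fun j k => if_congr (and_congr_right fun _ => ?_) rfl rfl
  rw [abs_le, Int.even_iff]
  push_cast
  omega

end Bigraded

theorem AKh.hasDim {𝕜 : Type*} [Field 𝕜] (h2 : (2 : 𝕜) ≠ 0) (n : ℕ) (i : ℤ) :
    (AKh 𝕜 (claspBraid n) i).HasDim fun j k =>
      SState.criticalCount n (i + (claspBraid n).nMinus)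
        (j - (claspBraid n).nPlus + 2 * (claspBraid n).nMinus) k := by
  classical
  intro j k
  obtain ⟨e⟩ := AKh.nonempty_linearEquiv
    (M := {S : SState n // S.IsCritical})
    (fun S => S.1.deg - (claspBraid n).nMinus)
    (fun S => S.1.deg + S.1.sum + (claspBraid n).nPlus - 2 * (claspBraid n).nMinus)
    (fun S => S.1.ann) (SState.criticalCycles 𝕜 n) (SState.criticalCycles_injective n)
    SState.totalD_criticalCycles (SState.isExhaustive_criticalCycles h2 n) SState.totalD_totalD
    SState.exists_of_criticalCycles_ne_zero i j k
  refine ⟨Module.Finite.equiv e, ?_⟩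
  change _ = SState.criticalCount n _ _ k
  rw [← e.finrank_eq, Module.finrank_fintype_fun_eq_card, Fintype.card_congr
    (Equiv.subtypeSubtypeEquivSubtypeInter SState.IsCritical fun S : SState n =>
      (S.deg - (claspBraid n).nMinus : ℤ) = i ∧
      (S.deg + S.sum + (claspBraid n).nPlus - 2 * (claspBraid n).nMinus : ℤ) = j ∧ S.ann = k),
    Fintype.card_subtype, Finset.card_filter, SState.criticalCount]
  push_cast
  refine Finset.sum_congr rfl fun S _ => ?_
  rw [← ind_eq]
  refine ind_congr (and_congr_right fun _ => ?_)
  unfold SState.HasDegrees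
  exact and_congr (by omega) (and_congr_left' (by omega))

/-! ### The homology of the clasp-braids -/

section

variable {𝕜 : Type*} [Field 𝕜]

theorem AKh.hasDim_even (h2 : (2 : 𝕜) ≠ 0) {n : ℕ} (hn : n % 2 = 0) (i : ℤ) :
    (AKh 𝕜 (claspBraid n) i).HasDim fun j k =>
      SState.criticalCount n (i + 2) (j - n + 4) k := by
  have h := AKh.hasDim h2 n i
  rw [nMinus_claspBraid, nPlus_claspBraid, if_pos hn, if_pos hn] at h
  exact h

theorem AKh.hasDim_odd (h2 : (2 : 𝕜) ≠ 0) {n : ℕ} (hn : n % 2 = 1) (i : ℤ) :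
    (AKh 𝕜 (claspBraid n) i).HasDim fun j k =>
      SState.criticalCount n i (j - n - 2) k := by
  have h := AKh.hasDim h2 n i
  rw [nMinus_claspBraid, nPlus_claspBraid, if_neg (by omega), if_neg (by omega)] at h
  refine h.congr fun j k => ?_
  congr 1 <;> push_cast <;> ring

open SState Bigraded

theorem AKh.iso_of_even (h2 : (2 : 𝕜) ≠ 0) {n : ℕ} (h1 : 1 ≤ n) (hn : Even n) (i : ℤ) :
    (AKh 𝕜 (claspBraid n) i).Iso
      (if i = n then (V 𝕜 2).shift (2 * n - 1)
      else if i = n - 1 then ((V 𝕜 2).shift (2 * n - 3)).sum ((V 𝕜 0).shift (2 * n - 3))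
      else if 1 ≤ i ∧ i ≤ n - 2 then
        ((V 𝕜 0).shift (2 * i + 1)).sum ((V 𝕜 0).shift (2 * i - 1))
      else if i = 0 then
        ((V 𝕜 0).shift 1).sum (((V 𝕜 0).shift (-1)).sum ((V 𝕜 0).shift (-1)))
      else if i = -1 then (V 𝕜 0).shift (-1)
      else if i = -2 then (V 𝕜 0).shift (-5)
      else Bigraded.zero 𝕜) := by
  obtain ⟨m, rfl⟩ : ∃ m, n = m + 1 := ⟨n - 1, by omega⟩
  have hm := Nat.even_iff.1 hn
  have h := (AKh.hasDim_even h2 hm i).congr fun j k => criticalCount_eq m _ _ _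
  have V0 := hasDim_V_zero (𝕜 := 𝕜)
  have V2 := hasDim_V_two (𝕜 := 𝕜)
  split_ifs with h1 h2 h3 h4 h5 h6
  · subst h1
    refine h.iso (V2.shift _) fun j k => ?_
    simp only [criticalFormula, stableFormula, upperCount, lowerCount]
    grind (splits := 30)
  · subst h2
    refine h.iso ((V2.shift _).sum (V0.shift _)) fun j k => ?_
    simp only [criticalFormula, stableFormula, upperCount, lowerCount]
    grind (splits := 30)
  · refine h.iso ((V0.shift _).sum (V0.shift _)) fun j k => ?_
    simp only [criticalFormula, stableFormula, upperCount, lowerCount]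
    grind (splits := 30)
  · subst h4
    refine h.iso ((V0.shift _).sum ((V0.shift _).sum (V0.shift _))) fun j k => ?_
    simp only [criticalFormula, stableFormula, upperCount, lowerCount]
    grind (splits := 30)
  · subst h5
    refine h.iso (V0.shift _) fun j k => ?_
    simp only [criticalFormula, stableFormula, upperCount, lowerCount]
    grind (splits := 30)
  · subst h6
    refine h.iso (V0.shift _) fun j k => ?_
    simp only [criticalFormula, stableFormula, upperCount, lowerCount]
    grind (splits := 30)
  · refine h.iso hasDim_zero fun j k => ?_
    simp only [criticalFormula, stableFormula, upperCount, lowerCount]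
    grind (splits := 30)

theorem AKh.iso_of_odd (h2 : (2 : 𝕜) ≠ 0) {n : ℕ} (hn : Odd n) (i : ℤ) :
    (AKh 𝕜 (claspBraid n) i).Iso
      (if i = n + 2 then (V 𝕜 2).shift (2 * n + 5)
      else if i = n + 1 then ((V 𝕜 2).shift (2 * n + 3)).sum ((V 𝕜 0).shift (2 * n + 3))
      else if 2 ≤ i ∧ i ≤ n then
        ((V 𝕜 0).shift (2 * i + 1)).sum ((V 𝕜 0).shift (2 * i + 3))
      else if i = 1 then (V 𝕜 0).shift 3
      else if i = 0 then ((V 𝕜 0).shift 3).sum ((V 𝕜 0).shift 1)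
      else Bigraded.zero 𝕜) := by
  have hm := Nat.odd_iff.1 hn
  obtain ⟨m, rfl⟩ : ∃ m, n = m + 1 := ⟨n - 1, by omega⟩
  have h := (AKh.hasDim_odd h2 hm i).congr fun j k => criticalCount_eq m _ _ _
  have V0 := hasDim_V_zero (𝕜 := 𝕜)
  have V2 := hasDim_V_two (𝕜 := 𝕜)
  split_ifs with h1 h2 h3 h4 h5
  · subst h1
    refine h.iso (V2.shift _) fun j k => ?_
    simp only [criticalFormula, stableFormula, upperCount, lowerCount]
    grind (splits := 30)
  · subst h2
    refine h.iso ((V2.shift _).sum (V0.shift _)) fun j k => ?_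
    simp only [criticalFormula, stableFormula, upperCount, lowerCount]
    grind (splits := 30)
  · refine h.iso ((V0.shift _).sum (V0.shift _)) fun j k => ?_
    simp only [criticalFormula, stableFormula, upperCount, lowerCount]
    grind (splits := 30)
  · subst h4
    refine h.iso (V0.shift _) fun j k => ?_
    simp only [criticalFormula, stableFormula, upperCount, lowerCount]
    grind (splits := 30)
  · subst h5
    refine h.iso ((V0.shift _).sum (V0.shift _)) fun j k => ?_
    simp only [criticalFormula, stableFormula, upperCount, lowerCount]
    grind (splits := 30)
  · refine h.iso hasDim_zero fun j k => ?_
    simp only [criticalFormula, stableFormula, upperCount, lowerCount]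
    grind (splits := 30)

theorem AKh.iso_zero (h2 : (2 : 𝕜) ≠ 0) (i : ℤ) :
    (AKh 𝕜 (claspBraid 0) i).Iso
      (if i = 0 then ((V 𝕜 2).shift (-1)).sum ((V 𝕜 0).shift (-1))
      else if i = -1 then (V 𝕜 2).shift (-3)
      else if i = -2 then (V 𝕜 0).shift (-5)
      else Bigraded.zero 𝕜) := by
  have h := (AKh.hasDim_even h2 (n := 0) rfl i).congr fun j k => criticalCount_zero _ _ _
  simp only [BaseGen.sum_univ, BaseGen.deg, BaseGen.sum, BaseGen.ann, sgnInt] at h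
  have V0 := hasDim_V_zero (𝕜 := 𝕜)
  have V2 := hasDim_V_two (𝕜 := 𝕜)
  split_ifs with h1 h2 h3
  · subst h1
    refine h.iso ((V2.shift _).sum (V0.shift _)) fun j k => ?_
    simp
    grind (splits := 30)
  · subst h2
    refine h.iso (V2.shift _) fun j k => ?_
    simp
    grind (splits := 30)
  · subst h3
    refine h.iso (V0.shift _) fun j k => ?_
    simp
    grind (splits := 30)
  · refine h.iso hasDim_zero fun j k => ?_
    grind (splits := 30)

end

theorem lemma8p3 {𝕜 : Type*} [Field 𝕜] (h2 : (2 : 𝕜) ≠ 0) :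
    (∀ n : ℕ, 1 ≤ n → Even n → ∀ i : ℤ,
      (AKh 𝕜 (claspBraid n) i).Iso
        (if i = n then (Bigraded.V 𝕜 2).shift (2 * n - 1)
        else if i = n - 1 then
          ((Bigraded.V 𝕜 2).shift (2 * n - 3)).sum ((Bigraded.V 𝕜 0).shift (2 * n - 3))
        else if 1 ≤ i ∧ i ≤ n - 2 then
          ((Bigraded.V 𝕜 0).shift (2 * i + 1)).sum ((Bigraded.V 𝕜 0).shift (2 * i - 1))
        else if i = 0 then
          ((Bigraded.V 𝕜 0).shift 1).sum
            (((Bigraded.V 𝕜 0).shift (-1)).sum ((Bigraded.V 𝕜 0).shift (-1)))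
        else if i = -1 then (Bigraded.V 𝕜 0).shift (-1)
        else if i = -2 then (Bigraded.V 𝕜 0).shift (-5)
        else Bigraded.zero 𝕜)) ∧
    (∀ n : ℕ, 1 ≤ n → Odd n → ∀ i : ℤ,
      (AKh 𝕜 (claspBraid n) i).Iso
        (if i = n + 2 then (Bigraded.V 𝕜 2).shift (2 * n + 5)
        else if i = n + 1 then
          ((Bigraded.V 𝕜 2).shift (2 * n + 3)).sum ((Bigraded.V 𝕜 0).shift (2 * n + 3))
        else if 2 ≤ i ∧ i ≤ n then
          ((Bigraded.V 𝕜 0).shift (2 * i + 1)).sum ((Bigraded.V 𝕜 0).shift (2 * i + 3))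
        else if i = 1 then (Bigraded.V 𝕜 0).shift 3
        else if i = 0 then ((Bigraded.V 𝕜 0).shift 3).sum ((Bigraded.V 𝕜 0).shift 1)
        else Bigraded.zero 𝕜)) ∧
    (∀ i : ℤ,
      (AKh 𝕜 (claspBraid 0) i).Iso
        (if i = 0 then ((Bigraded.V 𝕜 2).shift (-1)).sum ((Bigraded.V 𝕜 0).shift (-1))
        else if i = -1 then (Bigraded.V 𝕜 2).shift (-3)
        else if i = -2 then (Bigraded.V 𝕜 0).shift (-5)
        else Bigraded.zero 𝕜)) := by
  exact ⟨fun _ h1 hn i => AKh.iso_of_even h2 h1 hn i, fun _ _ hn i => AKh.iso_of_odd h2 hn i,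
    fun i => AKh.iso_zero h2 i⟩
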